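/- Let $\Omega=\mathbb R^2$ or $\Omega=\mathbb R^2/\mathbb Z^2$, let $0<T^*\le\infty$, and let $\theta$ be a classical solution on $\Omega\times[0,T^*)$ of the surface quasi-geostrophic equation $$\partial_t\theta+u\cdot\nabla\theta=0,\qquad u=\nabla^\perp\psi=(-\partial_{x_2}\psi,\partial_{x_1}\psi),\qquad \psi=(-\Delta)^{-1/2}\theta,\qquad \theta(\cdot,0)=\theta_0 .$$ Here $\theta\in C^1(\Omega\times[0,T^*))$, the norm $\|\theta(\cdot,t)\|_{L^1(\Omega)}+\|\theta(\cdot,t)\|_{L^\infty(\Omega)}$ is bounded on $[0,T']$ for every $T'<T^*$, and $\psi(\cdot,t)\in C^1(\Omega)$ for every $t$; the operator $(-\Delta)^{-1/2}$ is convolution with $\frac1{2\pi|x|}$ on $\mathbb R^2$, and the Fourier multiplier $\hat\psi(k)=\hat\theta(k)/(2\pi|k|)$ for $k\ne0$, $\hat\psi(0)=0$, on the torus. (Functions on the torus are regarded as $\mathbb Z^2$-periodic functions on $\mathbb R^2$.) Let $a<b$ and let $\varphi_1,\varphi_2\in C^1([a,b]\times[0,T^*))$ be real-valued functions whose graphs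 $x_2=\varphi_i(x_1,t)$ are nondegenerate level curves of $\theta$: there are constants $g_1,g_2$ with $$\theta(x_1,\varphi_i(x_1,t),t)=g_i,\qquad \partial_{x_2}\theta(x_1,\varphi_i(x_1,t),t)\neq0\qquad(x_1\in[a,b],\ t\in[0,T^*)).$$ Put $\delta(x_1,t)=|\varphi_2(x_1,t)-\varphi_1(x_1,t)|$ and $\delta(t)=\min_{x_1\in[a,b]}\delta(x_1,t)$. Suppose that the two curves form a semi-uniform front, that is, for some constant $c>0$, $$\min_{x_1\in[a,b]}\delta(x_1,t)\ \ge\ c\,\max_{x_1\in[a,b]}\delta(x_1,t)\qquad\text{for all }t\in[0,T^*),$$ and that $\delta(0)>0$. Then $$\delta(t)>e^{-e^{At+B}}\qquad\text{for all }t\in[0,T^*),$$ with real constants $A,B$ that depend only on the length $b-a$ of the front, the semi-uniformity constant $c$, the initial thickness $\delta(0)$, and the norm $\|\theta_0\|_{L^1(\Omega)}+\|\theta_0\|_{L^\infty(\Omega)}$. -/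

import Mathlib

open MeasureTheory Set
open scoped ENNReal NNReal

noncomputable section

namespace QG

/-- The spatial domain: the plane `ℝ²` or the torus `ℝ²/ℤ²`. Functions on the torus are
represented by `ℤ²`-periodic functions on `ℝ × ℝ`. -/
inductive Domain
  | plane
  | torus

/-- The unit square, a fundamental domain of the torus. -/
def unitSquare : Set (ℝ × ℝ) := Ico (0 : ℝ) 1 ×ˢ Ico (0 : ℝ) 1

/-- Lebesgue measure of the domain. -/
def Domain.measure : Domain → Measure (ℝ × ℝ)
  | .plane => volume
  | .torus => volume.restrict unitSquare

/-- `f : ℝ × ℝ → ℝ` is a function on the domain. -/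
def Domain.IsFunction : Domain → (ℝ × ℝ → ℝ) → Prop
  | .plane, _ => True
  | .torus, f => ∀ x : ℝ × ℝ, f (x.1 + 1, x.2) = f x ∧ f (x.1, x.2 + 1) = f x

/-- The norm of `L¹ ∩ L^∞`. -/
def normL1Linf (Ω : Domain) (f : ℝ × ℝ → ℝ) : ℝ≥0∞ :=
  eLpNorm f 1 Ω.measure + eLpNorm f ⊤ Ω.measure

/-- The Euclidean norm (the norm instance of `ℝ × ℝ` is the sup norm). -/
def euclid (x : ℝ × ℝ) : ℝ := Real.sqrt (x.1 ^ 2 + x.2 ^ 2)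

/-- Fourier coefficients of a `ℤ²`-periodic function. -/
def fourierCoeff₂ (f : ℝ × ℝ → ℝ) (k : ℤ × ℤ) : ℂ :=
  ∫ x in unitSquare,
    (f x : ℂ) * Complex.exp (-(2 * Real.pi * Complex.I * (k.1 * x.1 + k.2 * x.2)))

/-- `ψ = (-Δ)^{-1/2} θ`. On the plane this is the Riesz potential of order one, whose kernel is
`1 / (2π|x - y|)`; on the torus it is the Fourier multiplier `1 / (2π|k|)`, `k ≠ 0`, with `ψ`
normalized to have mean zero. -/
def IsInvSqrtLaplacian : Domain → (ℝ × ℝ → ℝ) → (ℝ × ℝ → ℝ) → Prop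
  | .plane, θ, ψ => ∀ x, ψ x = (1 / (2 * Real.pi)) * ∫ y, θ y / euclid (x - y)
  | .torus, θ, ψ => Domain.torus.IsFunction ψ ∧
      ∀ k : ℤ × ℤ, fourierCoeff₂ ψ k =
        if k = 0 then 0
        else fourierCoeff₂ θ k / ((2 * Real.pi * euclid ((k.1 : ℝ), (k.2 : ℝ)) : ℝ) : ℂ)

/-- `∂f/∂x₁`. -/
def d₁ (f : ℝ × ℝ → ℝ) (x : ℝ × ℝ) : ℝ := deriv (fun s => f (s, x.2)) x.1

/-- `∂f/∂x₂`. -/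
def d₂ (f : ℝ × ℝ → ℝ) (x : ℝ × ℝ) : ℝ := deriv (fun s => f (x.1, s)) x.2

/-- The time interval `[0, T)`, `T ≤ ∞`. -/
def timeInterval (T : EReal) : Set ℝ := {t | 0 ≤ t ∧ (t : EReal) < T}

/-- `θ` is a classical solution of the quasi-geostrophic equation on `Ω × [0, T)` with stream
function `ψ`; both are written `θ x t`, `ψ x t`. The velocity is `u = (-∂₂ψ, ∂₁ψ)`. -/
structure IsSolution (Ω : Domain) (T : EReal) (θ ψ : ℝ × ℝ → ℝ → ℝ) : Prop where
  isFunction : ∀ t ∈ timeInterval T, Ω.IsFunction (fun x => θ x t)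
  contDiffOn : ContDiffOn ℝ 1 (fun p : (ℝ × ℝ) × ℝ => θ p.1 p.2) (univ ×ˢ timeInterval T)
  locallyBounded : ∀ T' ∈ timeInterval T, ∃ M : ℝ≥0, ∀ t ∈ Icc 0 T',
    normL1Linf Ω (fun x => θ x t) ≤ M
  stream : ∀ t ∈ timeInterval T, IsInvSqrtLaplacian Ω (fun x => θ x t) (fun x => ψ x t)
  stream_contDiff : ∀ t ∈ timeInterval T, ContDiff ℝ 1 (fun x => ψ x t)
  transport : ∀ t ∈ timeInterval T, 0 < t → ∀ x : ℝ × ℝ,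
    deriv (fun s => θ x s) t
      + (-d₂ (fun y => ψ y t) x * d₁ (fun y => θ y t) x
        + d₁ (fun y => ψ y t) x * d₂ (fun y => θ y t) x) = 0

/-- `x₂ = φ(x₁, t)`, `x₁ ∈ [a, b]`, `t ∈ [0, T)`, is a (nondegenerate) `C¹` level curve of `θ`
at the level `g`. -/
structure IsLevelCurve (T : EReal) (θ : ℝ × ℝ → ℝ → ℝ) (a b : ℝ) (φ : ℝ → ℝ → ℝ) (g : ℝ) :
    Prop where
  contDiffOn : ContDiffOn ℝ 1 (fun p : ℝ × ℝ => φ p.1 p.2) (Icc a b ×ˢ timeInterval T)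
  level : ∀ x ∈ Icc a b, ∀ t ∈ timeInterval T, θ (x, φ x t) t = g
  nondegenerate : ∀ x ∈ Icc a b, ∀ t ∈ timeInterval T,
    d₂ (fun y => θ y t) (x, φ x t) ≠ 0

/-- The thickness `δ(x₁, t)`. -/
def thickness (φ₁ φ₂ : ℝ → ℝ → ℝ) (x t : ℝ) : ℝ := |φ₂ x t - φ₁ x t|

/-- The minimum of `δ(·, t)` over `[a, b]`. -/
def minThickness (a b : ℝ) (φ₁ φ₂ : ℝ → ℝ → ℝ) (t : ℝ) : ℝ :=
  sInf ((fun x => thickness φ₁ φ₂ x t) '' Icc a b)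

/-- The maximum of `δ(·, t)` over `[a, b]`. -/
def maxThickness (a b : ℝ) (φ₁ φ₂ : ℝ → ℝ → ℝ) (t : ℝ) : ℝ :=
  sSup ((fun x => thickness φ₁ φ₂ x t) '' Icc a b)

/-- Two level curves of `θ` over `[a, b]` form a semi-uniform front with constant `c`. -/
structure IsSemiUniformFront (T : EReal) (θ : ℝ × ℝ → ℝ → ℝ) (a b c : ℝ)
    (φ₁ φ₂ : ℝ → ℝ → ℝ) : Prop where
  levelCurve₁ : ∃ g₁, IsLevelCurve T θ a b φ₁ g₁
  levelCurve₂ : ∃ g₂, IsLevelCurve T θ a b φ₂ g₂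
  semiUniform : ∀ t ∈ timeInterval T,
    c * maxThickness a b φ₁ φ₂ t ≤ minThickness a b φ₁ φ₂ t

end QG

end

/-!
Writing `1 / (2π|z|)` as a superposition of Gaussians reduces every estimate on the stream function
to one on Gaussian convolutions, to be integrated over the scale. An increment of length `H` sees
the scales finer than `H` through the mass of the kernel, the scales between `H` and `1` through its
gradient, which costs a logarithm, and the coarse scales through the Fourier transform; hence `ψ` is
log-Lipschitz, with a constant depending on `‖θ‖_∞` and `‖θ‖₂` only. Both norms are controlled by
those of the initial datum, since `∫ β(θ)` is conserved for every `C¹` function `β` vanishing fast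
enough at `0`.

A nondegenerate level curve moves by `∂_t φ = ∂_{x₁} (ψ(x₁, φ))`. The area between the two curves
therefore changes only through the differences of `ψ` across the front at its two ends. For a
semi-uniform front the area is comparable to the thickness, so it satisfies
`|Y'| ≤ κ Y (1 + log⁺ (1 / Y))`, and such a quantity decays at most double exponentially.
-/

noncomputable section

open Filter
open scoped Topology Real

namespace QG

/-! ### The Euclidean norm -/

lemma euclid_nonneg (z : ℝ × ℝ) : 0 ≤ euclid z := Real.sqrt_nonneg _

lemma euclid_sq (z : ℝ × ℝ) : euclid z ^ 2 = z.1 ^ 2 + z.2 ^ 2 := Real.sq_sqrt (by positivity)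

lemma euclid_pos {z : ℝ × ℝ} (hz : z ≠ 0) : 0 < euclid z := by
  refine (euclid_nonneg z).lt_of_ne' fun h => hz ?_
  have hsq : z.1 ^ 2 + z.2 ^ 2 = 0 := by rw [← euclid_sq, h]; ring
  exact Prod.ext (by nlinarith [sq_nonneg z.1, sq_nonneg z.2] : z.1 = 0)
    (by nlinarith [sq_nonneg z.1, sq_nonneg z.2] : z.2 = 0)

lemma euclid_smul (r : ℝ) (z : ℝ × ℝ) : euclid (r • z) = |r| * euclid z := by
  rw [euclid, euclid, Prod.smul_fst, Prod.smul_snd, smul_eq_mul, smul_eq_mul,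
    show (r * z.1) ^ 2 + (r * z.2) ^ 2 = r ^ 2 * (z.1 ^ 2 + z.2 ^ 2) by ring,
    Real.sqrt_mul (sq_nonneg r), Real.sqrt_sq_eq_abs]

lemma euclid_neg (z : ℝ × ℝ) : euclid (-z) = euclid z := by simp [euclid]

lemma abs_dot_le_euclid_mul (x y : ℝ × ℝ) : |x.1 * y.1 + x.2 * y.2| ≤ euclid x * euclid y := by
  refine abs_le_of_sq_le_sq ?_ (mul_nonneg (euclid_nonneg x) (euclid_nonneg y))
  rw [mul_pow, euclid_sq, euclid_sq]
  nlinarith [sq_nonneg (x.1 * y.2 - x.2 * y.1)]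

/-! ### Gaussians on the plane -/

/-- The unnormalized Gaussian `exp (-s |z|²)` on the plane, with `|z|` the Euclidean norm. -/
def gaussian (s : ℝ) (z : ℝ × ℝ) : ℝ := Real.exp (-s * (z.1 ^ 2 + z.2 ^ 2))

lemma gaussian_eq_mul (s : ℝ) (z : ℝ × ℝ) :
    gaussian s z = Real.exp (-s * z.1 ^ 2) * Real.exp (-s * z.2 ^ 2) := by
  rw [gaussian, mul_add, Real.exp_add]

lemma gaussian_pos (s : ℝ) (z : ℝ × ℝ) : 0 < gaussian s z := Real.exp_pos _

lemma gaussian_nonneg (s : ℝ) (z : ℝ × ℝ) : 0 ≤ gaussian s z := (gaussian_pos s z).le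

lemma gaussian_neg (s : ℝ) (z : ℝ × ℝ) : gaussian s (-z) = gaussian s z := by simp [gaussian]

lemma gaussian_le_one {s : ℝ} (hs : 0 ≤ s) (z : ℝ × ℝ) : gaussian s z ≤ 1 :=
  Real.exp_le_one_iff.mpr (by nlinarith [sq_nonneg z.1, sq_nonneg z.2])

lemma gaussian_add_scale (s t : ℝ) (z : ℝ × ℝ) :
    gaussian (s + t) z = gaussian s z * gaussian t z := by
  rw [gaussian, gaussian, gaussian, ← Real.exp_add]; ring_nf

lemma continuous_gaussian_uncurry : Continuous fun p : ℝ × (ℝ × ℝ) => gaussian p.1 p.2 := by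
  unfold gaussian; fun_prop

lemma continuous_gaussian (s : ℝ) : Continuous (gaussian s) := by
  unfold gaussian; fun_prop

lemma integrable_gaussian {s : ℝ} (hs : 0 < s) : Integrable (gaussian s) :=
  ((integrable_exp_neg_mul_sq hs).mul_prod (integrable_exp_neg_mul_sq hs)).congr
    (.of_forall fun z => (gaussian_eq_mul s z).symm)

lemma integral_gaussian_plane {s : ℝ} (hs : 0 < s) : ∫ z, gaussian s z = π / s := by
  have h := integral_prod_mul (μ := (volume : Measure ℝ)) (ν := (volume : Measure ℝ))
    (fun x : ℝ => Real.exp (-s * x ^ 2)) (fun x : ℝ => Real.exp (-s * x ^ 2))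
  rw [integral_gaussian, Real.mul_self_sqrt (by positivity)] at h
  rw [← h]
  exact integral_congr_ae (.of_forall fun z => gaussian_eq_mul s z)

lemma lintegral_gaussian {s : ℝ} (hs : 0 < s) :
    ∫⁻ z, ENNReal.ofReal (gaussian s z) = ENNReal.ofReal (π / s) := by
  rw [← integral_gaussian_plane hs, ofReal_integral_eq_lintegral_ofReal (integrable_gaussian hs)
    (.of_forall (gaussian_nonneg s))]

lemma lintegral_gaussian_sub_left {s : ℝ} (hs : 0 < s) (x : ℝ × ℝ) :
    ∫⁻ y, ENNReal.ofReal (gaussian s (x - y)) = ENNReal.ofReal (π / s) := by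
  rw [← lintegral_gaussian hs]
  exact lintegral_sub_left_eq_self (fun y => ENNReal.ofReal (gaussian s y)) x

lemma le_exp_sq_half (x : ℝ) : x ≤ Real.exp (x ^ 2 / 2) := by
  have := Real.add_one_le_exp (x ^ 2 / 2)
  nlinarith [sq_nonneg (x - 1)]

lemma sqrt_mul_euclid_mul_gaussian_le {s : ℝ} (hs : 0 ≤ s) (z : ℝ × ℝ) :
    √s * euclid z * gaussian s z ≤ gaussian (s / 2) z := by
  have hexp : √s * euclid z ≤ Real.exp (s / 2 * (z.1 ^ 2 + z.2 ^ 2)) := by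
    have := le_exp_sq_half (√s * euclid z)
    rwa [mul_pow, Real.sq_sqrt hs, euclid_sq, mul_div_right_comm] at this
  calc √s * euclid z * gaussian s z
      ≤ Real.exp (s / 2 * (z.1 ^ 2 + z.2 ^ 2)) * gaussian s z :=
        mul_le_mul_of_nonneg_right hexp (gaussian_nonneg s z)
    _ = gaussian (s / 2) z := by rw [gaussian, gaussian, ← Real.exp_add]; ring_nf

lemma exp_half_le_two : Real.exp (1 / 2) ≤ 2 := by
  have hsq : Real.exp (1 / 2) ^ 2 = Real.exp 1 := by rw [← Real.exp_nat_mul]; norm_num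
  nlinarith [Real.exp_one_lt_d9, Real.exp_pos (1 / 2)]

lemma gaussian_add_le {s : ℝ} {v : ℝ × ℝ} (hs : 0 ≤ s) (hv : s * euclid v ^ 2 ≤ 1)
    (z : ℝ × ℝ) : gaussian (s / 2) (z + v) ≤ 2 * gaussian (s / 4) z := by
  rw [euclid_sq] at hv
  calc gaussian (s / 2) (z + v) ≤ Real.exp (1 / 2 + -(s / 4) * (z.1 ^ 2 + z.2 ^ 2)) := by
        refine Real.exp_le_exp.mpr ?_
        rw [Prod.fst_add, Prod.snd_add]
        nlinarith [mul_nonneg hs (add_nonneg (sq_nonneg (z.1 + 2 * v.1))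
          (sq_nonneg (z.2 + 2 * v.2)))]
    _ = Real.exp (1 / 2) * gaussian (s / 4) z := Real.exp_add _ _
    _ ≤ 2 * gaussian (s / 4) z :=
        mul_le_mul_of_nonneg_right exp_half_le_two (gaussian_nonneg _ z)

lemma hasDerivAt_gaussian_line (s : ℝ) (z v : ℝ × ℝ) (τ : ℝ) :
    HasDerivAt (fun τ : ℝ => gaussian s (z + τ • v))
      (gaussian s (z + τ • v)
        * (-s * (2 * ((z + τ • v).1 * v.1 + (z + τ • v).2 * v.2)))) τ := by
  have hline (p q : ℝ) : HasDerivAt (fun τ : ℝ => (p + τ * q) ^ 2) (2 * (p + τ * q) * q) τ := by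
    simpa using (((hasDerivAt_id' τ).mul_const q).const_add p).fun_pow 2
  refine (((hline z.1 v.1).fun_add (hline z.2 v.2)).const_mul (-s)).exp.congr_deriv ?_
  simp only [gaussian, Prod.fst_add, Prod.snd_add, Prod.smul_fst, Prod.smul_snd, smul_eq_mul]
  ring

lemma abs_gaussian_add_sub_le {s : ℝ} {v : ℝ × ℝ} (hs : 0 < s) (hv : s * euclid v ^ 2 ≤ 1)
    (z : ℝ × ℝ) :
    |gaussian s (z + v) - gaussian s z| ≤ 4 * euclid v * √s * gaussian (s / 4) z := by
  have hderiv : ∀ τ ∈ Icc (0 : ℝ) 1, ‖gaussian s (z + τ • v)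
      * (-s * (2 * ((z + τ • v).1 * v.1 + (z + τ • v).2 * v.2)))‖
        ≤ 4 * euclid v * √s * gaussian (s / 4) z := by
    intro τ hτ
    set y := z + τ • v
    have hτv : s * euclid (τ • v) ^ 2 ≤ 1 := by
      rw [euclid_smul, mul_pow, sq_abs]
      nlinarith [mul_nonneg hs.le (sq_nonneg (euclid v)), pow_le_one₀ (n := 2) hτ.1 hτ.2]
    rw [Real.norm_eq_abs, abs_mul, abs_mul, abs_mul, abs_neg, abs_of_pos hs, abs_two,
      abs_of_pos (gaussian_pos s y)]
    calc gaussian s y * (s * (2 * |y.1 * v.1 + y.2 * v.2|))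
        ≤ gaussian s y * (s * (2 * (euclid y * euclid v))) := by
          have := gaussian_nonneg s y
          gcongr
          exact abs_dot_le_euclid_mul y v
      _ = 2 * euclid v * √s * (√s * euclid y * gaussian s y) := by
          nth_rewrite 2 [← Real.mul_self_sqrt hs.le]; ring
      _ ≤ 2 * euclid v * √s * (2 * gaussian (s / 4) z) := by
          have := euclid_nonneg v
          refine mul_le_mul_of_nonneg_left ?_ (by positivity)
          exact (sqrt_mul_euclid_mul_gaussian_le hs.le y).trans (gaussian_add_le hs.le hτv z)
      _ = 4 * euclid v * √s * gaussian (s / 4) z := by ring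
  have := (convex_Icc (0 : ℝ) 1).norm_image_sub_le_of_norm_hasDerivWithin_le
    (fun τ _ => (hasDerivAt_gaussian_line s z v τ).hasDerivWithinAt) hderiv
    (left_mem_Icc.mpr zero_le_one) (right_mem_Icc.mpr zero_le_one)
  simpa using this

/-! ### Characters -/

/-- The character `x ↦ exp (-2πi ξ·x)` of the plane with frequency `ξ`, in the sign convention
of `fourierCoeff₂`. -/
def character (ξ x : ℝ × ℝ) : ℂ :=
  Complex.exp (-(2 * π * Complex.I * (ξ.1 * x.1 + ξ.2 * x.2)))

lemma character_eq_exp_mul_I (ξ x : ℝ × ℝ) :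
    character ξ x
      = Complex.exp ((-(2 * π * (ξ.1 * x.1 + ξ.2 * x.2)) : ℝ) * Complex.I) := by
  rw [character]; push_cast; ring_nf

@[simp] lemma norm_character (ξ x : ℝ × ℝ) : ‖character ξ x‖ = 1 := by
  rw [character_eq_exp_mul_I, Complex.norm_exp_ofReal_mul_I]

lemma character_eq_mul (ξ x : ℝ × ℝ) :
    character ξ x = Complex.exp (-(2 * π * Complex.I * (ξ.1 * x.1)))
      * Complex.exp (-(2 * π * Complex.I * (ξ.2 * x.2))) := by
  rw [character, ← Complex.exp_add]; ring_nf

lemma character_add (ξ x y : ℝ × ℝ) :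
    character ξ (x + y) = character ξ x * character ξ y := by
  rw [character, character, character, ← Complex.exp_add]
  push_cast [Prod.fst_add, Prod.snd_add]; ring_nf

lemma character_neg (ξ x : ℝ × ℝ) : character ξ (-x) = (starRingEnd ℂ) (character ξ x) := by
  rw [character_eq_exp_mul_I, character_eq_exp_mul_I, ← Complex.exp_conj, map_mul,
    Complex.conj_ofReal, Complex.conj_I, Prod.fst_neg, Prod.snd_neg]
  push_cast; ring_nf

lemma character_sub (ξ x y : ℝ × ℝ) :
    character ξ (x - y) = character ξ x * (starRingEnd ℂ) (character ξ y) := by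
  rw [sub_eq_add_neg, character_add, character_neg]

lemma character_comm (ξ x : ℝ × ℝ) : character ξ x = character x ξ := by
  rw [character, character]; ring_nf

lemma continuous_character_uncurry :
    Continuous fun p : (ℝ × ℝ) × (ℝ × ℝ) => character p.1 p.2 := by
  unfold character; fun_prop

@[fun_prop] lemma continuous_character (ξ : ℝ × ℝ) : Continuous (character ξ) := by
  unfold character; fun_prop

/-! ### The Fourier transform of Gaussians -/

/-- The Fourier transform `ξ ↦ (π / s) exp (-π² |ξ|² / s)` of the Gaussian `gaussian s`. -/
def gaussianFT (s : ℝ) (ξ : ℝ × ℝ) : ℝ := π / s * gaussian (π ^ 2 / s) ξ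

lemma gaussianFT_nonneg {s : ℝ} (hs : 0 ≤ s) (ξ : ℝ × ℝ) : 0 ≤ gaussianFT s ξ :=
  mul_nonneg (by positivity) (gaussian_nonneg _ ξ)

lemma integral_exp_mul_exp_neg_mul_sq {s : ℝ} (hs : 0 < s) (ξ : ℝ) :
    ∫ x : ℝ, Complex.exp (-(2 * π * Complex.I * (ξ * x))) * (Real.exp (-s * x ^ 2) : ℂ)
      = (√(π / s) * Real.exp (-(π ^ 2 / s) * ξ ^ 2) : ℝ) := by
  have h := fourierIntegral_gaussian (b := (s : ℂ)) (by simpa using hs) (-(2 * π * ξ) : ℂ)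
  have hsqrt : ((π : ℂ) / s) ^ (1 / 2 : ℂ) = (√(π / s) : ℝ) := by
    rw [Real.sqrt_eq_rpow, Complex.ofReal_cpow (by positivity)]; push_cast; rfl
  have hs' : (s : ℂ) ≠ 0 := by exact_mod_cast hs.ne'
  have hexponent : -((π : ℂ) ^ 2 / s) * ξ ^ 2 = -(-(2 * π * ξ) : ℂ) ^ 2 / (4 * s) := by
    field_simp; ring
  rw [hsqrt] at h
  push_cast
  rw [hexponent, ← h]
  refine integral_congr_ae (.of_forall fun x => ?_)
  ring_nf

lemma integral_gaussian_mul_character {s : ℝ} (hs : 0 < s) (ξ : ℝ × ℝ) :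
    ∫ z, (gaussian s z : ℂ) * character ξ z = gaussianFT s ξ := by
  have h := integral_prod_mul (μ := (volume : Measure ℝ)) (ν := (volume : Measure ℝ))
    (fun x : ℝ => Complex.exp (-(2 * π * Complex.I * (ξ.1 * x))) *
      (Real.exp (-s * x ^ 2) : ℂ))
    (fun x : ℝ => Complex.exp (-(2 * π * Complex.I * (ξ.2 * x))) *
      (Real.exp (-s * x ^ 2) : ℂ))
  rw [integral_exp_mul_exp_neg_mul_sq hs, integral_exp_mul_exp_neg_mul_sq hs] at h
  have hFT : gaussianFT s ξ = √(π / s) * Real.exp (-(π ^ 2 / s) * ξ.1 ^ 2)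
      * (√(π / s) * Real.exp (-(π ^ 2 / s) * ξ.2 ^ 2)) := by
    rw [gaussianFT, gaussian_eq_mul, mul_mul_mul_comm, Real.mul_self_sqrt (by positivity)]
  rw [hFT, Complex.ofReal_mul, ← h]
  refine integral_congr_ae (.of_forall fun z => ?_)
  simp only [gaussian_eq_mul, character_eq_mul]
  push_cast
  ring

lemma gaussian_eq_integral_gaussianFT {s : ℝ} (hs : 0 < s) (z : ℝ × ℝ) :
    (gaussian s z : ℂ) = ∫ ξ, (gaussianFT s ξ : ℂ) * character ξ z := by
  have h := integral_gaussian_mul_character (s := π ^ 2 / s) (by positivity) z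
  have hdual : π / (π ^ 2 / s) * gaussian (π ^ 2 / (π ^ 2 / s)) z = s / π * gaussian s z := by
    rw [div_div_cancel₀ (by positivity)]; field_simp
  rw [gaussianFT, hdual] at h
  have hFT : ∫ ξ, (gaussianFT s ξ : ℂ) * character ξ z
      = ((π / s : ℝ) : ℂ) * ∫ ξ, (gaussian (π ^ 2 / s) ξ : ℂ) * character z ξ := by
    rw [← integral_const_mul]
    refine integral_congr_ae (.of_forall fun ξ => ?_)
    simp only [gaussianFT, character_comm ξ z]; push_cast; ring
  rw [hFT, h, ← Complex.ofReal_mul]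
  congr 1; field_simp

/-! ### Subordination of the Riesz kernel to Gaussians -/

/-- The density `s ^ (-1/2) / (2π√π)` in the subordination formula
`1 / (2π|z|) = ∫ s in Ioi 0, weight s * gaussian s z`. -/
def weight (s : ℝ) : ℝ := 1 / (2 * π * √π) * s ^ (-(1 / 2) : ℝ)

/-- The part of the Riesz kernel `1 / (2π|z|)` carried by the inverse square scales in `I`; large
`s` correspond to short distances. -/
def scaleKernel (I : Set ℝ) (z : ℝ × ℝ) : ℝ := ∫ s in I, weight s * gaussian s z

/-- The potential of `f` with respect to `scaleKernel I`. -/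
def potential (I : Set ℝ) (f : ℝ × ℝ → ℝ) (x : ℝ × ℝ) : ℝ := ∫ y, f y * scaleKernel I (x - y)

lemma weight_nonneg {s : ℝ} (hs : 0 ≤ s) : 0 ≤ weight s := by unfold weight; positivity

@[fun_prop] lemma measurable_weight : Measurable weight := by unfold weight; fun_prop

lemma weight_le {s : ℝ} (hs : 0 ≤ s) : weight s ≤ s ^ (-(1 / 2) : ℝ) := by
  refine mul_le_of_le_one_left (by positivity) ?_
  have : 1 ≤ √π := Real.one_le_sqrt.mpr (by linarith [Real.pi_gt_three])
  rw [div_le_one (by positivity)]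
  nlinarith [Real.pi_gt_three]

lemma integrableOn_weight_mul_gaussian {z : ℝ × ℝ} (hz : z ≠ 0) :
    IntegrableOn (fun s => weight s * gaussian s z) (Ioi 0) := by
  have hz2 : 0 < z.1 ^ 2 + z.2 ^ 2 := by rw [← euclid_sq]; exact pow_pos (euclid_pos hz) 2
  have h := integrableOn_rpow_mul_exp_neg_mul_rpow (s := -(1 / 2)) (p := 1) (by norm_num) one_pos
    hz2
  refine IntegrableOn.congr_fun (h.const_mul (1 / (2 * π * √π))) ?_ measurableSet_Ioi
  intro s _
  simp only [weight, gaussian, Real.rpow_one]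
  ring_nf

lemma scaleKernel_Ioi_zero {z : ℝ × ℝ} (hz : z ≠ 0) :
    scaleKernel (Ioi 0) z = 1 / (2 * π * euclid z) := by
  have hE := euclid_pos hz
  have hGamma := Real.integral_rpow_mul_exp_neg_mul_Ioi (a := 1 / 2) (by norm_num) (pow_pos hE 2)
  have hker : scaleKernel (Ioi 0) z = 1 / (2 * π * √π) *
      ∫ t : ℝ in Ioi 0, t ^ (1 / 2 - 1 : ℝ) * Real.exp (-(euclid z ^ 2 * t)) := by
    rw [scaleKernel, ← integral_const_mul]
    refine setIntegral_congr_fun measurableSet_Ioi fun s _ => ?_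
    simp only [weight, gaussian, euclid_sq]
    norm_num
    ring_nf
  rw [hker, hGamma, Real.Gamma_one_half_eq, ← Real.sqrt_eq_rpow, Real.sqrt_div zero_le_one,
    Real.sqrt_one, Real.sqrt_sq hE.le]
  field_simp

/-! ### Integrals of the weight -/

lemma lintegral_weight_mul_rpow_le {I : Set ℝ} (hI : MeasurableSet I) (hI0 : I ⊆ Ioi 0) {p : ℝ}
    (hp : IntegrableOn (fun s : ℝ => s ^ (p - 1 / 2)) I) :
    ∫⁻ s in I, ENNReal.ofReal (weight s) * ENNReal.ofReal (s ^ p)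
      ≤ ENNReal.ofReal (∫ s in I, s ^ (p - 1 / 2)) := by
  rw [ofReal_integral_eq_lintegral_ofReal hp]
  · refine setLIntegral_mono' hI fun s hs => ?_
    have h0 : 0 < s := hI0 hs
    rw [← ENNReal.ofReal_mul (weight_nonneg h0.le), sub_eq_neg_add, Real.rpow_add h0]
    exact ENNReal.ofReal_le_ofReal
      (mul_le_mul_of_nonneg_right (weight_le h0.le) (Real.rpow_nonneg h0.le _))
  · filter_upwards [ae_restrict_mem hI] with s hs
    exact Real.rpow_nonneg (hI0 hs).le _

lemma lintegral_weight_Ioc_zero_one_le :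
    ∫⁻ s in Ioc (0 : ℝ) 1, ENNReal.ofReal (weight s) ≤ 2 := by
  have hint : IntegrableOn (fun s : ℝ => s ^ (0 - 1 / 2 : ℝ)) (Ioc 0 1) := by
    rw [← intervalIntegrable_iff_integrableOn_Ioc_of_le zero_le_one]
    exact intervalIntegral.intervalIntegrable_rpow' (by norm_num)
  have h := lintegral_weight_mul_rpow_le measurableSet_Ioc Ioc_subset_Ioi_self hint
  rw [← intervalIntegral.integral_of_le zero_le_one, integral_rpow (Or.inl (by norm_num))] at h
  norm_num at h
  exact h

lemma lintegral_weight_mul_rpow_Ioc_one_le {S : ℝ} (hS : 1 ≤ S) :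
    ∫⁻ s in Ioc (1 : ℝ) S, ENNReal.ofReal (weight s) * ENNReal.ofReal (s ^ (-(1 / 2) : ℝ))
      ≤ ENNReal.ofReal (Real.log S) := by
  have hexp (s : ℝ) : s ^ (-(1 / 2) - 1 / 2 : ℝ) = s⁻¹ := by
    rw [← Real.rpow_neg_one]; norm_num
  have hint : IntegrableOn (fun s : ℝ => s ^ (-(1 / 2) - 1 / 2 : ℝ)) (Ioc 1 S) := by
    simp only [hexp]
    rw [← intervalIntegrable_iff_integrableOn_Ioc_of_le hS]
    refine intervalIntegral.intervalIntegrable_inv (fun x hx => ?_) continuousOn_id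
    rw [uIcc_of_le hS] at hx
    exact (zero_lt_one.trans_le hx.1).ne'
  have h := lintegral_weight_mul_rpow_le measurableSet_Ioc
    (Ioc_subset_Ioi_self.trans (Ioi_subset_Ioi zero_le_one)) hint
  simp only [hexp] at h
  rwa [← intervalIntegral.integral_of_le hS, integral_inv_of_pos one_pos (by linarith),
    div_one] at h

lemma lintegral_weight_mul_inv_Ioi_le {S : ℝ} (hS : 0 < S) :
    ∫⁻ s in Ioi S, ENNReal.ofReal (weight s) * ENNReal.ofReal s⁻¹
      ≤ ENNReal.ofReal (2 * S ^ (-(1 / 2) : ℝ)) := by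
  have h := lintegral_weight_mul_rpow_le measurableSet_Ioi (Ioi_subset_Ioi hS.le)
    (integrableOn_Ioi_rpow_of_lt (a := -1 - 1 / 2) (by norm_num) hS)
  rw [integral_Ioi_rpow_of_lt (by norm_num) hS] at h
  simp only [Real.rpow_neg_one] at h
  refine h.trans_eq (congrArg ENNReal.ofReal ?_)
  rw [show (-1 - 1 / 2 + 1 : ℝ) = -(1 / 2) by norm_num]
  ring

/-! ### Integrability of the kernels -/

lemma scaleKernel_nonneg {I : Set ℝ} (hI : MeasurableSet I) (hI0 : I ⊆ Ioi 0) (z : ℝ × ℝ) :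
    0 ≤ scaleKernel I z :=
  setIntegral_nonneg hI fun s hs => mul_nonneg (weight_nonneg (hI0 hs).le) (gaussian_nonneg s z)

lemma measurable_weight_mul_gaussian :
    Measurable fun p : ℝ × (ℝ × ℝ) => weight p.1 * gaussian p.1 p.2 :=
  (measurable_weight.comp measurable_fst).mul continuous_gaussian_uncurry.measurable

lemma measurable_scaleKernel (I : Set ℝ) : Measurable (scaleKernel I) := by
  have : StronglyMeasurable (fun p : (ℝ × ℝ) × ℝ => weight p.2 * gaussian p.2 p.1) :=
    (measurable_weight_mul_gaussian.comp measurable_swap).stronglyMeasurable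
  exact (this.integral_prod_right (ν := volume.restrict I)).measurable

lemma ofReal_scaleKernel {I : Set ℝ} (hI : MeasurableSet I) (hI0 : I ⊆ Ioi 0) {z : ℝ × ℝ}
    (hz : z ≠ 0) : ENNReal.ofReal (scaleKernel I z)
      = ∫⁻ s in I, ENNReal.ofReal (weight s) * ENNReal.ofReal (gaussian s z) := by
  rw [scaleKernel, ofReal_integral_eq_lintegral_ofReal
    ((integrableOn_weight_mul_gaussian hz).mono_set hI0)]
  · exact setLIntegral_congr_fun hI fun s hs => ENNReal.ofReal_mul (weight_nonneg (hI0 hs).le)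
  · filter_upwards [ae_restrict_mem hI] with s hs
    exact mul_nonneg (weight_nonneg (hI0 hs).le) (gaussian_nonneg s z)

lemma ae_sub_ne_zero (x : ℝ × ℝ) : ∀ᵐ y : ℝ × ℝ, x - y ≠ 0 := by
  filter_upwards [Measure.ae_ne volume x] with y hy
  rwa [sub_ne_zero, ne_comm]

lemma lintegral_scaleKernel_Ioi_one_lt_top :
    ∫⁻ z, ENNReal.ofReal (scaleKernel (Ioi 1) z) < ⊤ := by
  have hI0 : Ioi (1 : ℝ) ⊆ Ioi 0 := Ioi_subset_Ioi zero_le_one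
  calc ∫⁻ z, ENNReal.ofReal (scaleKernel (Ioi 1) z)
      = ∫⁻ z, ∫⁻ s in Ioi (1 : ℝ), ENNReal.ofReal (weight s) * ENNReal.ofReal (gaussian s z) := by
        refine lintegral_congr_ae ?_
        filter_upwards [Measure.ae_ne volume 0] with z hz
        exact ofReal_scaleKernel measurableSet_Ioi hI0 hz
    _ = ∫⁻ s in Ioi (1 : ℝ), ∫⁻ z, ENNReal.ofReal (weight s) * ENNReal.ofReal (gaussian s z) := by
        refine lintegral_lintegral_swap (Measurable.aemeasurable ?_)
        exact ((measurable_weight.comp measurable_snd).ennreal_ofReal).mul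
          (continuous_gaussian_uncurry.measurable.comp measurable_swap).ennreal_ofReal
    _ = ∫⁻ s in Ioi (1 : ℝ), ENNReal.ofReal π *
          (ENNReal.ofReal (weight s) * ENNReal.ofReal s⁻¹) := by
        refine setLIntegral_congr_fun measurableSet_Ioi fun s hs => ?_
        rw [lintegral_const_mul _ (continuous_gaussian s).measurable.ennreal_ofReal,
          lintegral_gaussian (hI0 hs), div_eq_mul_inv, ENNReal.ofReal_mul Real.pi_pos.le]
        ring
    _ < ⊤ := by
        rw [lintegral_const_mul' _ _ ENNReal.ofReal_ne_top]
        exact ENNReal.mul_lt_top ENNReal.ofReal_lt_top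
          ((lintegral_weight_mul_inv_Ioi_le one_pos).trans_lt ENNReal.ofReal_lt_top)

lemma integrable_scaleKernel_Ioi_one : Integrable (scaleKernel (Ioi 1)) := by
  refine ⟨(measurable_scaleKernel _).aestronglyMeasurable, ?_⟩
  rw [hasFiniteIntegral_iff_ofReal (.of_forall
    (scaleKernel_nonneg measurableSet_Ioi (Ioi_subset_Ioi zero_le_one)))]
  exact lintegral_scaleKernel_Ioi_one_lt_top

lemma scaleKernel_Ioc_zero_one_le {z : ℝ × ℝ} (hz : z ≠ 0) : scaleKernel (Ioc 0 1) z ≤ 2 := by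
  rw [← ENNReal.ofReal_le_ofReal_iff (by norm_num),
    ofReal_scaleKernel measurableSet_Ioc Ioc_subset_Ioi_self hz]
  refine le_trans (setLIntegral_mono (by fun_prop) fun s hs => ?_)
    (lintegral_weight_Ioc_zero_one_le.trans (by simp))
  exact mul_le_of_le_one_right' (ENNReal.ofReal_le_one.mpr (gaussian_le_one hs.1.le z))

lemma scaleKernel_Ioi_zero_eq_add {z : ℝ × ℝ} (hz : z ≠ 0) :
    scaleKernel (Ioi 0) z = scaleKernel (Ioc 0 1) z + scaleKernel (Ioi 1) z := by
  have h := integrableOn_weight_mul_gaussian hz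
  rw [scaleKernel, ← Ioc_union_Ioi_eq_Ioi (zero_le_one' ℝ), setIntegral_union
    (Ioc_disjoint_Ioi le_rfl) measurableSet_Ioi (h.mono_set Ioc_subset_Ioi_self)
    (h.mono_set (Ioi_subset_Ioi zero_le_one))]
  rfl

lemma integrable_mul_scaleKernel_Ioi_one {f : ℝ × ℝ → ℝ} (hf : Continuous f) {M : ℝ}
    (hM : ∀ y, |f y| ≤ M) (x : ℝ × ℝ) : Integrable fun y => f y * scaleKernel (Ioi 1) (x - y) :=
  (integrable_scaleKernel_Ioi_one.comp_sub_left x).bdd_mul hf.aestronglyMeasurable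
    (.of_forall hM)

lemma integrable_mul_scaleKernel_Ioi_zero {f : ℝ × ℝ → ℝ} (hf : Continuous f)
    (hfi : Integrable f) {M : ℝ} (hM : ∀ y, |f y| ≤ M) (x : ℝ × ℝ) :
    Integrable fun y => f y * scaleKernel (Ioi 0) (x - y) := by
  have hcoarse : Integrable fun y => f y * scaleKernel (Ioc 0 1) (x - y) := by
    refine hfi.mul_bdd (c := 2)
      ((measurable_scaleKernel _).comp (measurable_const.sub measurable_id)).aestronglyMeasurable ?_
    filter_upwards [ae_sub_ne_zero x] with y hy
    rw [Real.norm_of_nonneg (scaleKernel_nonneg measurableSet_Ioc Ioc_subset_Ioi_self _)]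
    exact scaleKernel_Ioc_zero_one_le hy
  refine (hcoarse.add (integrable_mul_scaleKernel_Ioi_one hf hM x)).congr ?_
  filter_upwards [ae_sub_ne_zero x] with y hy
  rw [Pi.add_apply, scaleKernel_Ioi_zero_eq_add hy, mul_add]

/-! ### The log-Lipschitz modulus of potentials -/

/-- The modulus of continuity `H (1 + log⁺ (1 / H))` of log-Lipschitz functions; its value at
`H = 0` is `0`. -/
def logModulus (H : ℝ) : ℝ := H * (1 + Real.posLog H⁻¹)

lemma le_logModulus {H : ℝ} (hH : 0 ≤ H) : H ≤ logModulus H :=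
  le_mul_of_one_le_right hH (le_add_of_nonneg_right Real.posLog_nonneg)

lemma logModulus_nonneg {H : ℝ} (hH : 0 ≤ H) : 0 ≤ logModulus H := hH.trans (le_logModulus hH)

lemma mul_posLog_inv_le {h H : ℝ} (hh : h ≤ H) :
    h * Real.posLog H⁻¹ ≤ logModulus H - H := by
  have := mul_le_mul_of_nonneg_right hh (Real.posLog_nonneg (x := H⁻¹))
  rw [logModulus]; linarith

/-- The increment `∫ |f(y)| |G(x + v - y) - G(x - y)| dy` of the Gaussian potential of `|f|` at
scale `s`, for the displacement `v`. -/
def gaussianIncrement (f : ℝ × ℝ → ℝ) (x v : ℝ × ℝ) (s : ℝ) : ℝ≥0∞ :=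
  ∫⁻ y, ‖f y‖ₑ * ENNReal.ofReal |gaussian s (x + v - y) - gaussian s (x - y)|

section Increment

variable {f : ℝ × ℝ → ℝ} {M E : ℝ} {v : ℝ × ℝ} {s : ℝ}

lemma gaussianIncrement_le (hM : ∀ y, |f y| ≤ M) (x v : ℝ × ℝ) (hs : 0 < s) :
    gaussianIncrement f x v s ≤ ENNReal.ofReal (2 * π * M) * ENNReal.ofReal s⁻¹ := by
  have hM0 : 0 ≤ M := (abs_nonneg _).trans (hM 0)
  calc gaussianIncrement f x v s ≤ ∫⁻ y, ENNReal.ofReal M *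
        (ENNReal.ofReal (gaussian s (x + v - y)) + ENNReal.ofReal (gaussian s (x - y))) := by
        refine lintegral_mono fun y => mul_le_mul' ?_ ?_
        · rw [Real.enorm_eq_ofReal_abs]; exact ENNReal.ofReal_le_ofReal (hM y)
        · rw [← ENNReal.ofReal_add (gaussian_nonneg _ _) (gaussian_nonneg _ _)]
          refine ENNReal.ofReal_le_ofReal ((abs_sub _ _).trans_eq ?_)
          rw [abs_of_pos (gaussian_pos _ _), abs_of_pos (gaussian_pos _ _)]
    _ = ENNReal.ofReal M * (ENNReal.ofReal (π / s) + ENNReal.ofReal (π / s)) := by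
        have hmeas : Measurable fun y => ENNReal.ofReal (gaussian s (x + v - y)) :=
          ((continuous_gaussian s).comp (by fun_prop)).measurable.ennreal_ofReal
        rw [lintegral_const_mul' _ _ ENNReal.ofReal_ne_top, lintegral_add_left hmeas,
          lintegral_gaussian_sub_left hs, lintegral_gaussian_sub_left hs]
    _ = ENNReal.ofReal (2 * π * M) * ENNReal.ofReal s⁻¹ := by
        rw [← ENNReal.ofReal_add (by positivity) (by positivity), ← ENNReal.ofReal_mul hM0,
          ← ENNReal.ofReal_mul (by positivity)]
        ring_nf

lemma abs_gaussian_add_sub_sub_le (hs : 0 < s) (hv : s * euclid v ^ 2 ≤ 1) (x y : ℝ × ℝ) :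
    |gaussian s (x + v - y) - gaussian s (x - y)|
      ≤ 4 * euclid v * √s * gaussian (s / 4) (x - y) := by
  rw [add_sub_right_comm]
  exact abs_gaussian_add_sub_le hs hv (x - y)

lemma gaussianIncrement_le_of_bounded (hM : ∀ y, |f y| ≤ M) (x : ℝ × ℝ) (hs : 0 < s)
    (hv : s * euclid v ^ 2 ≤ 1) : gaussianIncrement f x v s
      ≤ ENNReal.ofReal (16 * π * M * euclid v) * ENNReal.ofReal (s ^ (-(1 / 2) : ℝ)) := by
  have hM0 : 0 ≤ M := (abs_nonneg _).trans (hM 0)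
  have hv0 := euclid_nonneg v
  calc gaussianIncrement f x v s ≤ ∫⁻ y, ENNReal.ofReal (M * (4 * euclid v * √s)) *
        ENNReal.ofReal (gaussian (s / 4) (x - y)) := by
        refine lintegral_mono fun y => ?_
        rw [Real.enorm_eq_ofReal_abs, ← ENNReal.ofReal_mul (abs_nonneg _),
          ← ENNReal.ofReal_mul (by positivity), mul_assoc]
        exact ENNReal.ofReal_le_ofReal (mul_le_mul (hM y)
          (abs_gaussian_add_sub_sub_le hs hv x y) (abs_nonneg _) hM0)
    _ = ENNReal.ofReal (M * (4 * euclid v * √s) * (π / (s / 4))) := by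
        rw [lintegral_const_mul' _ _ ENNReal.ofReal_ne_top,
          lintegral_gaussian_sub_left (by positivity), ← ENNReal.ofReal_mul (by positivity)]
    _ = ENNReal.ofReal (16 * π * M * euclid v) * ENNReal.ofReal (s ^ (-(1 / 2) : ℝ)) := by
        rw [← ENNReal.ofReal_mul (by positivity), Real.rpow_neg hs.le, ← Real.sqrt_eq_rpow]
        nth_rewrite 2 [← Real.mul_self_sqrt hs.le]
        congr 1
        field_simp
        ring

lemma abs_mul_abs_gaussian_sub_le (hs : 0 < s) (hv : s * euclid v ^ 2 ≤ 1) (x y : ℝ × ℝ) (r : ℝ) :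
    |r| * |gaussian s (x + v - y) - gaussian s (x - y)|
      ≤ 2 * euclid v * (r ^ 2 + s * gaussian (s / 2) (x - y)) := by
  have hv0 := euclid_nonneg v
  have hhalf : gaussian (s / 2) (x - y) = gaussian (s / 4) (x - y) ^ 2 := by
    rw [sq, ← gaussian_add_scale]; ring_nf
  calc |r| * |gaussian s (x + v - y) - gaussian s (x - y)|
      ≤ |r| * (4 * euclid v * √s * gaussian (s / 4) (x - y)) := by
        gcongr; exact abs_gaussian_add_sub_sub_le hs hv x y
    _ = 2 * euclid v * (2 * |r| * (√s * gaussian (s / 4) (x - y))) := by ring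
    _ ≤ 2 * euclid v * (|r| ^ 2 + (√s * gaussian (s / 4) (x - y)) ^ 2) := by
        gcongr; exact two_mul_le_add_sq _ _
    _ = 2 * euclid v * (r ^ 2 + s * gaussian (s / 2) (x - y)) := by
        rw [mul_pow, Real.sq_sqrt hs.le, sq_abs, hhalf]

lemma gaussianIncrement_le_of_lintegral_sq (hf : Continuous f) (hE0 : 0 ≤ E)
    (hE : ∫⁻ y, ENNReal.ofReal (f y ^ 2) ≤ ENNReal.ofReal E) (x : ℝ × ℝ)
    (hs : 0 < s) (hv : s * euclid v ^ 2 ≤ 1) :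
    gaussianIncrement f x v s ≤ ENNReal.ofReal (2 * euclid v * (E + 2 * π)) := by
  have hv0 := euclid_nonneg v
  calc gaussianIncrement f x v s ≤ ∫⁻ y, ENNReal.ofReal (2 * euclid v) * (ENNReal.ofReal (f y ^ 2) +
        ENNReal.ofReal s * ENNReal.ofReal (gaussian (s / 2) (x - y))) := by
        refine lintegral_mono fun y => ?_
        rw [Real.enorm_eq_ofReal_abs, ← ENNReal.ofReal_mul (abs_nonneg _),
          ← ENNReal.ofReal_mul hs.le, ← ENNReal.ofReal_add (sq_nonneg _)
          (mul_nonneg hs.le (gaussian_nonneg _ _)), ← ENNReal.ofReal_mul (by positivity)]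
        exact ENNReal.ofReal_le_ofReal (abs_mul_abs_gaussian_sub_le hs hv x y (f y))
    _ ≤ ENNReal.ofReal (2 * euclid v) *
          (ENNReal.ofReal E + ENNReal.ofReal s * ENNReal.ofReal (π / (s / 2))) := by
        rw [lintegral_const_mul' _ _ ENNReal.ofReal_ne_top, lintegral_add_left (by fun_prop),
          lintegral_const_mul' _ _ ENNReal.ofReal_ne_top,
          lintegral_gaussian_sub_left (by positivity)]
        gcongr
    _ = ENNReal.ofReal (2 * euclid v * (E + 2 * π)) := by
        rw [← ENNReal.ofReal_mul hs.le, ← ENNReal.ofReal_add hE0 (by positivity),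
          ← ENNReal.ofReal_mul (by positivity)]
        congr 1; field_simp

end Increment

lemma enorm_scaleKernel_sub_le {I : Set ℝ} (hI : MeasurableSet I) (hI0 : I ⊆ Ioi 0)
    {z w : ℝ × ℝ} (hz : z ≠ 0) (hw : w ≠ 0) :
    ‖scaleKernel I z - scaleKernel I w‖ₑ ≤
      ∫⁻ s in I, ENNReal.ofReal (weight s) * ENNReal.ofReal |gaussian s z - gaussian s w| := by
  rw [scaleKernel, scaleKernel, ← integral_sub
    ((integrableOn_weight_mul_gaussian hz).mono_set hI0)
    ((integrableOn_weight_mul_gaussian hw).mono_set hI0)]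
  refine (enorm_integral_le_lintegral_enorm _).trans (setLIntegral_mono' hI fun s hs => le_of_eq ?_)
  rw [← mul_sub, enorm_mul, Real.enorm_of_nonneg (weight_nonneg (hI0 hs).le),
    Real.enorm_eq_ofReal_abs]

lemma enorm_potential_add_sub_le {f : ℝ × ℝ → ℝ} (hf : Continuous f) {I : Set ℝ}
    (hI : MeasurableSet I) (hI0 : I ⊆ Ioi 0)
    (hint : ∀ x, Integrable fun y => f y * scaleKernel I (x - y)) (x v : ℝ × ℝ) :
    ‖potential I f (x + v) - potential I f x‖ₑ
      ≤ ∫⁻ s in I, ENNReal.ofReal (weight s) * gaussianIncrement f x v s := by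
  rw [potential, potential, ← integral_sub (hint _) (hint _)]
  refine (enorm_integral_le_lintegral_enorm _).trans ?_
  calc ∫⁻ y, ‖f y * scaleKernel I (x + v - y) - f y * scaleKernel I (x - y)‖ₑ
      ≤ ∫⁻ y, ∫⁻ s in I, ENNReal.ofReal (weight s) *
          (‖f y‖ₑ * ENNReal.ofReal |gaussian s (x + v - y) - gaussian s (x - y)|) := by
        refine lintegral_mono_ae ?_
        filter_upwards [ae_sub_ne_zero x, ae_sub_ne_zero (x + v)] with y hx hxv
        rw [← mul_sub, enorm_mul]
        refine (mul_le_mul_right (enorm_scaleKernel_sub_le hI hI0 hxv hx) _).trans_eq ?_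
        rw [← lintegral_const_mul' _ _ enorm_ne_top]
        simp only [mul_left_comm]
    _ = ∫⁻ s in I, ∫⁻ y, ENNReal.ofReal (weight s) *
          (‖f y‖ₑ * ENNReal.ofReal |gaussian s (x + v - y) - gaussian s (x - y)|) := by
        have hgauss : Continuous fun p : (ℝ × ℝ) × ℝ =>
            |gaussian p.2 (x + v - p.1) - gaussian p.2 (x - p.1)| := by
          unfold gaussian; fun_prop
        refine lintegral_lintegral_swap (Measurable.aemeasurable ?_)
        exact (measurable_weight.comp measurable_snd).ennreal_ofReal.mul
          ((hf.measurable.comp measurable_fst).enorm.mul hgauss.measurable.ennreal_ofReal)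
    _ = ∫⁻ s in I, ENNReal.ofReal (weight s) * gaussianIncrement f x v s := by
        simp only [lintegral_const_mul' _ _ ENNReal.ofReal_ne_top, gaussianIncrement]

section LogLipschitz

variable {f : ℝ × ℝ → ℝ} {M E : ℝ} {v : ℝ × ℝ}

lemma lintegral_weight_mul_gaussianIncrement_Ioc_one_le (hM : ∀ y, |f y| ≤ M) (x : ℝ × ℝ)
    {S : ℝ} (hS : 1 ≤ S) (hv : S * euclid v ^ 2 ≤ 1) :
    ∫⁻ s in Ioc 1 S, ENNReal.ofReal (weight s) * gaussianIncrement f x v s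
      ≤ ENNReal.ofReal (16 * π * M * euclid v * Real.log S) := by
  have hM0 : 0 ≤ M := (abs_nonneg _).trans (hM 0)
  have hv0 := euclid_nonneg v
  rw [ENNReal.ofReal_mul (by positivity)]
  refine le_trans ?_ (mul_le_mul_right (lintegral_weight_mul_rpow_Ioc_one_le hS) _)
  rw [← lintegral_const_mul' _ _ ENNReal.ofReal_ne_top]
  refine setLIntegral_mono' measurableSet_Ioc fun s hs => ?_
  have hsv : s * euclid v ^ 2 ≤ 1 :=
    (mul_le_mul_of_nonneg_right hs.2 (sq_nonneg _)).trans hv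
  refine (mul_le_mul_right (gaussianIncrement_le_of_bounded hM x (zero_lt_one.trans hs.1) hsv)
    _).trans_eq (mul_left_comm _ _ _)

lemma lintegral_weight_mul_gaussianIncrement_Ioi_le (hM : ∀ y, |f y| ≤ M) (x v : ℝ × ℝ)
    {S : ℝ} (hS : 0 < S) :
    ∫⁻ s in Ioi S, ENNReal.ofReal (weight s) * gaussianIncrement f x v s
      ≤ ENNReal.ofReal (4 * π * M * S ^ (-(1 / 2) : ℝ)) := by
  have hM0 : 0 ≤ M := (abs_nonneg _).trans (hM 0)
  rw [show 4 * π * M * S ^ (-(1 / 2) : ℝ) = 2 * π * M * (2 * S ^ (-(1 / 2) : ℝ)) by ring,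
    ENNReal.ofReal_mul (by positivity)]
  refine le_trans ?_ (mul_le_mul_right (lintegral_weight_mul_inv_Ioi_le hS) _)
  rw [← lintegral_const_mul' _ _ ENNReal.ofReal_ne_top]
  exact setLIntegral_mono' measurableSet_Ioi fun s hs =>
    (mul_le_mul_right (gaussianIncrement_le hM x v (hS.trans hs)) _).trans_eq (mul_left_comm _ _ _)

lemma lintegral_weight_mul_gaussianIncrement_Ioi_one_le (hM : ∀ y, |f y| ≤ M) (x : ℝ × ℝ) {H : ℝ}
    (hH : 0 < H) (hH1 : H ≤ 1) (hv : euclid v ≤ H) :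
    ∫⁻ s in Ioi 1, ENNReal.ofReal (weight s) * gaussianIncrement f x v s
      ≤ ENNReal.ofReal (36 * π * M * logModulus H) := by
  have hM0 : 0 ≤ M := (abs_nonneg _).trans (hM 0)
  have hv0 := euclid_nonneg v
  have hinv : 1 ≤ H⁻¹ := (one_le_inv₀ hH).mpr hH1
  have hS : 1 ≤ H⁻¹ ^ 2 := one_le_pow₀ hinv
  have hSv : H⁻¹ ^ 2 * euclid v ^ 2 ≤ 1 := by
    rw [← mul_pow]
    exact pow_le_one₀ (by positivity) (by rwa [inv_mul_le_one₀ hH])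
  have hsqrt : (H⁻¹ ^ 2) ^ (-(1 / 2) : ℝ) = H := by
    rw [Real.rpow_neg (by positivity), ← Real.sqrt_eq_rpow, Real.sqrt_sq (by positivity), inv_inv]
  have hlog : Real.log (H⁻¹ ^ 2) = 2 * Real.posLog H⁻¹ := by
    rw [Real.log_pow, Real.posLog_eq_log (hinv.trans (le_abs_self _))]; norm_num
  have hvlog := mul_posLog_inv_le hv
  have hHmod := le_logModulus hH.le
  have hlog0 : 0 ≤ Real.log (H⁻¹ ^ 2) := Real.log_nonneg hS
  rw [← Ioc_union_Ioi_eq_Ioi hS, lintegral_union measurableSet_Ioi (Ioc_disjoint_Ioi le_rfl)]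
  refine (add_le_add (lintegral_weight_mul_gaussianIncrement_Ioc_one_le hM x hS hSv)
    (lintegral_weight_mul_gaussianIncrement_Ioi_le hM x v (by positivity))).trans ?_
  rw [← ENNReal.ofReal_add (by positivity) (by positivity), hsqrt, hlog]
  refine ENNReal.ofReal_le_ofReal ?_
  calc 16 * π * M * euclid v * (2 * Real.posLog H⁻¹) + 4 * π * M * H
      = π * M * (32 * (euclid v * Real.posLog H⁻¹) + 4 * H) := by ring
    _ ≤ π * M * (36 * logModulus H) := by gcongr; linarith
    _ = 36 * π * M * logModulus H := by ring

lemma lintegral_weight_mul_gaussianIncrement_Ioc_zero_one_le (hf : Continuous f) (hE0 : 0 ≤ E)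
    (hE : ∫⁻ y, ENNReal.ofReal (f y ^ 2) ≤ ENNReal.ofReal E) (x : ℝ × ℝ) (hv : euclid v ≤ 1) :
    ∫⁻ s in Ioc 0 1, ENNReal.ofReal (weight s) * gaussianIncrement f x v s
      ≤ ENNReal.ofReal (4 * (E + 2 * π) * euclid v) := by
  calc ∫⁻ s in Ioc 0 1, ENNReal.ofReal (weight s) * gaussianIncrement f x v s
      ≤ ∫⁻ s in Ioc (0 : ℝ) 1, ENNReal.ofReal (weight s) *
          ENNReal.ofReal (2 * euclid v * (E + 2 * π)) := by
        refine setLIntegral_mono (by fun_prop) fun s hs => mul_le_mul_right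
          (gaussianIncrement_le_of_lintegral_sq hf hE0 hE x hs.1 ?_) _
        exact mul_le_one₀ hs.2 (sq_nonneg _) (pow_le_one₀ (euclid_nonneg v) hv)
    _ ≤ 2 * ENNReal.ofReal (2 * euclid v * (E + 2 * π)) := by
        rw [lintegral_mul_const' _ _ ENNReal.ofReal_ne_top]
        exact mul_le_mul_left lintegral_weight_Ioc_zero_one_le _
    _ = ENNReal.ofReal (4 * (E + 2 * π) * euclid v) := by
        rw [← ENNReal.ofReal_ofNat 2, ← ENNReal.ofReal_mul zero_le_two]
        ring_nf

theorem abs_potential_Ioi_one_add_sub_le (hf : Continuous f) (hM : ∀ y, |f y| ≤ M) (x : ℝ × ℝ)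
    {H : ℝ} (hH : 0 < H) (hH1 : H ≤ 1) (hv : euclid v ≤ H) :
    |potential (Ioi 1) f (x + v) - potential (Ioi 1) f x| ≤ 36 * π * M * logModulus H := by
  have hM0 : 0 ≤ M := (abs_nonneg _).trans (hM 0)
  have hmod := logModulus_nonneg hH.le
  rw [← ENNReal.ofReal_le_ofReal_iff (by positivity), ← Real.enorm_eq_ofReal_abs]
  exact (enorm_potential_add_sub_le hf measurableSet_Ioi (Ioi_subset_Ioi zero_le_one)
    (integrable_mul_scaleKernel_Ioi_one hf hM) x v).trans
    (lintegral_weight_mul_gaussianIncrement_Ioi_one_le hM x hH hH1 hv)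

theorem abs_potential_Ioi_zero_add_sub_le (hf : Continuous f) (hfi : Integrable f)
    (hM : ∀ y, |f y| ≤ M) (hE0 : 0 ≤ E) (hE : ∫⁻ y, ENNReal.ofReal (f y ^ 2) ≤ ENNReal.ofReal E)
    (x : ℝ × ℝ) {H : ℝ} (hH : 0 < H) (hH1 : H ≤ 1) (hv : euclid v ≤ H) :
    |potential (Ioi 0) f (x + v) - potential (Ioi 0) f x|
      ≤ (36 * π * M + 4 * (E + 2 * π)) * logModulus H := by
  have hM0 : 0 ≤ M := (abs_nonneg _).trans (hM 0)
  have hv0 := euclid_nonneg v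
  have hmod := logModulus_nonneg hH.le
  have hsplit := enorm_potential_add_sub_le hf measurableSet_Ioi subset_rfl
    (integrable_mul_scaleKernel_Ioi_zero hf hfi hM) x v
  rw [← Ioc_union_Ioi_eq_Ioi (zero_le_one' ℝ),
    lintegral_union measurableSet_Ioi (Ioc_disjoint_Ioi le_rfl)] at hsplit
  have hbound := hsplit.trans (add_le_add
    (lintegral_weight_mul_gaussianIncrement_Ioc_zero_one_le hf hE0 hE x (hv.trans hH1))
    (lintegral_weight_mul_gaussianIncrement_Ioi_one_le hM x hH hH1 hv))
  rw [← ENNReal.ofReal_add (by positivity) (by positivity), Real.enorm_eq_ofReal_abs,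
    Ioc_union_Ioi_eq_Ioi (zero_le_one' ℝ), ENNReal.ofReal_le_ofReal_iff (by positivity)] at hbound
  have hvmod : 4 * (E + 2 * π) * euclid v ≤ 4 * (E + 2 * π) * logModulus H := by
    gcongr; exact hv.trans (le_logModulus hH.le)
  linarith

end LogLipschitz

/-! ### Subordination on the Fourier side -/

lemma weight_mul_gaussianFT_eq {s : ℝ} (hs : 0 < s) (ξ : ℝ × ℝ) :
    weight s * gaussianFT s ξ = (|(-1 : ℝ)| * s ^ (-1 - 1 : ℝ)) •
      (π * (weight (s ^ (-1 : ℝ)) * gaussian (s ^ (-1 : ℝ)) (π • ξ))) := by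
  have hgauss : gaussian (s ^ (-1 : ℝ)) (π • ξ) = gaussian (π ^ 2 / s) ξ := by
    simp only [gaussian, Real.rpow_neg_one, Prod.smul_fst, Prod.smul_snd, smul_eq_mul]
    congr 1; field_simp
  have hinv : (s ^ (-1 : ℝ)) ^ (-(1 / 2) : ℝ) = s ^ (1 / 2 : ℝ) := by
    rw [← Real.rpow_mul hs.le]; norm_num
  have hpow : s ^ (-1 - 1 : ℝ) * s ^ (1 / 2 : ℝ) = s ^ (-(1 / 2) : ℝ) * s ^ (-1 : ℝ) := by
    rw [← Real.rpow_add hs, ← Real.rpow_add hs]; norm_num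
  rw [gaussianFT, hgauss, weight, weight, hinv, div_eq_mul_inv π s, ← Real.rpow_neg_one s,
    abs_neg, abs_one, one_mul, smul_eq_mul]
  linear_combination -(1 / (2 * π * √π)) * π * gaussian (π ^ 2 / s) ξ * hpow

lemma integrableOn_weight_mul_gaussianFT {ξ : ℝ × ℝ} (hξ : ξ ≠ 0) :
    IntegrableOn (fun s => weight s * gaussianFT s ξ) (Ioi 0) := by
  have h := (integrableOn_weight_mul_gaussian (smul_ne_zero Real.pi_ne_zero hξ)).const_mul π
  refine IntegrableOn.congr_fun ((integrableOn_Ioi_comp_rpow_iff _ (p := -1) (by norm_num)).mpr h)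
    (fun s hs => (weight_mul_gaussianFT_eq hs ξ).symm) measurableSet_Ioi

lemma integral_weight_mul_gaussianFT {ξ : ℝ × ℝ} (hξ : ξ ≠ 0) :
    ∫ s in Ioi 0, weight s * gaussianFT s ξ = 1 / (2 * π * euclid ξ) := by
  rw [setIntegral_congr_fun measurableSet_Ioi (fun s hs => weight_mul_gaussianFT_eq hs ξ),
    integral_comp_rpow_Ioi (fun y => π * (weight y * gaussian y (π • ξ))) (by norm_num),
    integral_const_mul, ← scaleKernel, scaleKernel_Ioi_zero (smul_ne_zero Real.pi_ne_zero hξ),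
    euclid_smul, abs_of_pos Real.pi_pos]
  have := euclid_pos hξ
  field_simp

lemma lintegral_weight_mul_gaussianFT {ξ : ℝ × ℝ} (hξ : ξ ≠ 0) :
    ∫⁻ s in Ioi 0, ENNReal.ofReal (weight s) * ENNReal.ofReal (gaussianFT s ξ)
      = ENNReal.ofReal (1 / (2 * π * euclid ξ)) := by
  rw [← integral_weight_mul_gaussianFT hξ,
    ofReal_integral_eq_lintegral_ofReal (integrableOn_weight_mul_gaussianFT hξ)]
  · exact setLIntegral_congr_fun measurableSet_Ioi fun s hs =>
      (ENNReal.ofReal_mul (weight_nonneg (le_of_lt hs))).symm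
  · filter_upwards [ae_restrict_mem measurableSet_Ioi] with s hs
    exact mul_nonneg (weight_nonneg (le_of_lt hs)) (gaussianFT_nonneg (le_of_lt hs) ξ)

/-! ### The Fourier transform on the plane -/

lemma enorm_complex_ofReal (r : ℝ) : ‖(r : ℂ)‖ₑ = ENNReal.ofReal |r| := by
  rw [← ofReal_norm, Complex.norm_real, Real.norm_eq_abs]

/-- The Fourier transform of a real function on the plane, with the normalization of the phase
used in `character`. -/
def planeFourier (f : ℝ × ℝ → ℝ) (ξ : ℝ × ℝ) : ℂ := ∫ x, (f x : ℂ) * character ξ x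

lemma measurable_planeFourier {f : ℝ × ℝ → ℝ} (hf : Continuous f) :
    Measurable (planeFourier f) := by
  have : Continuous fun p : (ℝ × ℝ) × (ℝ × ℝ) => (f p.2 : ℂ) * character p.1 p.2 :=
    (Complex.continuous_ofReal.comp (hf.comp continuous_snd)).mul continuous_character_uncurry
  exact (this.measurable.stronglyMeasurable.integral_prod_right (ν := volume)).measurable

lemma norm_planeFourier_le (f : ℝ × ℝ → ℝ) (ξ : ℝ × ℝ) : ‖planeFourier f ξ‖ ≤ ∫ x, |f x| :=
  (norm_integral_le_integral_norm _).trans (by simp)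

lemma conj_planeFourier (f : ℝ × ℝ → ℝ) (ξ : ℝ × ℝ) :
    (starRingEnd ℂ) (planeFourier f ξ) = ∫ y, (f y : ℂ) * (starRingEnd ℂ) (character ξ y) := by
  rw [planeFourier, ← integral_conj]; simp

lemma integrable_gaussianFT {s : ℝ} (hs : 0 < s) : Integrable (gaussianFT s) :=
  (integrable_gaussian (by positivity)).const_mul _

lemma integrable_mul_mul_gaussianFT_mul_character {f g : ℝ × ℝ → ℝ} (hf : Integrable f)
    (hg : Integrable g) {s : ℝ} (hs : 0 < s) :
    Integrable (fun q : ((ℝ × ℝ) × (ℝ × ℝ)) × (ℝ × ℝ) =>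
      ((g q.1.1 * f q.1.2 * gaussianFT s q.2 : ℝ) : ℂ) * character q.2 (q.1.1 - q.1.2))
      ((volume.prod volume).prod volume) := by
  refine (((hg.mul_prod hf).mul_prod (integrable_gaussianFT hs)).ofReal).mul_bdd (c := 1) ?_
    (.of_forall fun q => by simp)
  exact (continuous_character_uncurry.comp (by fun_prop : Continuous
    fun q : ((ℝ × ℝ) × (ℝ × ℝ)) × (ℝ × ℝ) => (q.2, q.1.1 - q.1.2))).aestronglyMeasurable

lemma integral_mul_mul_gaussian {f g : ℝ × ℝ → ℝ} (hf : Integrable f) (hg : Integrable g) {s : ℝ}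
    (hs : 0 < s) :
    ∫ p : (ℝ × ℝ) × (ℝ × ℝ), ((g p.1 * f p.2 * gaussian s (p.1 - p.2) : ℝ) : ℂ)
      = ∫ ξ, (gaussianFT s ξ : ℂ) * (planeFourier g ξ * (starRingEnd ℂ) (planeFourier f ξ)) := by
  calc ∫ p : (ℝ × ℝ) × (ℝ × ℝ), ((g p.1 * f p.2 * gaussian s (p.1 - p.2) : ℝ) : ℂ)
      = ∫ p : (ℝ × ℝ) × (ℝ × ℝ), ∫ ξ,
          ((g p.1 * f p.2 * gaussianFT s ξ : ℝ) : ℂ) * character ξ (p.1 - p.2) := by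
        refine integral_congr_ae (.of_forall fun p => ?_)
        simp only
        rw [Complex.ofReal_mul, gaussian_eq_integral_gaussianFT hs, ← integral_const_mul]
        refine integral_congr_ae (.of_forall fun ξ => ?_)
        simp only; push_cast; ring
    _ = ∫ ξ, ∫ p : (ℝ × ℝ) × (ℝ × ℝ),
          ((g p.1 * f p.2 * gaussianFT s ξ : ℝ) : ℂ) * character ξ (p.1 - p.2) :=
        integral_integral_swap (integrable_mul_mul_gaussianFT_mul_character hf hg hs)
    _ = ∫ ξ, (gaussianFT s ξ : ℂ) *
          (planeFourier g ξ * (starRingEnd ℂ) (planeFourier f ξ)) := by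
        refine integral_congr_ae (.of_forall fun ξ => ?_)
        simp only
        rw [conj_planeFourier, planeFourier, ← integral_prod_mul, ← integral_const_mul]
        refine integral_congr_ae (.of_forall fun p => ?_)
        simp only [character_sub]; push_cast; ring

/-! ### Half of Plancherel's identity -/

lemma measurable_gaussian_sub (s : ℝ) :
    Measurable fun p : (ℝ × ℝ) × (ℝ × ℝ) => gaussian s (p.1 - p.2) :=
  ((continuous_gaussian s).comp (by fun_prop)).measurable

lemma lintegral_fst_mul_gaussian {F : ℝ × ℝ → ℝ≥0∞} (hF : Measurable F) {s : ℝ} (hs : 0 < s) :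
    ∫⁻ p : (ℝ × ℝ) × (ℝ × ℝ), F p.1 * ENNReal.ofReal (gaussian s (p.1 - p.2))
      = ENNReal.ofReal (π / s) * ∫⁻ x, F x := by
  have hmeas : Measurable fun p : (ℝ × ℝ) × (ℝ × ℝ) =>
      F p.1 * ENNReal.ofReal (gaussian s (p.1 - p.2)) :=
    (hF.comp measurable_fst).mul (measurable_gaussian_sub s).ennreal_ofReal
  rw [Measure.volume_eq_prod, lintegral_prod _ hmeas.aemeasurable,
    ← lintegral_const_mul' _ _ ENNReal.ofReal_ne_top]
  refine lintegral_congr fun x => ?_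
  have hslice : Measurable fun y => ENNReal.ofReal (gaussian s (x - y)) :=
    ((measurable_gaussian_sub s).comp measurable_prodMk_left).ennreal_ofReal
  rw [← lintegral_gaussian_sub_left hs x, mul_comm]
  exact lintegral_const_mul (F x) hslice

lemma lintegral_snd_mul_gaussian {F : ℝ × ℝ → ℝ≥0∞} (hF : Measurable F) {s : ℝ} (hs : 0 < s) :
    ∫⁻ p : (ℝ × ℝ) × (ℝ × ℝ), F p.2 * ENNReal.ofReal (gaussian s (p.1 - p.2))
      = ENNReal.ofReal (π / s) * ∫⁻ x, F x := by
  rw [← lintegral_fst_mul_gaussian hF hs, Measure.volume_eq_prod, ← lintegral_prod_swap]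
  refine lintegral_congr fun p => ?_
  rw [Prod.fst_swap, Prod.snd_swap, ← gaussian_neg, neg_sub]

lemma lintegral_enorm_mul_mul_gaussian_le {f : ℝ × ℝ → ℝ} (hf : Continuous f) {s : ℝ}
    (hs : 0 < s) :
    ∫⁻ p : (ℝ × ℝ) × (ℝ × ℝ), ‖f p.1 * f p.2 * gaussian s (p.1 - p.2)‖ₑ
      ≤ ENNReal.ofReal (π / s) * ∫⁻ x, ENNReal.ofReal (f x ^ 2) := by
  have hf2 : Measurable fun x => ENNReal.ofReal (f x ^ 2) := by fun_prop
  have hpoint (p : (ℝ × ℝ) × (ℝ × ℝ)) : 2 * ‖f p.1 * f p.2 * gaussian s (p.1 - p.2)‖ₑ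
      ≤ ENNReal.ofReal (f p.1 ^ 2) * ENNReal.ofReal (gaussian s (p.1 - p.2)) +
        ENNReal.ofReal (f p.2 ^ 2) * ENNReal.ofReal (gaussian s (p.1 - p.2)) := by
    rw [Real.enorm_eq_ofReal_abs, abs_mul, abs_of_pos (gaussian_pos _ _), ← add_mul,
      ← ENNReal.ofReal_add (sq_nonneg _) (sq_nonneg _), ← ENNReal.ofReal_mul (by positivity),
      show (2 : ℝ≥0∞) = ENNReal.ofReal 2 by simp, ← ENNReal.ofReal_mul (by norm_num), ← mul_assoc]
    refine ENNReal.ofReal_le_ofReal (mul_le_mul_of_nonneg_right ?_ (gaussian_nonneg _ _))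
    rw [abs_mul, ← mul_assoc, ← sq_abs (f p.1), ← sq_abs (f p.2)]
    exact two_mul_le_add_sq _ _
  have hmeas : Measurable fun p : (ℝ × ℝ) × (ℝ × ℝ) =>
      ENNReal.ofReal (f p.1 ^ 2) * ENNReal.ofReal (gaussian s (p.1 - p.2)) :=
    (hf2.comp measurable_fst).mul (measurable_gaussian_sub s).ennreal_ofReal
  have h2 := lintegral_mono (μ := volume) hpoint
  rw [lintegral_add_left hmeas, lintegral_fst_mul_gaussian hf2 hs,
    lintegral_snd_mul_gaussian hf2 hs, ← two_mul, lintegral_const_mul' _ _ (by simp)] at h2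
  exact (ENNReal.mul_le_mul_iff_right (by simp) (by simp)).mp h2

lemma lintegral_gaussianFT_mul_planeFourier_sq {f : ℝ × ℝ → ℝ} (hf : Continuous f) {s : ℝ}
    (hs : 0 < s) : ∫⁻ ξ, ENNReal.ofReal (gaussianFT s ξ) * ‖planeFourier f ξ‖ₑ ^ 2
      = ‖∫ ξ, (gaussianFT s ξ : ℂ) *
          (planeFourier f ξ * (starRingEnd ℂ) (planeFourier f ξ))‖ₑ := by
  have hreal (ξ : ℝ × ℝ) : (gaussianFT s ξ : ℂ) *
      (planeFourier f ξ * (starRingEnd ℂ) (planeFourier f ξ))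
        = ((gaussianFT s ξ * ‖planeFourier f ξ‖ ^ 2 : ℝ) : ℂ) := by
    rw [Complex.mul_conj']; push_cast; ring
  have hnonneg (ξ : ℝ × ℝ) : 0 ≤ gaussianFT s ξ * ‖planeFourier f ξ‖ ^ 2 :=
    mul_nonneg (gaussianFT_nonneg hs.le ξ) (by positivity)
  have hint : Integrable fun ξ => gaussianFT s ξ * ‖planeFourier f ξ‖ ^ 2 := by
    refine (integrable_gaussianFT hs).mul_bdd (c := (∫ x, |f x|) ^ 2)
      ((measurable_planeFourier hf).norm.pow_const 2).aestronglyMeasurable (.of_forall fun ξ => ?_)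
    rw [norm_pow, norm_norm]
    exact pow_le_pow_left₀ (norm_nonneg _) (norm_planeFourier_le f ξ) 2
  simp_rw [hreal]
  rw [integral_complex_ofReal, enorm_complex_ofReal, abs_of_nonneg (integral_nonneg hnonneg),
    ofReal_integral_eq_lintegral_ofReal hint (.of_forall hnonneg)]
  refine lintegral_congr fun ξ => ?_
  rw [ENNReal.ofReal_mul (gaussianFT_nonneg hs.le ξ), ENNReal.ofReal_pow (norm_nonneg _),
    ofReal_norm]

lemma lintegral_gaussian_mul_planeFourier_sq_le {f : ℝ × ℝ → ℝ} (hfc : Continuous f)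
    (hf : Integrable f) {s : ℝ} (hs : 0 < s) :
    ∫⁻ ξ, ENNReal.ofReal (gaussian (π ^ 2 / s) ξ) * ‖planeFourier f ξ‖ₑ ^ 2
      ≤ ∫⁻ x, ENNReal.ofReal (f x ^ 2) := by
  have hps : 0 < π / s := by positivity
  refine (ENNReal.mul_le_mul_iff_right (by simpa using hps) ENNReal.ofReal_ne_top).mp ?_
  calc ENNReal.ofReal (π / s) *
        ∫⁻ ξ, ENNReal.ofReal (gaussian (π ^ 2 / s) ξ) * ‖planeFourier f ξ‖ₑ ^ 2
      = ∫⁻ ξ, ENNReal.ofReal (gaussianFT s ξ) * ‖planeFourier f ξ‖ₑ ^ 2 := by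
        rw [← lintegral_const_mul' _ _ ENNReal.ofReal_ne_top]
        refine lintegral_congr fun ξ => ?_
        rw [gaussianFT, ENNReal.ofReal_mul hps.le, mul_assoc]
    _ = ‖∫ p : (ℝ × ℝ) × (ℝ × ℝ), ((f p.1 * f p.2 * gaussian s (p.1 - p.2) : ℝ) : ℂ)‖ₑ := by
        rw [lintegral_gaussianFT_mul_planeFourier_sq hfc hs, integral_mul_mul_gaussian hf hf hs]
    _ ≤ ∫⁻ p : (ℝ × ℝ) × (ℝ × ℝ), ‖f p.1 * f p.2 * gaussian s (p.1 - p.2)‖ₑ := by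
        rw [integral_complex_ofReal, enorm_complex_ofReal, ← Real.enorm_eq_ofReal_abs]
        exact enorm_integral_le_lintegral_enorm _
    _ ≤ ENNReal.ofReal (π / s) * ∫⁻ x, ENNReal.ofReal (f x ^ 2) :=
        lintegral_enorm_mul_mul_gaussian_le hfc hs

theorem lintegral_planeFourier_sq_le {f : ℝ × ℝ → ℝ} (hfc : Continuous f) (hf : Integrable f) :
    ∫⁻ ξ, ‖planeFourier f ξ‖ₑ ^ 2 ≤ ∫⁻ x, ENNReal.ofReal (f x ^ 2) := by
  set G : ℕ → ℝ × ℝ → ℝ≥0∞ := fun n ξ =>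
    ENNReal.ofReal (gaussian (π ^ 2 / ((n : ℝ) + 1)) ξ) * ‖planeFourier f ξ‖ₑ ^ 2 with hG
  have hlim (ξ : ℝ × ℝ) : Tendsto (fun n => G n ξ) atTop (𝓝 (‖planeFourier f ξ‖ₑ ^ 2)) := by
    have hscale : Tendsto (fun n : ℕ => π ^ 2 / ((n : ℝ) + 1)) atTop (𝓝 0) := by
      simpa [div_eq_mul_inv] using
        (tendsto_one_div_add_atTop_nhds_zero_nat (𝕜 := ℝ)).const_mul (π ^ 2)
    have hcont : Continuous fun a : ℝ => gaussian a ξ := by unfold gaussian; fun_prop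
    have := ENNReal.Tendsto.mul_const (b := ‖planeFourier f ξ‖ₑ ^ 2)
      (ENNReal.tendsto_ofReal ((hcont.tendsto 0).comp hscale)) (Or.inl (by simp [gaussian]))
    simpa [hG, gaussian] using this
  calc ∫⁻ ξ, ‖planeFourier f ξ‖ₑ ^ 2 = ∫⁻ ξ, liminf (fun n => G n ξ) atTop :=
        lintegral_congr fun ξ => (hlim ξ).liminf_eq.symm
    _ ≤ liminf (fun n => ∫⁻ ξ, G n ξ) atTop := lintegral_liminf_le fun n =>
        (continuous_gaussian _).measurable.ennreal_ofReal.mul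
          ((measurable_planeFourier hfc).enorm.pow_const 2)
    _ ≤ ∫⁻ x, ENNReal.ofReal (f x ^ 2) := by
        refine liminf_le_of_le (by isBoundedDefault) fun b hb => ?_
        obtain ⟨n, hn⟩ := hb.exists
        exact hn.trans (lintegral_gaussian_mul_planeFourier_sq_le hfc hf (by positivity))

/-! ### The gradient of a Riesz potential -/

section Potential

variable {f g : ℝ × ℝ → ℝ} {M : ℝ}

lemma integral_abs_mul_scaleKernel_Ioi_zero_le (hfc : Continuous f) (hf : Integrable f)
    (hM : ∀ y, |f y| ≤ M) (x : ℝ × ℝ) :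
    ∫ y, |f y * scaleKernel (Ioi 0) (x - y)|
      ≤ (∫ y, |f y| * 2) + ∫ z, M * scaleKernel (Ioi 1) z := by
  have htranslate : ∫ z, M * scaleKernel (Ioi 1) z = ∫ y, M * scaleKernel (Ioi 1) (x - y) :=
    (integral_sub_left_eq_self (fun z => M * scaleKernel (Ioi 1) z) volume x).symm
  have hfine : Integrable fun y => M * scaleKernel (Ioi 1) (x - y) :=
    (integrable_scaleKernel_Ioi_one.comp_sub_left x).const_mul M
  rw [htranslate, ← integral_add (hf.abs.mul_const 2) hfine]
  refine integral_mono_ae (integrable_mul_scaleKernel_Ioi_zero hfc hf hM x).abs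
    ((hf.abs.mul_const 2).add hfine) ?_
  filter_upwards [ae_sub_ne_zero x] with y hy
  have hfine0 := scaleKernel_nonneg measurableSet_Ioi (Ioi_subset_Ioi zero_le_one) (x - y)
  rw [abs_mul, abs_of_nonneg (scaleKernel_nonneg measurableSet_Ioi subset_rfl _),
    scaleKernel_Ioi_zero_eq_add hy, mul_add]
  gcongr
  · exact scaleKernel_Ioc_zero_one_le hy
  · exact hM y

lemma integrable_mul_mul_scaleKernel (hfc : Continuous f) (hf : Integrable f)
    (hM : ∀ y, |f y| ≤ M) (hgc : Continuous g) (hg : Integrable g) :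
    Integrable fun p : (ℝ × ℝ) × (ℝ × ℝ) =>
      g p.1 * (f p.2 * scaleKernel (Ioi 0) (p.1 - p.2)) := by
  have hmeas : Measurable fun p : (ℝ × ℝ) × (ℝ × ℝ) =>
      g p.1 * (f p.2 * scaleKernel (Ioi 0) (p.1 - p.2)) :=
    (hgc.measurable.comp measurable_fst).mul ((hfc.measurable.comp measurable_snd).mul
      ((measurable_scaleKernel _).comp (measurable_fst.sub measurable_snd)))
  rw [Measure.volume_eq_prod, integrable_prod_iff hmeas.aestronglyMeasurable]
  refine ⟨.of_forall fun x => (integrable_mul_scaleKernel_Ioi_zero hfc hf hM x).const_mul (g x),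
    (hg.norm.mul_const ((∫ y, |f y| * 2) + ∫ z, M * scaleKernel (Ioi 1) z)).mono'
      hmeas.aestronglyMeasurable.norm.integral_prod_right' (.of_forall fun x => ?_)⟩
  rw [Real.norm_of_nonneg (integral_nonneg fun y => norm_nonneg _)]
  simp only [norm_mul (g x)]
  rw [integral_const_mul]
  exact mul_le_mul_of_nonneg_left (integral_abs_mul_scaleKernel_Ioi_zero_le hfc hf hM x)
    (norm_nonneg _)

lemma integral_mul_potential (hfc : Continuous f) (hf : Integrable f) (hM : ∀ y, |f y| ≤ M)
    (hgc : Continuous g) (hg : Integrable g) :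
    ∫ x, g x * potential (Ioi 0) f x
      = ∫ p : (ℝ × ℝ) × (ℝ × ℝ), g p.1 * (f p.2 * scaleKernel (Ioi 0) (p.1 - p.2)) := by
  refine Eq.trans ?_ (integral_prod _ (integrable_mul_mul_scaleKernel hfc hf hM hgc hg)).symm
  exact integral_congr_ae (.of_forall fun x => (integral_const_mul _ _).symm)

lemma ae_fst_sub_snd_ne_zero : ∀ᵐ p : (ℝ × ℝ) × (ℝ × ℝ), p.1 - p.2 ≠ 0 := by
  have hmeas : MeasurableSet {p : (ℝ × ℝ) × (ℝ × ℝ) | p.1 - p.2 ≠ 0} :=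
    (measurable_fst.sub measurable_snd) (measurableSet_singleton 0).compl
  rw [Measure.volume_eq_prod, Measure.ae_prod_iff_ae_ae hmeas]
  exact .of_forall ae_sub_ne_zero

lemma integrable_weight_mul_mul_mul_gaussian (hfc : Continuous f) (hf : Integrable f)
    (hM : ∀ y, |f y| ≤ M) (hgc : Continuous g) (hg : Integrable g) :
    Integrable (fun q : ((ℝ × ℝ) × (ℝ × ℝ)) × ℝ =>
      weight q.2 * (g q.1.1 * f q.1.2 * gaussian q.2 (q.1.1 - q.1.2)))
      (volume.prod (volume.restrict (Ioi 0))) := by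
  have hgauss : Continuous fun q : ((ℝ × ℝ) × (ℝ × ℝ)) × ℝ => gaussian q.2 (q.1.1 - q.1.2) := by
    unfold gaussian; fun_prop
  have hmeas : Measurable fun q : ((ℝ × ℝ) × (ℝ × ℝ)) × ℝ =>
      weight q.2 * (g q.1.1 * f q.1.2 * gaussian q.2 (q.1.1 - q.1.2)) :=
    (measurable_weight.comp measurable_snd).mul (Continuous.measurable (by fun_prop))
  rw [integrable_prod_iff hmeas.aestronglyMeasurable]
  constructor
  · filter_upwards [ae_fst_sub_snd_ne_zero] with p hp
    refine ((integrableOn_weight_mul_gaussian hp).const_mul (g p.1 * f p.2)).congr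
      (.of_forall fun s => ?_)
    ring
  · refine (integrable_mul_mul_scaleKernel hfc hf hM hgc hg).norm.congr (.of_forall fun p => ?_)
    simp only
    rw [norm_mul, norm_mul, Real.norm_of_nonneg (scaleKernel_nonneg measurableSet_Ioi subset_rfl _),
      scaleKernel, ← mul_assoc, ← integral_const_mul]
    refine setIntegral_congr_fun measurableSet_Ioi fun s hs => ?_
    simp only [norm_mul, Real.norm_of_nonneg (weight_nonneg (le_of_lt hs)),
      Real.norm_of_nonneg (gaussian_nonneg s _)]
    ring

lemma integral_mul_mul_scaleKernel (hfc : Continuous f) (hf : Integrable f)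
    (hM : ∀ y, |f y| ≤ M) (hgc : Continuous g) (hg : Integrable g) :
    ∫ p : (ℝ × ℝ) × (ℝ × ℝ), g p.1 * (f p.2 * scaleKernel (Ioi 0) (p.1 - p.2))
      = ∫ s in Ioi 0, weight s *
          ∫ p : (ℝ × ℝ) × (ℝ × ℝ), g p.1 * f p.2 * gaussian s (p.1 - p.2) := by
  calc ∫ p : (ℝ × ℝ) × (ℝ × ℝ), g p.1 * (f p.2 * scaleKernel (Ioi 0) (p.1 - p.2))
      = ∫ p : (ℝ × ℝ) × (ℝ × ℝ), ∫ s in Ioi 0,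
          weight s * (g p.1 * f p.2 * gaussian s (p.1 - p.2)) := by
        refine integral_congr_ae (.of_forall fun p => ?_)
        simp only
        rw [scaleKernel, ← mul_assoc, ← integral_const_mul]
        refine integral_congr_ae (.of_forall fun s => ?_)
        simp only; ring
    _ = ∫ s in Ioi 0, ∫ p : (ℝ × ℝ) × (ℝ × ℝ),
          weight s * (g p.1 * f p.2 * gaussian s (p.1 - p.2)) :=
        integral_integral_swap (integrable_weight_mul_mul_mul_gaussian hfc hf hM hgc hg)
    _ = ∫ s in Ioi 0, weight s *
          ∫ p : (ℝ × ℝ) × (ℝ × ℝ), g p.1 * f p.2 * gaussian s (p.1 - p.2) := by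
        simp_rw [integral_const_mul]

lemma enorm_integral_mul_mul_gaussian_le (hf : Integrable f) (hg : Integrable g) {s : ℝ}
    (hs : 0 < s) :
    ‖∫ p : (ℝ × ℝ) × (ℝ × ℝ), g p.1 * f p.2 * gaussian s (p.1 - p.2)‖ₑ
      ≤ ∫⁻ ξ, ENNReal.ofReal (gaussianFT s ξ) * (‖planeFourier g ξ‖ₑ * ‖planeFourier f ξ‖ₑ) := by
  rw [Real.enorm_eq_ofReal_abs, ← enorm_complex_ofReal, ← integral_complex_ofReal,
    integral_mul_mul_gaussian hf hg hs]
  refine (enorm_integral_le_lintegral_enorm _).trans (lintegral_mono fun ξ => le_of_eq ?_)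
  rw [enorm_mul, enorm_mul, enorm_complex_ofReal, abs_of_nonneg (gaussianFT_nonneg hs.le ξ)]
  congr 2
  rw [← ofReal_norm, ← ofReal_norm, RCLike.norm_conj]

lemma lintegral_weight_mul_lintegral_gaussianFT {W : ℝ × ℝ → ℝ≥0∞} (hW : Measurable W)
    (hW' : ∀ ξ, W ξ ≠ ⊤) :
    ∫⁻ s in Ioi 0, ENNReal.ofReal (weight s) * ∫⁻ ξ, ENNReal.ofReal (gaussianFT s ξ) * W ξ
      = ∫⁻ ξ, ENNReal.ofReal (1 / (2 * π * euclid ξ)) * W ξ := by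
  have hFT : Measurable fun q : ℝ × (ℝ × ℝ) => gaussianFT q.1 q.2 := by
    unfold gaussianFT gaussian; fun_prop
  have hmeas : Measurable fun q : ℝ × (ℝ × ℝ) =>
      ENNReal.ofReal (weight q.1) * (ENNReal.ofReal (gaussianFT q.1 q.2) * W q.2) :=
    (measurable_weight.comp measurable_fst).ennreal_ofReal.mul
      (hFT.ennreal_ofReal.mul (hW.comp measurable_snd))
  simp_rw [← lintegral_const_mul' _ _ ENNReal.ofReal_ne_top]
  rw [lintegral_lintegral_swap hmeas.aemeasurable]
  refine lintegral_congr_ae ?_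
  filter_upwards [Measure.ae_ne volume 0] with ξ hξ
  simp_rw [← mul_assoc]
  rw [lintegral_mul_const' _ _ (hW' ξ), lintegral_weight_mul_gaussianFT hξ]

lemma enorm_integral_mul_potential_le (hfc : Continuous f) (hf : Integrable f)
    (hM : ∀ y, |f y| ≤ M) (hgc : Continuous g) (hg : Integrable g) :
    ‖∫ x, g x * potential (Ioi 0) f x‖ₑ ≤ ∫⁻ ξ, ENNReal.ofReal (1 / (2 * π * euclid ξ)) *
      (‖planeFourier g ξ‖ₑ * ‖planeFourier f ξ‖ₑ) := by
  have hmeas : Measurable fun ξ => ‖planeFourier g ξ‖ₑ * ‖planeFourier f ξ‖ₑ :=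
    (measurable_planeFourier hgc).enorm.mul (measurable_planeFourier hfc).enorm
  rw [integral_mul_potential hfc hf hM hgc hg, integral_mul_mul_scaleKernel hfc hf hM hgc hg,
    ← lintegral_weight_mul_lintegral_gaussianFT hmeas
      fun ξ => ENNReal.mul_ne_top enorm_ne_top enorm_ne_top]
  refine (enorm_integral_le_lintegral_enorm _).trans
    (setLIntegral_mono' measurableSet_Ioi fun s hs => ?_)
  rw [enorm_mul, Real.enorm_of_nonneg (weight_nonneg (le_of_lt hs))]
  gcongr
  exact enorm_integral_mul_mul_gaussian_le hf hg hs

end Potential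

lemma abs_integral_mul_potential_le {f g G : ℝ × ℝ → ℝ} (hfc : Continuous f) (hf : Integrable f)
    {M : ℝ} (hM : ∀ y, |f y| ≤ M) (hgc : Continuous g) (hg : Integrable g) (hGc : Continuous G)
    (hG : Integrable G)
    (hGg : ∀ ξ, ‖planeFourier G ξ‖ ≤ 2 * π * euclid ξ * ‖planeFourier g ξ‖) {E F : ℝ}
    (hE0 : 0 ≤ E) (hF0 : 0 ≤ F) (hE : ∫⁻ y, ENNReal.ofReal (f y ^ 2) ≤ ENNReal.ofReal E)
    (hF : ∫⁻ y, ENNReal.ofReal (g y ^ 2) ≤ ENNReal.ofReal F) :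
    |∫ x, G x * potential (Ioi 0) f x| ≤ E + F := by
  have hpoint {ξ : ℝ × ℝ} (hξ : ξ ≠ 0) :
      1 / (2 * π * euclid ξ) * (‖planeFourier G ξ‖ * ‖planeFourier f ξ‖)
        ≤ ‖planeFourier g ξ‖ ^ 2 + ‖planeFourier f ξ‖ ^ 2 := by
    have hpos := euclid_pos hξ
    calc 1 / (2 * π * euclid ξ) * (‖planeFourier G ξ‖ * ‖planeFourier f ξ‖)
        ≤ 1 / (2 * π * euclid ξ) *
            (2 * π * euclid ξ * ‖planeFourier g ξ‖ * ‖planeFourier f ξ‖) := by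
          gcongr; exact hGg ξ
      _ = ‖planeFourier g ξ‖ * ‖planeFourier f ξ‖ := by field_simp
      _ ≤ ‖planeFourier g ξ‖ ^ 2 + ‖planeFourier f ξ‖ ^ 2 := by
          nlinarith [sq_nonneg (‖planeFourier g ξ‖ - ‖planeFourier f ξ‖),
            norm_nonneg (planeFourier g ξ), norm_nonneg (planeFourier f ξ)]
  rw [← ENNReal.ofReal_le_ofReal_iff (by positivity), ← Real.enorm_eq_ofReal_abs]
  calc ‖∫ x, G x * potential (Ioi 0) f x‖ₑ
      ≤ ∫⁻ ξ, ENNReal.ofReal (1 / (2 * π * euclid ξ)) *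
          (‖planeFourier G ξ‖ₑ * ‖planeFourier f ξ‖ₑ) :=
        enorm_integral_mul_potential_le hfc hf hM hGc hG
    _ ≤ ∫⁻ ξ, (‖planeFourier g ξ‖ₑ ^ 2 + ‖planeFourier f ξ‖ₑ ^ 2) := by
        refine lintegral_mono_ae ?_
        filter_upwards [Measure.ae_ne volume 0] with ξ hξ
        simp only [← ofReal_norm]
        have := euclid_nonneg ξ
        rw [← ENNReal.ofReal_mul (norm_nonneg _), ← ENNReal.ofReal_mul (by positivity),
          ← ENNReal.ofReal_pow (norm_nonneg _), ← ENNReal.ofReal_pow (norm_nonneg _),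
          ← ENNReal.ofReal_add (by positivity) (by positivity)]
        exact ENNReal.ofReal_le_ofReal (hpoint hξ)
    _ ≤ ENNReal.ofReal (E + F) := by
        rw [lintegral_add_left ((measurable_planeFourier hgc).enorm.pow_const 2),
          ENNReal.ofReal_add hE0 hF0, add_comm]
        exact add_le_add ((lintegral_planeFourier_sq_le hfc hf).trans hE)
          ((lintegral_planeFourier_sq_le hgc hg).trans hF)

/-- The linear form `v ↦ ξ · v` on the plane. -/
def dotCLM (ξ : ℝ × ℝ) : ℝ × ℝ →L[ℝ] ℝ :=
  ξ.1 • ContinuousLinearMap.fst ℝ ℝ ℝ + ξ.2 • ContinuousLinearMap.snd ℝ ℝ ℝ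

@[simp] lemma dotCLM_apply (ξ v : ℝ × ℝ) : dotCLM ξ v = ξ.1 * v.1 + ξ.2 * v.2 := rfl

lemma hasFDerivAt_character (ξ x : ℝ × ℝ) :
    HasFDerivAt (character ξ) ((character ξ x * -(2 * π * Complex.I)) •
      (Complex.ofRealCLM.comp (dotCLM ξ))) x := by
  have hexp : character ξ = fun y => Complex.exp (-(2 * π * Complex.I) *
      Complex.ofRealCLM.comp (dotCLM ξ) y) := by
    funext y; simp [character]
  rw [congrFun hexp x, hexp, mul_smul]
  exact ((Complex.ofRealCLM.comp (dotCLM ξ)).hasFDerivAt.const_mul _).cexp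

lemma integrable_mul_ofReal_of_hasCompactSupport {u : ℝ × ℝ → ℝ} {w : ℝ × ℝ → ℂ}
    (hu : Continuous u) (hus : HasCompactSupport u) (hw : Continuous w) :
    Integrable fun x => w x * (u x : ℂ) :=
  (hw.mul (Complex.continuous_ofReal.comp hu)).integrable_of_hasCompactSupport
    (hus.comp_left (g := fun r : ℝ => (r : ℂ)) Complex.ofReal_zero).mul_left

lemma continuous_fderiv_apply {g : ℝ × ℝ → ℝ} (hg : ContDiff ℝ 1 g) (v : ℝ × ℝ) :
    Continuous fun x => fderiv ℝ g x v :=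
  (hg.continuous_fderiv one_ne_zero).clm_apply continuous_const

lemma planeFourier_fderiv {g : ℝ × ℝ → ℝ} (hg : ContDiff ℝ 1 g) (hgs : HasCompactSupport g)
    (v ξ : ℝ × ℝ) : planeFourier (fun x => fderiv ℝ g x v) ξ
      = 2 * π * Complex.I * (dotCLM ξ v : ℂ) * planeFourier g ξ := by
  have hderiv (x : ℝ × ℝ) :
      HasFDerivAt (fun y => (g y : ℂ)) (Complex.ofRealCLM.comp (fderiv ℝ g x)) x :=
    Complex.ofRealCLM.hasFDerivAt.comp x (hg.differentiable one_ne_zero x).hasFDerivAt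
  have hparts := integral_bilinear_hasFDerivAt_right_eq_neg_left_of_integrable (μ := volume)
    (f := character ξ) (g := fun y => (g y : ℂ)) (v := v) (B := ContinuousLinearMap.mul ℝ ℂ)
    (f' := fun x => (character ξ x * -(2 * π * Complex.I)) • Complex.ofRealCLM.comp (dotCLM ξ))
    (g' := fun x => Complex.ofRealCLM.comp (fderiv ℝ g x))
    (integrable_mul_ofReal_of_hasCompactSupport hg.continuous hgs (w := fun x =>
      ((character ξ x * -(2 * π * Complex.I)) • Complex.ofRealCLM.comp (dotCLM ξ)) v)
      (by fun_prop))
    (integrable_mul_ofReal_of_hasCompactSupport (continuous_fderiv_apply hg v)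
      (hgs.fderiv_apply (𝕜 := ℝ) v) (continuous_character ξ))
    (integrable_mul_ofReal_of_hasCompactSupport hg.continuous hgs (continuous_character ξ))
    (fun x _ => hasFDerivAt_character ξ x) (fun x _ => hderiv x)
  simp only [ContinuousLinearMap.mul_apply', ContinuousLinearMap.comp_apply,
    Complex.ofRealCLM_apply, smul_apply, smul_eq_mul] at hparts
  rw [planeFourier, planeFourier, ← integral_const_mul]
  simp_rw [mul_comm _ (character ξ _)]
  rw [hparts, ← integral_neg]
  refine integral_congr_ae (.of_forall fun x => ?_)
  simp only
  ring

lemma norm_planeFourier_fderiv_le {g : ℝ × ℝ → ℝ} (hg : ContDiff ℝ 1 g)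
    (hgs : HasCompactSupport g) {v : ℝ × ℝ} (hv : euclid v ≤ 1) (ξ : ℝ × ℝ) :
    ‖planeFourier (fun x => fderiv ℝ g x v) ξ‖ ≤ 2 * π * euclid ξ * ‖planeFourier g ξ‖ := by
  rw [planeFourier_fderiv hg hgs, norm_mul]
  gcongr
  simp only [norm_mul, Complex.norm_ofNat, Complex.norm_I, Complex.norm_real, mul_one,
    Real.norm_of_nonneg Real.pi_pos.le]
  gcongr
  exact (abs_dot_le_euclid_mul ξ v).trans (mul_le_of_le_one_right (euclid_nonneg ξ) hv)

lemma IsInvSqrtLaplacian.eq_potential {f ψ : ℝ × ℝ → ℝ} (h : IsInvSqrtLaplacian .plane f ψ) :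
    ψ = potential (Ioi 0) f := by
  funext x
  rw [show ψ x = _ from h x, ← integral_const_mul]
  refine integral_congr_ae ?_
  filter_upwards [ae_sub_ne_zero x] with y hy
  have := euclid_pos hy
  rw [scaleKernel_Ioi_zero hy]; field_simp

-- This `L²` bound for `∇ψ` is put in dual form because `ψ` is not known to have derivatives in
-- `L²` beforehand.
theorem abs_integral_mul_fderiv_potential_le {f g : ℝ × ℝ → ℝ} (hfc : Continuous f)
    (hf : Integrable f) {M : ℝ} (hM : ∀ y, |f y| ≤ M) (hψ : ContDiff ℝ 1 (potential (Ioi 0) f))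
    (hg : ContDiff ℝ 1 g) (hgs : HasCompactSupport g) {v : ℝ × ℝ} (hv : euclid v ≤ 1) {E F : ℝ}
    (hE0 : 0 ≤ E) (hF0 : 0 ≤ F) (hE : ∫⁻ y, ENNReal.ofReal (f y ^ 2) ≤ ENNReal.ofReal E)
    (hF : ∫⁻ y, ENNReal.ofReal (g y ^ 2) ≤ ENNReal.ofReal F) :
    |∫ x, g x * fderiv ℝ (potential (Ioi 0) f) x v| ≤ E + F := by
  have hg' := continuous_fderiv_apply hg v
  have hgs' : HasCompactSupport fun x => fderiv ℝ g x v := hgs.fderiv_apply (𝕜 := ℝ) v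
  rw [integral_mul_fderiv_eq_neg_fderiv_mul_of_integrable
    ((hg'.mul hψ.continuous).integrable_of_hasCompactSupport hgs'.mul_right)
    ((hg.continuous.mul (continuous_fderiv_apply hψ v)).integrable_of_hasCompactSupport
      hgs.mul_right)
    ((hg.continuous.mul hψ.continuous).integrable_of_hasCompactSupport hgs.mul_right)
    (fun x _ => hg.differentiable one_ne_zero x) (fun x _ => hψ.differentiable one_ne_zero x),
    abs_neg]
  exact abs_integral_mul_potential_le hfc hf hM hg.continuous
    (hg.continuous.integrable_of_hasCompactSupport hgs) hg'
    (hg'.integrable_of_hasCompactSupport hgs') (norm_planeFourier_fderiv_le hg hgs hv)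
    hE0 hF0 hE hF

/-! ### Partial derivatives -/

lemma d₁_eq_fderiv {f : ℝ × ℝ → ℝ} {x : ℝ × ℝ} (hf : DifferentiableAt ℝ f x) :
    d₁ f x = fderiv ℝ f x (1, 0) :=
  (hf.hasFDerivAt.comp_hasDerivAt (x := x.1) (f := fun s : ℝ => (s, x.2))
    ((hasDerivAt_id x.1).prodMk (hasDerivAt_const x.1 x.2))).deriv

lemma d₂_eq_fderiv {f : ℝ × ℝ → ℝ} {x : ℝ × ℝ} (hf : DifferentiableAt ℝ f x) :
    d₂ f x = fderiv ℝ f x (0, 1) :=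
  (hf.hasFDerivAt.comp_hasDerivAt (x := x.2) (f := fun s : ℝ => (x.1, s))
    ((hasDerivAt_const x.2 x.1).prodMk (hasDerivAt_id x.2))).deriv

/-! ### Integrals over the domain -/

lemma integrableOn_unitSquare {E : Type*} [NormedAddCommGroup E] {F : ℝ × ℝ → E}
    (hF : Continuous F) : IntegrableOn F unitSquare :=
  (hF.continuousOn.integrableOn_compact (isCompact_Icc.prod isCompact_Icc)).mono_set
    (prod_mono Ico_subset_Icc_self Ico_subset_Icc_self)

lemma measurableSet_unitSquare : MeasurableSet unitSquare :=
  measurableSet_Ico.prod measurableSet_Ico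

lemma norm_le_one_of_mem_unitSquare {x : ℝ × ℝ} (hx : x ∈ unitSquare) : ‖x‖ ≤ 1 := by
  obtain ⟨h₁, h₂⟩ := hx
  rw [Prod.norm_def, Real.norm_of_nonneg h₁.1, Real.norm_of_nonneg h₂.1]
  exact max_le h₁.2.le h₂.2.le

lemma setIntegral_unitSquare {E : Type*} [NormedAddCommGroup E] [NormedSpace ℝ E]
    {F : ℝ × ℝ → E} (hF : Continuous F) :
    ∫ x in unitSquare, F x = ∫ a in (0 : ℝ)..1, ∫ b in (0 : ℝ)..1, F (a, b) := by
  rw [unitSquare, Measure.volume_eq_prod, setIntegral_prod F (integrableOn_unitSquare hF),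
    integral_Ico_eq_integral_Ioc, intervalIntegral.integral_of_le zero_le_one]
  simp only [integral_Ico_eq_integral_Ioc, intervalIntegral.integral_of_le zero_le_one]

lemma setIntegral_unitSquare_add_right {E : Type*} [NormedAddCommGroup E] [NormedSpace ℝ E]
    {F : ℝ × ℝ → E} (hF : Continuous F) (h₁ : ∀ x : ℝ × ℝ, F (x.1 + 1, x.2) = F x)
    (h₂ : ∀ x : ℝ × ℝ, F (x.1, x.2 + 1) = F x) (v : ℝ × ℝ) :
    ∫ x in unitSquare, F (x + v) = ∫ x in unitSquare, F x := by
  have hperiod (k : ℝ → E) (hk : Function.Periodic k 1) (r : ℝ) :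
      ∫ a in (0 : ℝ)..1, k (a + r) = ∫ a in (0 : ℝ)..1, k a := by
    rw [intervalIntegral.integral_comp_add_right, zero_add, add_comm 1 r,
      hk.intervalIntegral_add_eq r 0, zero_add]
  rw [setIntegral_unitSquare (by fun_prop), setIntegral_unitSquare hF,
    ← hperiod (fun a => ∫ b in (0 : ℝ)..1, F (a, b)) (fun a => by simp [fun b => h₁ (a, b)]) v.1]
  exact intervalIntegral.integral_congr fun a _ =>
    hperiod (fun b => F (a + v.1, b)) (fun b => h₂ (a + v.1, b)) v.2

instance (Ω : Domain) : IsFiniteMeasureOnCompacts Ω.measure := by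
  cases Ω with
  | plane => exact inferInstanceAs (IsFiniteMeasureOnCompacts (volume : Measure (ℝ × ℝ)))
  | torus => exact inferInstanceAs (IsFiniteMeasureOnCompacts (volume.restrict unitSquare))

lemma Domain.IsFunction.comp_add_right {Ω : Domain} {f : ℝ × ℝ → ℝ} (hf : Ω.IsFunction f)
    (v : ℝ × ℝ) : Ω.IsFunction fun x => f (x + v) := by
  cases Ω with
  | plane => trivial
  | torus =>
    refine fun x => ⟨?_, ?_⟩
    · refine (congrArg f ?_).trans (hf (x + v)).1
      ext <;> simp [add_right_comm]
    · refine (congrArg f ?_).trans (hf (x + v)).2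
      ext <;> simp [add_right_comm]

lemma Domain.IsFunction.comp {Ω : Domain} {f : ℝ × ℝ → ℝ} (hf : Ω.IsFunction f) (β : ℝ → ℝ) :
    Ω.IsFunction fun x => β (f x) := by
  cases Ω with
  | plane => trivial
  | torus => exact fun x => ⟨congrArg β (hf x).1, congrArg β (hf x).2⟩

lemma Domain.IsFunction.mul {Ω : Domain} {f g : ℝ × ℝ → ℝ} (hf : Ω.IsFunction f)
    (hg : Ω.IsFunction g) : Ω.IsFunction fun x => f x * g x := by
  cases Ω with
  | plane => trivial
  | torus =>
    exact fun x => ⟨congrArg₂ _ (hf x).1 (hg x).1, congrArg₂ _ (hf x).2 (hg x).2⟩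

lemma Domain.IsFunction.sub {Ω : Domain} {f g : ℝ × ℝ → ℝ} (hf : Ω.IsFunction f)
    (hg : Ω.IsFunction g) : Ω.IsFunction fun x => f x - g x := by
  cases Ω with
  | plane => trivial
  | torus =>
    exact fun x => ⟨congrArg₂ _ (hf x).1 (hg x).1, congrArg₂ _ (hf x).2 (hg x).2⟩

lemma integral_domain_add_right {Ω : Domain} {f : ℝ × ℝ → ℝ} (hf : Continuous f)
    (hΩ : Ω.IsFunction f) (v : ℝ × ℝ) :
    ∫ x, f (x + v) ∂Ω.measure = ∫ x, f x ∂Ω.measure := by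
  cases Ω with
  | plane => exact integral_add_right_eq_self (μ := volume) f v
  | torus => exact setIntegral_unitSquare_add_right hf (fun x => (hΩ x).1) (fun x => (hΩ x).2) v

lemma integrable_domain {Ω : Domain} {f : ℝ × ℝ → ℝ} (hf : Continuous f)
    (hc : Ω = .plane → HasCompactSupport f) : Integrable f Ω.measure := by
  cases Ω with
  | plane => exact hf.integrable_of_hasCompactSupport (hc rfl)
  | torus => exact integrableOn_unitSquare hf

/-! ### Integrals of Jacobians -/

/-- The difference quotient of `f` at `x` with step `h` in the direction `v`. For `C¹` functions
`∂₁∂₂` makes no sense, but the identity `∫ ∂₁f ∂₂g = ∫ ∂₂f ∂₁g` is exact at the level of difference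
quotients by translation invariance. -/
def diffQuot (f : ℝ × ℝ → ℝ) (v : ℝ × ℝ) (h : ℝ) (x : ℝ × ℝ) : ℝ :=
  h⁻¹ * (f (x + h • v) - f x)

section Jacobian

variable {f g : ℝ × ℝ → ℝ} {v w : ℝ × ℝ}

lemma continuous_diffQuot (hf : Continuous f) (v : ℝ × ℝ) (h : ℝ) :
    Continuous (diffQuot f v h) := by
  unfold diffQuot
  fun_prop

lemma tendsto_diffQuot (hf : ContDiff ℝ 1 f) (v x : ℝ × ℝ) :
    Tendsto (fun h => diffQuot f v h x) (𝓝[≠] 0) (𝓝 (fderiv ℝ f x v)) :=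
  ((hf.differentiable one_ne_zero x).hasFDerivAt.hasLineDerivAt v).tendsto_slope_zero

lemma norm_diffQuot_le (hf : ContDiff ℝ 1 f) {R C : ℝ}
    (hC : ∀ x ∈ Metric.closedBall (0 : ℝ × ℝ) (R + 1), ‖fderiv ℝ f x‖ ≤ C) (hv : ‖v‖ ≤ 1)
    {h : ℝ} (hh : ‖h‖ ≤ 1) {x : ℝ × ℝ} (hx : ‖x‖ ≤ R) : ‖diffQuot f v h x‖ ≤ C := by
  have hstep : ‖h • v‖ ≤ ‖h‖ := by
    rw [norm_smul]
    exact mul_le_of_le_one_right (norm_nonneg h) hv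
  have hx' : x ∈ Metric.closedBall (0 : ℝ × ℝ) (R + 1) := by
    rw [mem_closedBall_zero_iff]
    linarith
  have hxv : x + h • v ∈ Metric.closedBall (0 : ℝ × ℝ) (R + 1) :=
    mem_closedBall_zero_iff.mpr
      ((norm_add_le _ _).trans (add_le_add hx (hstep.trans hh)))
  have hC0 : 0 ≤ C := (norm_nonneg _).trans (hC x hx')
  have hmvt : ‖f (x + h • v) - f x‖ ≤ C * ‖h • v‖ := by
    simpa using (convex_closedBall (0 : ℝ × ℝ) (R + 1)).norm_image_sub_le_of_norm_fderiv_le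
      (𝕜 := ℝ) (fun z _ => hf.differentiable one_ne_zero z) hC hx' hxv
  rcases eq_or_ne h 0 with rfl | hh0
  · simpa [diffQuot] using hC0
  · rw [diffQuot, norm_mul, norm_inv, inv_mul_le_iff₀ (norm_pos_iff.mpr hh0), mul_comm]
    exact hmvt.trans (by gcongr)

lemma tendsto_integral_diffQuot_mul_diffQuot {μ : Measure (ℝ × ℝ)} [IsFiniteMeasureOnCompacts μ]
    (hf : ContDiff ℝ 1 f) (hg : ContDiff ℝ 1 g) {R : ℝ}
    (hsupp : ∀ᵐ x ∂μ, R < ‖x‖ → ∀ u : ℝ × ℝ, ‖u‖ ≤ 1 → g (x + u) = 0)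
    (hv : ‖v‖ ≤ 1) (hw : ‖w‖ ≤ 1) :
    Tendsto (fun h => ∫ x, diffQuot f v h x * diffQuot g w h x ∂μ) (𝓝[≠] 0)
      (𝓝 (∫ x, fderiv ℝ f x v * fderiv ℝ g x w ∂μ)) := by
  obtain ⟨Cf, hCf⟩ := (isCompact_closedBall (0 : ℝ × ℝ) (R + 1)).exists_bound_of_continuousOn
    (hf.continuous_fderiv one_ne_zero).continuousOn
  obtain ⟨Cg, hCg⟩ := (isCompact_closedBall (0 : ℝ × ℝ) (R + 1)).exists_bound_of_continuousOn
    (hg.continuous_fderiv one_ne_zero).continuousOn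
  have hsmall : ∀ᶠ h : ℝ in 𝓝[≠] 0, ‖h‖ ≤ 1 :=
    nhdsWithin_le_nhds
      ((continuous_norm.tendsto' (0 : ℝ) 0 norm_zero).eventually_le_const one_pos)
  refine tendsto_integral_filter_of_dominated_convergence
    ((Metric.closedBall (0 : ℝ × ℝ) R).indicator fun _ => Cf * Cg)
    (.of_forall fun h => ((continuous_diffQuot hf.continuous v h).mul
      (continuous_diffQuot hg.continuous w h)).aestronglyMeasurable) ?_ ?_
    (.of_forall fun x => (tendsto_diffQuot hf v x).mul (tendsto_diffQuot hg w x))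
  · filter_upwards [hsmall] with h hh
    filter_upwards [hsupp] with x hx
    by_cases hxR : ‖x‖ ≤ R
    · have hfx := norm_diffQuot_le hf hCf hv hh hxR
      rw [indicator_of_mem (mem_closedBall_zero_iff.mpr hxR), norm_mul]
      exact mul_le_mul hfx (norm_diffQuot_le hg hCg hw hh hxR) (norm_nonneg _)
        ((norm_nonneg _).trans hfx)
    · have hhw : ‖h • w‖ ≤ 1 := by
        rw [norm_smul]
        exact mul_le_one₀ hh (norm_nonneg w) hw
      have hgx : g x = 0 := by simpa using hx (not_le.mp hxR) 0 (by simp)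
      rw [diffQuot, diffQuot, hx (not_le.mp hxR) _ hhw, hgx,
        indicator_of_notMem (by simpa using hxR)]
      simp
  · rw [integrable_indicator_iff measurableSet_closedBall]
    exact integrableOn_const (isCompact_closedBall _ _).measure_lt_top.ne

variable {Ω : Domain}

lemma integral_diffQuot_mul_diffQuot (hf : Continuous f) (hg : Continuous g)
    (hfΩ : Ω.IsFunction f) (hgΩ : Ω.IsFunction g) (hc : Ω = .plane → HasCompactSupport g)
    (v w : ℝ × ℝ) (h : ℝ) :
    ∫ x, diffQuot f v h x * diffQuot g w h x ∂Ω.measure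
      = h⁻¹ ^ 2 * ((∫ x, f x * g (x + h • (w - v)) ∂Ω.measure)
        - (∫ x, f x * g (x + h • -v) ∂Ω.measure)
        - (∫ x, f x * g (x + h • w) ∂Ω.measure) + ∫ x, f x * g x ∂Ω.measure) := by
  have hint (p q : ℝ × ℝ) : Integrable (fun x => f (x + p) * g (x + q)) Ω.measure :=
    integrable_domain (by fun_prop)
      fun hΩ => ((hc hΩ).comp_homeomorph (Homeomorph.addRight q)).mul_left
  have htranslate (p q : ℝ × ℝ) : ∫ x, f (x + p) * g (x + q) ∂Ω.measure
      = ∫ x, f x * g (x + (q - p)) ∂Ω.measure := by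
    rw [← integral_domain_add_right (by fun_prop) (hfΩ.mul (hgΩ.comp_add_right (q - p))) p]
    simp only [add_assoc, add_sub_cancel]
  have hvw := hint (h • v) (h • w)
  have hv0 := hint (h • v) 0
  have h0w := hint 0 (h • w)
  have h00 := hint 0 0
  have tvw := htranslate (h • v) (h • w)
  have tv0 := htranslate (h • v) 0
  simp only [add_zero, zero_sub, ← smul_neg, ← smul_sub] at hv0 h0w h00 tvw tv0
  have hvw_v0 : Integrable (fun x => f (x + h • v) * g (x + h • w) - f (x + h • v) * g x)
      Ω.measure := hvw.sub hv0
  have hvw_v0_0w : Integrable (fun x => f (x + h • v) * g (x + h • w) - f (x + h • v) * g x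
      - f x * g (x + h • w)) Ω.measure := hvw_v0.sub h0w
  rw [← tvw, ← tv0, ← integral_sub hvw hv0, ← integral_sub hvw_v0 h0w,
    ← integral_add hvw_v0_0w h00, ← integral_const_mul]
  refine integral_congr_ae (.of_forall fun x => ?_)
  simp only [diffQuot]
  ring

lemma integral_fderiv_mul_fderiv_comm (hf : ContDiff ℝ 1 f) (hg : ContDiff ℝ 1 g)
    (hfΩ : Ω.IsFunction f) (hgΩ : Ω.IsFunction g) (hc : Ω = .plane → HasCompactSupport g)
    (hv : ‖v‖ ≤ 1) (hw : ‖w‖ ≤ 1) :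
    ∫ x, fderiv ℝ f x v * fderiv ℝ g x w ∂Ω.measure
      = ∫ x, fderiv ℝ f x w * fderiv ℝ g x v ∂Ω.measure := by
  obtain ⟨R, hR⟩ : ∃ R, ∀ᵐ x ∂Ω.measure, R < ‖x‖ → ∀ u : ℝ × ℝ, ‖u‖ ≤ 1 → g (x + u) = 0 := by
    cases Ω with
    | plane =>
      obtain ⟨R, hR⟩ := (hc rfl).isCompact.isBounded.subset_closedBall (0 : ℝ × ℝ)
      refine ⟨R + 1, .of_forall fun x hx u hu => ?_⟩
      by_contra hne
      have hxu := hR (subset_tsupport g (Function.mem_support.mpr hne))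
      rw [mem_closedBall_zero_iff] at hxu
      have htriangle : ‖x‖ ≤ ‖x + u‖ + ‖u‖ := by simpa using norm_sub_le (x + u) u
      linarith
    | torus =>
      refine ⟨1, ?_⟩
      filter_upwards [ae_restrict_mem measurableSet_unitSquare] with x hx h
      exact absurd (norm_le_one_of_mem_unitSquare hx) (not_le.mpr h)
  have hneg : Tendsto (fun h : ℝ => -h) (𝓝[≠] 0) (𝓝[≠] 0) :=
    tendsto_nhdsWithin_iff.mpr ⟨tendsto_nhdsWithin_of_tendsto_nhds
      (by simpa using (continuous_neg (G := ℝ)).tendsto 0),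
      eventually_mem_nhdsWithin.mono fun h hh => neg_ne_zero.mpr hh⟩
  refine tendsto_nhds_unique (tendsto_integral_diffQuot_mul_diffQuot hf hg hR hv hw)
    (((tendsto_integral_diffQuot_mul_diffQuot hf hg hR hw hv).comp hneg).congr fun h => ?_)
  simp only [Function.comp_apply]
  rw [integral_diffQuot_mul_diffQuot hf.continuous hg.continuous hfΩ hgΩ hc,
    integral_diffQuot_mul_diffQuot hf.continuous hg.continuous hfΩ hgΩ hc]
  rw [show -h • (v - w) = h • (w - v) by rw [neg_smul, ← smul_neg, neg_sub],
    show -h • -w = h • w from neg_smul_neg h w, show -h • v = h • -v by rw [neg_smul, smul_neg]]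
  ring

/-- The Poisson bracket `∂₁f ∂₂g - ∂₂f ∂₁g`; the transport equation reads `∂ₜθ + {ψ, θ} = 0`. -/
def jacobian (f g : ℝ × ℝ → ℝ) (x : ℝ × ℝ) : ℝ :=
  fderiv ℝ f x (1, 0) * fderiv ℝ g x (0, 1) - fderiv ℝ f x (0, 1) * fderiv ℝ g x (1, 0)

lemma continuous_jacobian (hf : ContDiff ℝ 1 f) (hg : ContDiff ℝ 1 g) :
    Continuous (jacobian f g) :=
  ((continuous_fderiv_apply hf _).mul (continuous_fderiv_apply hg _)).sub
    ((continuous_fderiv_apply hf _).mul (continuous_fderiv_apply hg _))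

lemma integral_jacobian (hf : ContDiff ℝ 1 f) (hg : ContDiff ℝ 1 g)
    (hfΩ : Ω.IsFunction f) (hgΩ : Ω.IsFunction g) (hc : Ω = .plane → HasCompactSupport g) :
    ∫ x, jacobian f g x ∂Ω.measure = 0 := by
  have hint (v w : ℝ × ℝ) :
      Integrable (fun x => fderiv ℝ f x v * fderiv ℝ g x w) Ω.measure :=
    integrable_domain ((continuous_fderiv_apply hf v).mul (continuous_fderiv_apply hg w))
      fun hΩ => ((hc hΩ).fderiv_apply (𝕜 := ℝ) w).mul_left
  refine (integral_sub (hint _ _) (hint _ _)).trans (sub_eq_zero.mpr ?_)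
  exact integral_fderiv_mul_fderiv_comm hf hg hfΩ hgΩ hc (by simp [Prod.norm_def])
    (by simp [Prod.norm_def])

lemma jacobian_mul_comp (hf : ContDiff ℝ 1 f) {ψ χ : ℝ × ℝ → ℝ} (hχ : ContDiff ℝ 1 χ)
    {β : ℝ → ℝ} (hβ : ContDiff ℝ 1 β) (x : ℝ × ℝ) :
    jacobian ψ (fun y => χ y * β (f y)) x
      = χ x * (deriv β (f x) * jacobian ψ f x) + β (f x) * jacobian ψ χ x := by
  have hβf : HasFDerivAt (fun y => β (f y)) (deriv β (f x) • fderiv ℝ f x) x :=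
    (hβ.differentiable one_ne_zero (f x)).hasDerivAt.comp_hasFDerivAt x
      (hf.differentiable one_ne_zero x).hasFDerivAt
  simp only [jacobian, ((hχ.differentiable one_ne_zero x).hasFDerivAt.fun_mul hβf).fderiv,
    add_apply, smul_apply, smul_eq_mul]
  ring

lemma integral_mul_deriv_mul_jacobian {ψ χ : ℝ × ℝ → ℝ} {β : ℝ → ℝ} (hψ : ContDiff ℝ 1 ψ)
    (hf : ContDiff ℝ 1 f) (hχ : ContDiff ℝ 1 χ) (hβ : ContDiff ℝ 1 β) (hψΩ : Ω.IsFunction ψ)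
    (hfΩ : Ω.IsFunction f) (hχΩ : Ω.IsFunction χ) (hc : Ω = .plane → HasCompactSupport χ) :
    ∫ x, χ x * (deriv β (f x) * jacobian ψ f x) ∂Ω.measure
      = -∫ x, β (f x) * jacobian ψ χ x ∂Ω.measure := by
  have hβf : ContDiff ℝ 1 fun x => β (f x) := hβ.comp hf
  have hβ'f : Continuous fun x => deriv β (f x) :=
    (hβ.continuous_deriv le_rfl).comp hf.continuous
  have hproduct : Integrable (fun x => χ x * (deriv β (f x) * jacobian ψ f x)) Ω.measure :=
    integrable_domain (hχ.continuous.mul (hβ'f.mul (continuous_jacobian hψ hf)))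
      fun hΩ => (hc hΩ).mul_right
  have hflux : Integrable (fun x => β (f x) * jacobian ψ χ x) Ω.measure := by
    refine integrable_domain (hβf.continuous.mul (continuous_jacobian hψ hχ)) fun hΩ => ?_
    exact (((hc hΩ).fderiv_apply (𝕜 := ℝ) _).mul_left.sub
      ((hc hΩ).fderiv_apply (𝕜 := ℝ) _).mul_left).mul_left
  rw [eq_neg_iff_add_eq_zero, ← integral_add hproduct hflux]
  simp only [← jacobian_mul_comp hf hχ hβ]
  exact integral_jacobian hψ (hχ.mul hβf) hψΩ (hχΩ.mul (hfΩ.comp β)) fun hΩ => (hc hΩ).mul_right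

end Jacobian

/-! ### Continuous functions on the domain -/

section Norm

variable {Ω : Domain} {f : ℝ × ℝ → ℝ} {M : ℝ}

lemma Domain.IsFunction.apply_fract (hf : Domain.torus.IsFunction f) (x : ℝ × ℝ) :
    f (Int.fract x.1, Int.fract x.2) = f x := by
  have h₁ : Function.Periodic (fun a => f (a, Int.fract x.2)) 1 := fun a => (hf (a, _)).1
  have h₂ : Function.Periodic (fun b => f (x.1, b)) 1 := fun b => (hf (x.1, b)).2
  have h₁' := h₁.sub_int_mul_eq (x := x.1) ⌊x.1⌋
  have h₂' := h₂.sub_int_mul_eq (x := x.2) ⌊x.2⌋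
  simp only [mul_one, Int.self_sub_floor] at h₁' h₂'
  rw [h₁', h₂']

lemma mem_of_ae_mem_of_isClosed (hf : Continuous f) (hΩ : Ω.IsFunction f) {s : Set ℝ}
    (hs : IsClosed s) (h : ∀ᵐ x ∂Ω.measure, f x ∈ s) (x : ℝ × ℝ) : f x ∈ s := by
  have hopen : IsOpen (f ⁻¹' sᶜ) := hs.isOpen_compl.preimage hf
  cases Ω with
  | plane =>
    have hempty : f ⁻¹' sᶜ = ∅ := (hopen.measure_eq_zero_iff volume).mp h
    exact not_not.mp fun hx => hempty.subset hx
  | torus =>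
    set U : Set (ℝ × ℝ) := Ioo 0 1 ×ˢ Ioo 0 1 with hU
    have hUopen : IsOpen U := isOpen_Ioo.prod isOpen_Ioo
    have hzero : volume.restrict U (f ⁻¹' sᶜ) = 0 :=
      ae_restrict_of_ae_restrict_of_subset (prod_mono Ioo_subset_Ico_self Ioo_subset_Ico_self) h
    rw [Measure.restrict_apply hopen.measurableSet,
      (hopen.inter hUopen).measure_eq_zero_iff volume] at hzero
    have hmaps : MapsTo f (closure U) (closure s) :=
      MapsTo.closure (fun y hy => not_not.mp fun hys => hzero.subset ⟨hys, hy⟩) hf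
    rw [hU, closure_prod_eq, closure_Ioo zero_ne_one, hs.closure_eq] at hmaps
    rw [← hΩ.apply_fract]
    exact hmaps ⟨⟨Int.fract_nonneg _, (Int.fract_lt_one _).le⟩,
      ⟨Int.fract_nonneg _, (Int.fract_lt_one _).le⟩⟩

lemma abs_le_of_normL1Linf_le (hf : Continuous f) (hΩ : Ω.IsFunction f) (hM : 0 ≤ M)
    (h : normL1Linf Ω f ≤ ENNReal.ofReal M) (x : ℝ × ℝ) : |f x| ≤ M := by
  have hsup : eLpNorm f ⊤ Ω.measure ≤ ENNReal.ofReal M := le_add_self.trans h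
  rw [eLpNorm_exponent_top] at hsup
  refine abs_le.mpr (mem_of_ae_mem_of_isClosed hf hΩ (isClosed_Icc (a := -M) (b := M)) ?_ x)
  filter_upwards [ae_le_eLpNormEssSup (f := f) (μ := Ω.measure)] with y hy
  have hyM := hy.trans hsup
  rw [Real.enorm_eq_ofReal_abs, ENNReal.ofReal_le_ofReal_iff hM] at hyM
  exact abs_le.mp hyM

lemma integrable_of_normL1Linf_le (hf : Continuous f)
    (h : normL1Linf Ω f ≤ ENNReal.ofReal M) : Integrable f Ω.measure :=
  memLp_one_iff_integrable.mp
    ⟨hf.aestronglyMeasurable, (le_self_add.trans h).trans_lt ENNReal.ofReal_lt_top⟩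

lemma lintegral_sq_le_of_normL1Linf_le (hf : Continuous f) (hΩ : Ω.IsFunction f) (hM : 0 ≤ M)
    (h : normL1Linf Ω f ≤ ENNReal.ofReal M) :
    ∫⁻ x, ENNReal.ofReal (f x ^ 2) ∂Ω.measure ≤ ENNReal.ofReal (M ^ 2) := by
  have hL1 : eLpNorm f 1 Ω.measure ≤ ENNReal.ofReal M := le_self_add.trans h
  rw [eLpNorm_one_eq_lintegral_enorm] at hL1
  calc ∫⁻ x, ENNReal.ofReal (f x ^ 2) ∂Ω.measure
      ≤ ∫⁻ x, ENNReal.ofReal M * ‖f x‖ₑ ∂Ω.measure := by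
        refine lintegral_mono fun x => ?_
        have hx := abs_le_of_normL1Linf_le hf hΩ hM h x
        rw [Real.enorm_eq_ofReal_abs, ← ENNReal.ofReal_mul hM, ← sq_abs, sq]
        exact ENNReal.ofReal_le_ofReal (by gcongr)
    _ ≤ ENNReal.ofReal M * ENNReal.ofReal M := by
        rw [lintegral_const_mul' _ _ ENNReal.ofReal_ne_top]
        gcongr
    _ = ENNReal.ofReal (M ^ 2) := by rw [← ENNReal.ofReal_mul hM, sq]

lemma integrable_sq_of_normL1Linf_le (hf : Continuous f) (hΩ : Ω.IsFunction f) (hM : 0 ≤ M)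
    (h : normL1Linf Ω f ≤ ENNReal.ofReal M) : Integrable (fun x => f x ^ 2) Ω.measure := by
  refine ⟨(hf.pow 2).aestronglyMeasurable, ?_⟩
  rw [hasFiniteIntegral_iff_ofReal (.of_forall fun x => sq_nonneg _)]
  exact (lintegral_sq_le_of_normL1Linf_le hf hΩ hM h).trans_lt ENNReal.ofReal_lt_top

end Norm

/-! ### The time interval -/

lemma Icc_subset_timeInterval {T : EReal} {t : ℝ} (ht : t ∈ timeInterval T) :
    Icc 0 t ⊆ timeInterval T := fun _ hs =>
  ⟨hs.1, (EReal.coe_le_coe_iff.mpr hs.2).trans_lt ht.2⟩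

lemma zero_mem_timeInterval {T : EReal} {t : ℝ} (ht : t ∈ timeInterval T) :
    0 ∈ timeInterval T :=
  Icc_subset_timeInterval ht ⟨le_rfl, ht.1⟩

/-- The open time interval `(0, T)`, on which time derivatives are two-sided. -/
def openTimeInterval (T : EReal) : Set ℝ := {t | 0 < t ∧ (t : EReal) < T}

lemma isOpen_openTimeInterval (T : EReal) : IsOpen (openTimeInterval T) :=
  (isOpen_lt continuous_const continuous_id).inter
    (isOpen_lt continuous_coe_real_ereal continuous_const)

lemma openTimeInterval_subset (T : EReal) : openTimeInterval T ⊆ timeInterval T :=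
  fun _ h => ⟨h.1.le, h.2⟩

lemma Ioo_subset_openTimeInterval {T : EReal} {t : ℝ} (ht : t ∈ timeInterval T) :
    Ioo 0 t ⊆ openTimeInterval T := fun _ hs =>
  ⟨hs.1, (Icc_subset_timeInterval ht (Ioo_subset_Icc_self hs)).2⟩

lemma abs_sub_le_of_hasDerivAt {f f' : ℝ → ℝ} {t C : ℝ} (ht : 0 ≤ t)
    (hc : ContinuousOn f (Icc 0 t)) (hd : ∀ s ∈ Ioo 0 t, HasDerivAt f (f' s) s)
    (hC : ∀ s ∈ Ioo 0 t, |f' s| ≤ C) : |f t - f 0| ≤ C * t := by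
  rcases ht.eq_or_lt with rfl | ht0
  · simp
  · obtain ⟨s, hs, h⟩ := exists_hasDerivAt_eq_slope f f' ht0 hc hd
    rw [eq_div_iff (by linarith), sub_zero] at h
    rw [← h, abs_mul, abs_of_pos ht0]
    exact mul_le_mul_of_nonneg_right (hC s hs) ht

section Slices

variable {T : EReal} {θ : ℝ × ℝ → ℝ → ℝ} {t : ℝ}

lemma contDiff_slice
    (h : ContDiffOn ℝ 1 (fun p : (ℝ × ℝ) × ℝ => θ p.1 p.2) (univ ×ˢ timeInterval T))
    (ht : t ∈ timeInterval T) : ContDiff ℝ 1 fun x => θ x t := by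
  rw [← contDiffOn_univ]
  exact h.comp (f := fun x : ℝ × ℝ => (x, t)) (by fun_prop) (fun x _ => ⟨mem_univ _, ht⟩)

lemma differentiableAt_uncurry
    (h : ContDiffOn ℝ 1 (fun p : (ℝ × ℝ) × ℝ => θ p.1 p.2) (univ ×ˢ timeInterval T))
    (ht : t ∈ openTimeInterval T) (x : ℝ × ℝ) :
    DifferentiableAt ℝ (fun p : (ℝ × ℝ) × ℝ => θ p.1 p.2) (x, t) := by
  have hnhds : univ ×ˢ openTimeInterval T ∈ 𝓝 (x, t) :=
    (isOpen_univ.prod (isOpen_openTimeInterval T)).mem_nhds ⟨mem_univ _, ht⟩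
  exact ((h.mono (prod_mono_right (openTimeInterval_subset T))).contDiffAt hnhds).differentiableAt
    one_ne_zero

lemma hasDerivAt_time
    (h : ContDiffOn ℝ 1 (fun p : (ℝ × ℝ) × ℝ => θ p.1 p.2) (univ ×ˢ timeInterval T))
    (ht : t ∈ openTimeInterval T) (x : ℝ × ℝ) :
    HasDerivAt (fun s => θ x s)
      (fderiv ℝ (fun p : (ℝ × ℝ) × ℝ => θ p.1 p.2) (x, t) (0, 1)) t :=
  (differentiableAt_uncurry h ht x).hasFDerivAt.comp_hasDerivAt (x := t) (f := fun s : ℝ => (x, s))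
    ((hasDerivAt_const t x).prodMk (hasDerivAt_id t))

lemma continuousOn_deriv_time
    (h : ContDiffOn ℝ 1 (fun p : (ℝ × ℝ) × ℝ => θ p.1 p.2) (univ ×ˢ timeInterval T)) :
    ContinuousOn (fun p : (ℝ × ℝ) × ℝ => deriv (θ p.1) p.2) (univ ×ˢ openTimeInterval T) :=
  (((h.mono (prod_mono_right (openTimeInterval_subset T))).continuousOn_fderiv_of_isOpen
    (isOpen_univ.prod (isOpen_openTimeInterval T)) le_rfl).clm_apply continuousOn_const).congr
      fun p hp => (hasDerivAt_time h hp.2 p.1).deriv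

variable {Ω : Domain} {β : ℝ → ℝ} {χ : ℝ × ℝ → ℝ}

lemma exists_isCompact_ae_eq_zero (hc : Ω = .plane → HasCompactSupport χ) :
    ∃ K : Set (ℝ × ℝ), IsCompact K ∧ ∀ᵐ x ∂Ω.measure, x ∉ K → χ x = 0 := by
  cases Ω with
  | plane =>
    exact ⟨tsupport χ, hc rfl, .of_forall fun x hx => image_eq_zero_of_notMem_tsupport hx⟩
  | torus =>
    refine ⟨Metric.closedBall 0 1, isCompact_closedBall _ _, ?_⟩
    filter_upwards [ae_restrict_mem measurableSet_unitSquare] with x hx h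
    exact absurd (mem_closedBall_zero_iff.mpr (norm_le_one_of_mem_unitSquare hx)) h

lemma hasDerivAt_integral_mul_comp
    (h : ContDiffOn ℝ 1 (fun p : (ℝ × ℝ) × ℝ => θ p.1 p.2) (univ ×ˢ timeInterval T))
    (hβ : ContDiff ℝ 1 β) (hχ : Continuous χ) (hc : Ω = .plane → HasCompactSupport χ)
    (ht : t ∈ openTimeInterval T) :
    HasDerivAt (fun s => ∫ x, χ x * β (θ x s) ∂Ω.measure)
      (∫ x, χ x * (deriv β (θ x t) * deriv (θ x) t) ∂Ω.measure) t := by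
  obtain ⟨K, hK, hχK⟩ := exists_isCompact_ae_eq_zero hc
  obtain ⟨J, hJ, htJ, hJT⟩ := exists_compact_subset (isOpen_openTimeInterval T) ht
  have hcont : ContinuousOn (fun p : (ℝ × ℝ) × ℝ =>
      χ p.1 * (deriv β (θ p.1 p.2) * deriv (θ p.1) p.2)) (univ ×ˢ openTimeInterval T) :=
    (hχ.comp continuous_fst).continuousOn.mul
      (((hβ.continuous_deriv le_rfl).comp_continuousOn
        (h.continuousOn.mono (prod_mono_right (openTimeInterval_subset T)))).mul
        (continuousOn_deriv_time h))
  obtain ⟨C, hC⟩ := (hK.prod hJ).exists_bound_of_continuousOn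
    (hcont.mono (prod_mono (subset_univ K) hJT))
  have hslice {s : ℝ} (hs : s ∈ openTimeInterval T) : Continuous fun x => χ x * β (θ x s) :=
    hχ.mul (hβ.continuous.comp (contDiff_slice h (openTimeInterval_subset T hs)).continuous)
  refine (hasDerivAt_integral_of_dominated_loc_of_deriv_le
    (F' := fun s x => χ x * (deriv β (θ x s) * deriv (θ x) s)) (bound := K.indicator fun _ => C)
    (mem_interior_iff_mem_nhds.mp htJ) ?_
    (integrable_domain (hslice ht) fun hΩ => (hc hΩ).mul_right) ?_ ?_ ?_ ?_).2
  · filter_upwards [(isOpen_openTimeInterval T).mem_nhds ht] with s hs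
    exact (hslice hs).aestronglyMeasurable
  · exact (hcont.comp_continuous (f := fun x : ℝ × ℝ => (x, t)) (by fun_prop)
      fun x => ⟨mem_univ _, ht⟩).aestronglyMeasurable
  · filter_upwards [hχK] with x hx s hs
    by_cases hxK : x ∈ K
    · rw [indicator_of_mem hxK]
      exact hC (x, s) ⟨hxK, hs⟩
    · rw [indicator_of_notMem hxK, hx hxK, zero_mul, norm_zero]
  · rw [integrable_indicator_iff hK.measurableSet]
    exact integrableOn_const hK.measure_lt_top.ne
  · refine .of_forall fun x s hs => ?_
    exact ((hβ.differentiable one_ne_zero (θ x s)).hasDerivAt.comp s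
      (hasDerivAt_time h (hJT hs) x).differentiableAt.hasDerivAt).const_mul (χ x)

lemma continuousOn_integral_mul_comp
    (h : ContDiffOn ℝ 1 (fun p : (ℝ × ℝ) × ℝ => θ p.1 p.2) (univ ×ˢ timeInterval T))
    (hβ : Continuous β) (hχ : Continuous χ) (hc : Ω = .plane → HasCompactSupport χ)
    (ht : t ∈ timeInterval T) :
    ContinuousOn (fun s => ∫ x, χ x * β (θ x s) ∂Ω.measure) (Icc 0 t) := by
  obtain ⟨K, hK, hχK⟩ := exists_isCompact_ae_eq_zero hc
  have hcont : ContinuousOn (fun p : (ℝ × ℝ) × ℝ => χ p.1 * β (θ p.1 p.2))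
      (univ ×ˢ timeInterval T) :=
    (hχ.comp continuous_fst).continuousOn.mul (hβ.comp_continuousOn h.continuousOn)
  obtain ⟨C, hC⟩ := (hK.prod isCompact_Icc).exists_bound_of_continuousOn
    (hcont.mono (prod_mono (subset_univ K) (Icc_subset_timeInterval ht)))
  refine continuousOn_of_dominated (bound := K.indicator fun _ => C) (fun s hs => ?_)
    (fun s hs => ?_) ?_ (.of_forall fun x => ?_)
  · exact (hχ.mul (hβ.comp
      (contDiff_slice h (Icc_subset_timeInterval ht hs)).continuous)).aestronglyMeasurable
  · filter_upwards [hχK] with x hx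
    by_cases hxK : x ∈ K
    · rw [indicator_of_mem hxK]
      exact hC (x, s) ⟨hxK, hs⟩
    · rw [indicator_of_notMem hxK, hx hxK, zero_mul, norm_zero]
  · rw [integrable_indicator_iff hK.measurableSet]
    exact integrableOn_const hK.measure_lt_top.ne
  · exact hcont.comp (f := fun s : ℝ => (x, s)) (by fun_prop)
      fun s hs => ⟨mem_univ _, Icc_subset_timeInterval ht hs⟩

end Slices

/-! ### Conserved quantities -/

section Flux

variable {f χ : ℝ × ℝ → ℝ} {M C R : ℝ} {β : ℝ → ℝ}

lemma abs_mul_comp_le (hM : ∀ y, |f y| ≤ M) (hβ0 : ∀ s, 0 ≤ β s) (hβ2 : ∀ s, β s ≤ s ^ 2)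
    (hR : 0 < R) {D : ℝ} (hD : |D| ≤ C / R) (x : ℝ × ℝ) :
    |R * (β (f x) * D)| ≤ |C * M * f x| := by
  have hM0 : 0 ≤ M := (abs_nonneg _).trans (hM 0)
  have hC0 : 0 ≤ C := by simpa [hR.ne'] using mul_nonneg ((abs_nonneg _).trans hD) hR.le
  have hβf : β (f x) ≤ M * |f x| := by
    refine (hβ2 _).trans ?_
    rw [← sq_abs, sq]
    exact mul_le_mul_of_nonneg_right (hM x) (abs_nonneg _)
  calc |R * (β (f x) * D)| = R * (β (f x) * |D|) := by
        rw [abs_mul, abs_mul, abs_of_pos hR, abs_of_nonneg (hβ0 _)]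
    _ ≤ R * (M * |f x| * (C / R)) := by gcongr
    _ = C * M * |f x| := by field_simp
    _ = |C * M * f x| := by rw [abs_mul, abs_of_nonneg (mul_nonneg hC0 hM0)]

lemma lintegral_sq_le_of_abs_le_mul {g : ℝ × ℝ → ℝ} {K E : ℝ} (hg : ∀ x, |g x| ≤ |K * f x|)
    (hE : ∫⁻ y, ENNReal.ofReal (f y ^ 2) ≤ ENNReal.ofReal E) :
    ∫⁻ x, ENNReal.ofReal (g x ^ 2) ≤ ENNReal.ofReal (K ^ 2 * E) :=
  calc ∫⁻ x, ENNReal.ofReal (g x ^ 2)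
      ≤ ∫⁻ x, ENNReal.ofReal (K ^ 2) * ENNReal.ofReal (f x ^ 2) := by
        refine lintegral_mono fun x => ?_
        rw [← ENNReal.ofReal_mul (sq_nonneg _), ← mul_pow]
        exact ENNReal.ofReal_le_ofReal (sq_le_sq.mpr (hg x))
    _ ≤ ENNReal.ofReal (K ^ 2 * E) := by
        rw [lintegral_const_mul' _ _ ENNReal.ofReal_ne_top, ENNReal.ofReal_mul (sq_nonneg _)]
        gcongr

lemma abs_integral_mul_fderiv_mul_fderiv_potential_le (hf : ContDiff ℝ 1 f) (hfi : Integrable f)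
    (hM : ∀ y, |f y| ≤ M) (hE : ∫⁻ y, ENNReal.ofReal (f y ^ 2) ≤ ENNReal.ofReal (M ^ 2))
    (hψ : ContDiff ℝ 1 (potential (Ioi 0) f)) (hβ : ContDiff ℝ 1 β) (hβ0 : ∀ s, 0 ≤ β s)
    (hβ2 : ∀ s, β s ≤ s ^ 2) (hχ : ContDiff ℝ 2 χ) (hχs : HasCompactSupport χ) (hR : 0 < R)
    {v w : ℝ × ℝ} (hv : euclid v ≤ 1) (hC : ∀ x, |fderiv ℝ χ x w| ≤ C / R) :
    |∫ x, β (f x) * fderiv ℝ χ x w * fderiv ℝ (potential (Ioi 0) f) x v|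
      ≤ (M ^ 2 + (C * M) ^ 2 * M ^ 2) / R := by
  have hχw : ContDiff ℝ 1 fun x => fderiv ℝ χ x w :=
    (hχ.fderiv_right (m := 1) (by norm_num)).clm_apply contDiff_const
  have hgs : HasCompactSupport fun x => R * (β (f x) * fderiv ℝ χ x w) :=
    ((hχs.fderiv_apply (𝕜 := ℝ) w).mul_left (f := fun x => β (f x))).mul_left (f := fun _ => R)
  have hdual := abs_integral_mul_fderiv_potential_le hf.continuous hfi hM hψ
    (contDiff_const.mul ((hβ.comp hf).mul hχw)) hgs hv (sq_nonneg M) (by positivity) hE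
    (lintegral_sq_le_of_abs_le_mul (fun x => abs_mul_comp_le hM hβ0 hβ2 hR (hC x) x) hE)
  rw [le_div_iff₀ hR]
  refine Eq.trans_le ?_ hdual
  rw [← abs_of_pos hR, ← abs_mul, mul_comm, ← integral_const_mul, abs_of_pos hR]
  simp only [mul_assoc, Function.comp_apply]

lemma abs_integral_mul_jacobian_potential_le (hf : ContDiff ℝ 1 f) (hfi : Integrable f)
    (hM : ∀ y, |f y| ≤ M) (hE : ∫⁻ y, ENNReal.ofReal (f y ^ 2) ≤ ENNReal.ofReal (M ^ 2))
    (hψ : ContDiff ℝ 1 (potential (Ioi 0) f)) (hβ : ContDiff ℝ 1 β) (hβ0 : ∀ s, 0 ≤ β s)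
    (hβ2 : ∀ s, β s ≤ s ^ 2) (hχ : ContDiff ℝ 2 χ) (hχs : HasCompactSupport χ) (hR : 0 < R)
    (hC : ∀ x, ‖fderiv ℝ χ x‖ ≤ C / R) :
    |∫ x, β (f x) * jacobian (potential (Ioi 0) f) χ x|
      ≤ 2 * (M ^ 2 + (C * M) ^ 2 * M ^ 2) / R := by
  have hflux {v w : ℝ × ℝ} (hv : euclid v ≤ 1) (hw : ‖w‖ ≤ 1) :=
    abs_integral_mul_fderiv_mul_fderiv_potential_le hf hfi hM hE hψ hβ hβ0 hβ2 hχ hχs hR hv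
      (w := w) fun x => ((fderiv ℝ χ x).le_opNorm_of_le hw).trans (by simpa using hC x)
  have hint (v w : ℝ × ℝ) : Integrable fun x =>
      β (f x) * fderiv ℝ χ x w * fderiv ℝ (potential (Ioi 0) f) x v :=
    (((hβ.comp hf).continuous.mul (continuous_fderiv_apply (hχ.of_le one_le_two) w)).mul
      (continuous_fderiv_apply hψ v)).integrable_of_hasCompactSupport
        (hχs.fderiv_apply (𝕜 := ℝ) w).mul_left.mul_right
  calc |∫ x, β (f x) * jacobian (potential (Ioi 0) f) χ x|
      = |(∫ x, β (f x) * fderiv ℝ χ x (0, 1) * fderiv ℝ (potential (Ioi 0) f) x (1, 0))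
          - ∫ x, β (f x) * fderiv ℝ χ x (1, 0) * fderiv ℝ (potential (Ioi 0) f) x (0, 1)| := by
        rw [← integral_sub (hint _ _) (hint _ _)]
        refine congrArg _ (integral_congr_ae (.of_forall fun x => ?_))
        simp only [jacobian]
        ring
    _ ≤ (M ^ 2 + (C * M) ^ 2 * M ^ 2) / R + (M ^ 2 + (C * M) ^ 2 * M ^ 2) / R :=
        (abs_sub _ _).trans (add_le_add
          (hflux (by simp [euclid]) (by simp [Prod.norm_def]))
          (hflux (by simp [euclid]) (by simp [Prod.norm_def])))
    _ = 2 * (M ^ 2 + (C * M) ^ 2 * M ^ 2) / R := by ring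

end Flux

lemma exists_cutoff : ∃ C : ℝ, ∀ R > 0, ∃ χ : ℝ × ℝ → ℝ, ContDiff ℝ 2 χ ∧ HasCompactSupport χ ∧
    (∀ x, χ x ∈ Icc 0 1) ∧ (∀ x, ‖x‖ ≤ R → χ x = 1) ∧ ∀ x, ‖fderiv ℝ χ x‖ ≤ C / R := by
  let η : ContDiffBump (0 : ℝ × ℝ) := ⟨1, 2, one_pos, one_lt_two⟩
  have hη : ContDiff ℝ 2 η := η.contDiff
  obtain ⟨C, hC⟩ := (η.hasCompactSupport.fderiv (𝕜 := ℝ)).exists_bound_of_continuous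
    (hη.continuous_fderiv two_ne_zero)
  refine ⟨C, fun R hR => ⟨fun x => η (R⁻¹ • x), hη.comp (contDiff_const_smul _),
    η.hasCompactSupport.comp_homeomorph (Homeomorph.smulOfNeZero R⁻¹ (inv_ne_zero hR.ne')),
    fun x => ⟨η.nonneg, η.le_one⟩, fun x hx => η.one_of_mem_closedBall ?_, fun x => ?_⟩⟩
  · rw [mem_closedBall_zero_iff, norm_smul, norm_inv, Real.norm_of_nonneg hR.le,
      inv_mul_le_iff₀ hR]
    exact hx.trans_eq (mul_one R).symm
  · rw [fderiv_comp_smul, norm_smul, norm_inv, Real.norm_of_nonneg hR.le, inv_mul_eq_div]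
    gcongr
    exact hC _

lemma tendsto_integral_cutoff_mul {F : ℝ × ℝ → ℝ} (hF : Integrable F) {χ : ℕ → ℝ × ℝ → ℝ}
    (hχ : ∀ n, Continuous (χ n)) (hχ01 : ∀ n x, χ n x ∈ Icc 0 1)
    (hχ1 : ∀ (n : ℕ) x, ‖x‖ ≤ n + 1 → χ n x = 1) :
    Tendsto (fun n => ∫ x, χ n x * F x) atTop (𝓝 (∫ x, F x)) := by
  refine tendsto_integral_of_dominated_convergence (fun x => ‖F x‖)
    (fun n => (hχ n).aestronglyMeasurable.mul hF.aestronglyMeasurable) hF.norm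
    (fun n => .of_forall fun x => ?_) (.of_forall fun x => ?_)
  · rw [norm_mul, Real.norm_of_nonneg (hχ01 n x).1]
    exact mul_le_of_le_one_left (norm_nonneg _) (hχ01 n x).2
  · obtain ⟨n₀, hn₀⟩ := exists_nat_ge ‖x‖
    refine tendsto_const_nhds.congr' ?_
    filter_upwards [eventually_ge_atTop n₀] with n hn
    have hnn₀ : (n₀ : ℝ) ≤ n := by exact_mod_cast hn
    rw [hχ1 n x (by linarith), one_mul]

namespace IsSolution

variable {Ω : Domain} {T : EReal} {θ ψ : ℝ × ℝ → ℝ → ℝ} {t : ℝ} {β : ℝ → ℝ}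

lemma contDiff (hS : IsSolution Ω T θ ψ) (ht : t ∈ timeInterval T) :
    ContDiff ℝ 1 fun x => θ x t :=
  contDiff_slice hS.contDiffOn ht

lemma isFunction_stream (hS : IsSolution Ω T θ ψ) (ht : t ∈ timeInterval T) :
    Ω.IsFunction fun x => ψ x t := by
  cases Ω with
  | plane => trivial
  | torus => exact (hS.stream t ht).1

lemma exists_normL1Linf_le (hS : IsSolution Ω T θ ψ) (ht : t ∈ timeInterval T) :
    ∃ M : ℝ, 0 ≤ M ∧ ∀ s ∈ Icc 0 t, normL1Linf Ω (fun x => θ x s) ≤ ENNReal.ofReal M := by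
  obtain ⟨M, hM⟩ := hS.locallyBounded t ht
  exact ⟨M, M.2, fun s hs => by simpa using hM s hs⟩

lemma deriv_time_eq_neg_jacobian (hS : IsSolution Ω T θ ψ) (ht : t ∈ openTimeInterval T)
    (x : ℝ × ℝ) : deriv (θ x) t = -jacobian (fun y => ψ y t) (fun y => θ y t) x := by
  have htT := openTimeInterval_subset T ht
  have hθ := (hS.contDiff htT).differentiable one_ne_zero x
  have hψ := (hS.stream_contDiff t htT).differentiable one_ne_zero x
  have htransport := hS.transport t htT ht.1 x
  rw [d₁_eq_fderiv hψ, d₂_eq_fderiv hψ, d₁_eq_fderiv hθ, d₂_eq_fderiv hθ] at htransport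
  rw [jacobian]
  linarith

lemma hasDerivAt_integral (hS : IsSolution Ω T θ ψ) (hβ : ContDiff ℝ 1 β) {χ : ℝ × ℝ → ℝ}
    (hχ : ContDiff ℝ 1 χ) (hχΩ : Ω.IsFunction χ) (hc : Ω = .plane → HasCompactSupport χ)
    (ht : t ∈ openTimeInterval T) :
    HasDerivAt (fun s => ∫ x, χ x * β (θ x s) ∂Ω.measure)
      (∫ x, β (θ x t) * jacobian (fun y => ψ y t) χ x ∂Ω.measure) t := by
  have htT := openTimeInterval_subset T ht
  convert hasDerivAt_integral_mul_comp hS.contDiffOn hβ hχ.continuous hc ht using 1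
  simp only [hS.deriv_time_eq_neg_jacobian ht, mul_neg, integral_neg]
  rw [integral_mul_deriv_mul_jacobian (hS.stream_contDiff t htT) (hS.contDiff htT) hχ hβ
    (hS.isFunction_stream htT) (hS.isFunction t htT) hχΩ hc, neg_neg]

lemma integral_comp_torus (hS : IsSolution .torus T θ ψ) (hβ : ContDiff ℝ 1 β)
    (ht : t ∈ timeInterval T) :
    ∫ x, β (θ x t) ∂Domain.torus.measure = ∫ x, β (θ x 0) ∂Domain.torus.measure := by
  have h := abs_sub_le_of_hasDerivAt (C := 0) ht.1
    (continuousOn_integral_mul_comp (Ω := .torus) hS.contDiffOn hβ.continuous (χ := fun _ => 1)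
      continuous_const nofun ht)
    (fun s hs => hS.hasDerivAt_integral hβ (χ := fun _ => 1) contDiff_const
      (fun x => ⟨rfl, rfl⟩) nofun (Ioo_subset_openTimeInterval ht hs))
    (fun s _ => by simp [jacobian])
  simp only [one_mul, zero_mul, abs_nonpos_iff] at h
  exact sub_eq_zero.mp h

lemma abs_integral_cutoff_mul_sub_le (hS : IsSolution .plane T θ ψ) (hβ : ContDiff ℝ 1 β)
    (hβ0 : ∀ s, 0 ≤ β s) (hβ2 : ∀ s, β s ≤ s ^ 2) (ht : t ∈ timeInterval T) {M : ℝ}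
    (hM0 : 0 ≤ M) (hM : ∀ s ∈ Icc 0 t, normL1Linf .plane (fun x => θ x s) ≤ ENNReal.ofReal M)
    {χ : ℝ × ℝ → ℝ} (hχ : ContDiff ℝ 2 χ) (hχs : HasCompactSupport χ) {C R : ℝ} (hR : 0 < R)
    (hC : ∀ x, ‖fderiv ℝ χ x‖ ≤ C / R) :
    |(∫ x, χ x * β (θ x t)) - ∫ x, χ x * β (θ x 0)|
      ≤ 2 * (M ^ 2 + (C * M) ^ 2 * M ^ 2) / R * t := by
  refine abs_sub_le_of_hasDerivAt ht.1
    (continuousOn_integral_mul_comp (Ω := .plane) hS.contDiffOn hβ.continuous hχ.continuous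
      (fun _ => hχs) ht)
    (fun s hs => hS.hasDerivAt_integral hβ (hχ.of_le one_le_two) trivial (fun _ => hχs)
      (Ioo_subset_openTimeInterval ht hs)) fun s hs => ?_
  have hsT := Icc_subset_timeInterval ht (Ioo_subset_Icc_self hs)
  have hMs := hM s (Ioo_subset_Icc_self hs)
  have hθ := hS.contDiff hsT
  have hψ := hS.stream_contDiff s hsT
  rw [(hS.stream s hsT).eq_potential] at hψ ⊢
  exact abs_integral_mul_jacobian_potential_le hθ (integrable_of_normL1Linf_le hθ.continuous hMs)
    (abs_le_of_normL1Linf_le hθ.continuous (hS.isFunction s hsT) hM0 hMs)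
    (lintegral_sq_le_of_normL1Linf_le hθ.continuous (hS.isFunction s hsT) hM0 hMs) hψ hβ hβ0 hβ2
    hχ hχs hR hC

lemma integral_comp_plane (hS : IsSolution .plane T θ ψ) (hβ : ContDiff ℝ 1 β)
    (hβ0 : ∀ s, 0 ≤ β s) (hβ2 : ∀ s, β s ≤ s ^ 2) (ht : t ∈ timeInterval T) :
    ∫ x, β (θ x t) = ∫ x, β (θ x 0) := by
  obtain ⟨M, hM0, hM⟩ := hS.exists_normL1Linf_le ht
  obtain ⟨C, hcutoff⟩ := exists_cutoff
  choose χ hχ hχs hχ01 hχ1 hχC using fun n : ℕ => hcutoff (n + 1) n.cast_add_one_pos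
  have hint {s : ℝ} (hs : s ∈ Icc 0 t) : Integrable fun x => β (θ x s) := by
    have hθ := (hS.contDiff (Icc_subset_timeInterval ht hs)).continuous
    refine (integrable_sq_of_normL1Linf_le (Ω := .plane) hθ trivial hM0 (hM s hs)).mono'
      (hβ.continuous.comp hθ).aestronglyMeasurable (.of_forall fun x => ?_)
    rw [Real.norm_of_nonneg (hβ0 _)]
    exact hβ2 _
  have hlim := (tendsto_integral_cutoff_mul (hint ⟨ht.1, le_rfl⟩)
    (fun n => (hχ n).continuous) hχ01 hχ1).sub (tendsto_integral_cutoff_mul (hint ⟨le_rfl, ht.1⟩)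
    (fun n => (hχ n).continuous) hχ01 hχ1)
  have hbound (n : ℕ) := hS.abs_integral_cutoff_mul_sub_le hβ hβ0 hβ2 ht hM0 hM (hχ n) (hχs n)
    n.cast_add_one_pos (hχC n)
  have hzero : Tendsto (fun n : ℕ => 2 * (M ^ 2 + (C * M) ^ 2 * M ^ 2) / ((n : ℝ) + 1) * t)
      atTop (𝓝 0) := by
    simpa [div_eq_mul_inv] using ((tendsto_one_div_add_atTop_nhds_zero_nat (𝕜 := ℝ)).const_mul
      (2 * (M ^ 2 + (C * M) ^ 2 * M ^ 2))).mul_const t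
  exact sub_eq_zero.mp (tendsto_nhds_unique hlim (squeeze_zero_norm hbound hzero))

theorem integral_comp (hS : IsSolution Ω T θ ψ) (hβ : ContDiff ℝ 1 β) (hβ0 : ∀ s, 0 ≤ β s)
    (hβ2 : ∀ s, β s ≤ s ^ 2) (ht : t ∈ timeInterval T) :
    ∫ x, β (θ x t) ∂Ω.measure = ∫ x, β (θ x 0) ∂Ω.measure := by
  cases Ω with
  | plane => exact hS.integral_comp_plane hβ hβ0 hβ2 ht
  | torus => exact hS.integral_comp_torus hβ ht

end IsSolution

lemma expNegInvGlue_le {x : ℝ} (hx : 0 ≤ x) : expNegInvGlue x ≤ x := by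
  rcases hx.eq_or_lt with rfl | hx
  · simp
  · rw [expNegInvGlue, if_neg (not_le.mpr hx), Real.exp_neg, inv_le_comm₀ (Real.exp_pos _) hx]
    linarith [Real.add_one_le_exp x⁻¹]

lemma expNegInvGlue_sq_sub_le (N s : ℝ) : expNegInvGlue (s ^ 2 - N ^ 2) ≤ s ^ 2 := by
  rcases le_total (s ^ 2 - N ^ 2) 0 with h | h
  · rw [expNegInvGlue.zero_of_nonpos h]
    exact sq_nonneg s
  · exact (expNegInvGlue_le h).trans (sub_le_self _ (sq_nonneg N))

namespace IsSolution

variable {Ω : Domain} {T : EReal} {θ ψ : ℝ × ℝ → ℝ → ℝ} {t N : ℝ}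

-- Maximum principle: apply the conservation law to a smooth `β` vanishing exactly on `[-N, N]`.
theorem abs_le (hS : IsSolution Ω T θ ψ) (hN : 0 ≤ N)
    (h0 : normL1Linf Ω (fun x => θ x 0) ≤ ENNReal.ofReal N) (ht : t ∈ timeInterval T)
    (x : ℝ × ℝ) : |θ x t| ≤ N := by
  have h0T := zero_mem_timeInterval ht
  let β : ℝ → ℝ := fun s => expNegInvGlue (s ^ 2 - N ^ 2)
  have hβ : ContDiff ℝ 1 β :=
    (expNegInvGlue.contDiff (n := 1)).comp ((contDiff_id.pow 2).sub contDiff_const)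
  have hβ0 (s : ℝ) : 0 ≤ β s := expNegInvGlue.nonneg _
  have hβ_eq_zero (s : ℝ) : β s = 0 ↔ |s| ≤ N := by
    rw [expNegInvGlue.zero_iff_nonpos, sub_nonpos, sq_le_sq, abs_of_nonneg hN]
  have hθ := (hS.contDiff ht).continuous
  have hβθ : Continuous fun x => β (θ x t) := hβ.continuous.comp hθ
  have hint : Integrable (fun x => β (θ x t)) Ω.measure := by
    obtain ⟨M, hM0, hM⟩ := hS.exists_normL1Linf_le ht
    refine (integrable_sq_of_normL1Linf_le hθ (hS.isFunction t ht) hM0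
      (hM t ⟨ht.1, le_rfl⟩)).mono' hβθ.aestronglyMeasurable (.of_forall fun y => ?_)
    rw [Real.norm_of_nonneg (hβ0 _)]
    exact expNegInvGlue_sq_sub_le N _
  have hinitial (y : ℝ × ℝ) : β (θ y 0) = 0 := (hβ_eq_zero _).mpr
    (abs_le_of_normL1Linf_le (hS.contDiff h0T).continuous (hS.isFunction 0 h0T) hN h0 y)
  have hconserved := hS.integral_comp hβ hβ0 (expNegInvGlue_sq_sub_le N) ht
  simp only [hinitial, integral_zero] at hconserved
  rw [integral_eq_zero_iff_of_nonneg (fun x => hβ0 _) hint] at hconserved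
  exact (hβ_eq_zero _).mp (mem_of_ae_mem_of_isClosed hβθ ((hS.isFunction t ht).comp β)
    isClosed_singleton hconserved x)

theorem lintegral_sq_le (hS : IsSolution Ω T θ ψ) (hN : 0 ≤ N)
    (h0 : normL1Linf Ω (fun x => θ x 0) ≤ ENNReal.ofReal N) (ht : t ∈ timeInterval T) :
    ∫⁻ x, ENNReal.ofReal (θ x t ^ 2) ∂Ω.measure ≤ ENNReal.ofReal (N ^ 2) := by
  have h0T := zero_mem_timeInterval ht
  obtain ⟨M, hM0, hM⟩ := hS.exists_normL1Linf_le ht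
  have hint {s : ℝ} (hs : s ∈ Icc 0 t) : Integrable (fun x => θ x s ^ 2) Ω.measure := by
    have hsT := Icc_subset_timeInterval ht hs
    exact integrable_sq_of_normL1Linf_le (hS.contDiff hsT).continuous (hS.isFunction s hsT) hM0
      (hM s hs)
  rw [← ofReal_integral_eq_lintegral_ofReal (hint ⟨ht.1, le_rfl⟩)
      (.of_forall fun x => sq_nonneg _),
    hS.integral_comp (β := fun s => s ^ 2) (contDiff_id.pow 2) sq_nonneg (fun s => le_rfl) ht]
  exact (ofReal_integral_eq_lintegral_ofReal (hint ⟨le_rfl, ht.1⟩)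
    (.of_forall fun x => sq_nonneg _)).trans_le
      (lintegral_sq_le_of_normL1Linf_le (hS.contDiff h0T).continuous (hS.isFunction 0 h0T) hN h0)

end IsSolution

/-! ### Fourier series on the torus -/

/-- A pair of integers as a point of the plane. -/
def latticePoint (k : ℤ × ℤ) : ℝ × ℝ := ((k.1 : ℝ), (k.2 : ℝ))

lemma latticePoint_ne_zero {k : ℤ × ℤ} (hk : k ≠ 0) : latticePoint k ≠ 0 := by
  simpa [latticePoint, Prod.ext_iff] using hk

lemma character_latticePoint (k m : ℤ × ℤ) : character (latticePoint k) (latticePoint m) = 1 := by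
  rw [← Complex.exp_int_mul_two_pi_mul_I (-(k.1 * m.1 + k.2 * m.2)), character]
  congr 1
  simp only [latticePoint]
  push_cast
  ring

lemma character_latticePoint_fst_add_one (k : ℤ × ℤ) (x : ℝ × ℝ) :
    character (latticePoint k) (x.1 + 1, x.2) = character (latticePoint k) x := by
  rw [show (x.1 + 1, x.2) = x + latticePoint (1, 0) by ext <;> simp [latticePoint],
    character_add, character_latticePoint, mul_one]

lemma character_latticePoint_snd_add_one (k : ℤ × ℤ) (x : ℝ × ℝ) :
    character (latticePoint k) (x.1, x.2 + 1) = character (latticePoint k) x := by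
  rw [show (x.1, x.2 + 1) = x + latticePoint (0, 1) by ext <;> simp [latticePoint],
    character_add, character_latticePoint, mul_one]

lemma fourierCoeff₂_eq (f : ℝ × ℝ → ℝ) (k : ℤ × ℤ) :
    fourierCoeff₂ f k = ∫ x in unitSquare, (f x : ℂ) * character (latticePoint k) x := by
  simp [fourierCoeff₂, character, latticePoint]

lemma fourierCoeff₂_add_right {f : ℝ × ℝ → ℝ} (hf : Continuous f)
    (hp : Domain.torus.IsFunction f) (v : ℝ × ℝ) (k : ℤ × ℤ) :
    fourierCoeff₂ (fun x => f (x + v)) k = character (latticePoint k) (-v) * fourierCoeff₂ f k := by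
  rw [fourierCoeff₂_eq, fourierCoeff₂_eq, ← setIntegral_unitSquare_add_right
    (F := fun x => (f x : ℂ) * character (latticePoint k) x) (by fun_prop)
    (fun x => by rw [(hp x).1, character_latticePoint_fst_add_one])
    (fun x => by rw [(hp x).2, character_latticePoint_snd_add_one]) v, ← integral_const_mul]
  refine integral_congr_ae (.of_forall fun x => ?_)
  have hchar : character (latticePoint k) x
      = character (latticePoint k) (-v) * character (latticePoint k) (x + v) := by
    rw [← character_add, neg_add_cancel_comm_assoc]
  simp only [hchar]
  ring

lemma fourierCoeff₂_sub {f g : ℝ × ℝ → ℝ} (hf : Continuous f) (hg : Continuous g) (k : ℤ × ℤ) :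
    fourierCoeff₂ (fun x => f x - g x) k = fourierCoeff₂ f k - fourierCoeff₂ g k := by
  simp only [fourierCoeff₂_eq, Complex.ofReal_sub, sub_mul]
  exact integral_sub (integrableOn_unitSquare (by fun_prop))
    (integrableOn_unitSquare (by fun_prop))

lemma volume_unitSquare : volume unitSquare = 1 := by
  rw [unitSquare, Measure.volume_eq_prod, Measure.prod_prod]; simp

lemma norm_fourierCoeff₂_le {f : ℝ × ℝ → ℝ} {M : ℝ} (hM : ∀ y, |f y| ≤ M) (k : ℤ × ℤ) :
    ‖fourierCoeff₂ f k‖ ≤ M := by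
  rw [fourierCoeff₂_eq]
  refine (norm_setIntegral_le_of_norm_le_const (by simp [volume_unitSquare]) (C := M)
    fun x _ => ?_).trans_eq (by simp [measureReal_def, volume_unitSquare])
  rw [norm_mul, norm_character, mul_one, Complex.norm_real]
  exact hM x

lemma norm_le_tsum_of_norm_fourier_le {h : ℝ → ℂ} (hc : Continuous h)
    (hp : Function.Periodic h 1) {B : ℤ → ℝ} (hB : Summable B)
    (hle : ∀ n : ℤ,
      ‖∫ x in (0 : ℝ)..1, h x * Complex.exp (-(2 * π * Complex.I * (n * x)))‖ ≤ B n) (x : ℝ) :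
    ‖h x‖ ≤ ∑' n, B n := by
  let H : C(AddCircle (1 : ℝ), ℂ) := ⟨hp.lift, continuous_coinduced_dom.mpr hc⟩
  have hH (y : ℝ) : H (y : AddCircle (1 : ℝ)) = h y := hp.lift_coe y
  have hcoeff (n : ℤ) : ‖fourierCoeff H n‖ ≤ B n := by
    refine le_trans (le_of_eq ?_) (hle n)
    rw [fourierCoeff_eq_intervalIntegral _ n 0]
    simp only [div_one, one_smul, zero_add]
    congr 1
    refine intervalIntegral.integral_congr fun y _ => ?_
    simp only [hH, fourier_coe_apply, smul_eq_mul]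
    rw [mul_comm]
    congr 2
    push_cast
    ring
  have hseries := has_pointwise_sum_fourier_series_of_summable (.of_norm_bounded hB hcoeff)
    (x : AddCircle (1 : ℝ))
  rw [hH] at hseries
  refine hseries.norm_le_of_bounded hB.hasSum fun n => ?_
  rw [norm_smul, fourier_apply, Circle.norm_coe, mul_one]
  exact hcoeff n

theorem abs_le_tsum_of_norm_fourierCoeff₂_le {w : ℝ × ℝ → ℝ} (hw : Continuous w)
    (hp : Domain.torus.IsFunction w) {B : ℤ × ℤ → ℝ} (hB : Summable B)
    (hle : ∀ k, ‖fourierCoeff₂ w k‖ ≤ B k) (x : ℝ × ℝ) : |w x| ≤ ∑' k, B k := by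
  have hB' : Summable fun p : ℤ × ℤ => B (p.2, p.1) := hB.prod_symm
  have hrow (m : ℤ) (a : ℝ) : ‖∫ b in (0 : ℝ)..1, (w (a, b) : ℂ) *
      Complex.exp (-(2 * π * Complex.I * (m * b)))‖ ≤ ∑' n, B (n, m) := by
    refine norm_le_tsum_of_norm_fourier_le (h := fun a => ∫ b in (0 : ℝ)..1, (w (a, b) : ℂ) *
      Complex.exp (-(2 * π * Complex.I * (m * b))))
      (intervalIntegral.continuous_parametric_intervalIntegral_of_continuous' (by fun_prop) 0 1)
      (fun a => by simp only [fun b => (hp (a, b)).1]) (hB'.prod_factor m) (fun n => ?_) a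
    refine le_trans (le_of_eq ?_) (hle (n, m))
    rw [fourierCoeff₂_eq, setIntegral_unitSquare (by fun_prop)]
    congr 1
    refine intervalIntegral.integral_congr fun a _ => ?_
    rw [← intervalIntegral.integral_mul_const]
    refine intervalIntegral.integral_congr fun b _ => ?_
    simp only [character_eq_mul, latticePoint, Complex.ofReal_intCast]
    ring
  calc |w x| = ‖(w (x.1, x.2) : ℂ)‖ := (Complex.norm_real _).symm
    _ ≤ ∑' m, ∑' n, B (n, m) :=
      norm_le_tsum_of_norm_fourier_le (h := fun b => (w (x.1, b) : ℂ)) (by fun_prop)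
        (fun b => by simp only [(hp (x.1, b)).2]) hB'.prod (fun m => hrow m x.1) x.2
    _ = ∑' k, B k := by rw [← hB'.tsum_prod]; exact (Equiv.prodComm ℤ ℤ).tsum_eq B

/-! ### The short-range potential of a periodic function -/

lemma potential_eq_integral_sub (I : Set ℝ) (f : ℝ × ℝ → ℝ) (x : ℝ × ℝ) :
    potential I f x = ∫ z, f (x - z) * scaleKernel I z := by
  rw [← integral_sub_left_eq_self (fun z => f (x - z) * scaleKernel I z) volume x]
  simp only [sub_sub_cancel, potential]

lemma continuous_potential_Ioi_one {f : ℝ × ℝ → ℝ} (hf : Continuous f) {M : ℝ}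
    (hM : ∀ y, |f y| ≤ M) : Continuous (potential (Ioi 1) f) := by
  simp only [funext (potential_eq_integral_sub (Ioi 1) f)]
  have hnonneg := scaleKernel_nonneg measurableSet_Ioi (Ioi_subset_Ioi (zero_le_one' ℝ))
  refine continuous_of_dominated (bound := fun z => M * scaleKernel (Ioi 1) z) (fun x => ?_)
    (fun x => .of_forall fun z => ?_) (integrable_scaleKernel_Ioi_one.const_mul M)
    (.of_forall fun z => by fun_prop)
  · exact ((by fun_prop : Continuous fun z => f (x - z)).measurable.mul
      (measurable_scaleKernel _)).aestronglyMeasurable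
  · rw [norm_mul, Real.norm_of_nonneg (hnonneg z)]
    exact mul_le_mul_of_nonneg_right (hM _) (hnonneg z)

lemma isFunction_potential {f : ℝ × ℝ → ℝ} (hp : Domain.torus.IsFunction f) (I : Set ℝ) :
    Domain.torus.IsFunction (potential I f) := by
  intro x
  simp only [potential_eq_integral_sub]
  constructor
  · refine integral_congr_ae (.of_forall fun z => ?_)
    have h := (hp (x - z)).1
    rw [show ((x - z).1 + 1, (x - z).2) = (x.1 + 1, x.2) - z by
      ext <;> simp [sub_add_eq_add_sub]] at h
    simp only [h]
  · refine integral_congr_ae (.of_forall fun z => ?_)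
    have h := (hp (x - z)).2
    rw [show ((x - z).1, (x - z).2 + 1) = (x.1, x.2 + 1) - z by
      ext <;> simp [sub_add_eq_add_sub]] at h
    simp only [h]

lemma integrable_weight_mul_gaussian_prod : Integrable
    (fun p : (ℝ × ℝ) × ℝ => weight p.2 * gaussian p.2 p.1)
    (volume.prod (volume.restrict (Ioi 1))) := by
  have hI0 : Ioi (1 : ℝ) ⊆ Ioi 0 := Ioi_subset_Ioi zero_le_one
  have hmeas : Measurable fun p : (ℝ × ℝ) × ℝ => weight p.2 * gaussian p.2 p.1 :=
    measurable_weight_mul_gaussian.comp measurable_swap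
  rw [integrable_prod_iff hmeas.aestronglyMeasurable]
  constructor
  · filter_upwards [Measure.ae_ne volume 0] with z hz
    exact (integrableOn_weight_mul_gaussian hz).mono_set hI0
  · refine integrable_scaleKernel_Ioi_one.congr (.of_forall fun z => ?_)
    exact setIntegral_congr_fun measurableSet_Ioi fun s hs => (Real.norm_of_nonneg
      (mul_nonneg (weight_nonneg (hI0 hs).le) (gaussian_nonneg s z))).symm

lemma integral_scaleKernel_mul_character (ξ : ℝ × ℝ) :
    ∫ z, (scaleKernel (Ioi 1) z : ℂ) * character ξ z
      = ((∫ s in Ioi 1, weight s * gaussianFT s ξ : ℝ) : ℂ) := by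
  have hint : Integrable (fun p : (ℝ × ℝ) × ℝ =>
      ((weight p.2 * gaussian p.2 p.1 : ℝ) : ℂ) * character ξ p.1)
      (volume.prod (volume.restrict (Ioi 1))) :=
    integrable_weight_mul_gaussian_prod.ofReal.mul_bdd (c := 1)
      ((continuous_character ξ).comp continuous_fst).aestronglyMeasurable
      (.of_forall fun p => (norm_character ξ p.1).le)
  calc ∫ z, (scaleKernel (Ioi 1) z : ℂ) * character ξ z
      = ∫ z, ∫ s in Ioi 1, ((weight s * gaussian s z : ℝ) : ℂ) * character ξ z := by
        simp only [scaleKernel, ← integral_complex_ofReal, ← integral_mul_const]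
    _ = ∫ s in Ioi 1, ∫ z, ((weight s * gaussian s z : ℝ) : ℂ) * character ξ z :=
        integral_integral_swap hint
    _ = ∫ s in Ioi 1, ((weight s * gaussianFT s ξ : ℝ) : ℂ) := by
        refine setIntegral_congr_fun measurableSet_Ioi fun s hs => ?_
        simp only [Complex.ofReal_mul, mul_assoc, integral_const_mul,
          integral_gaussian_mul_character (zero_lt_one.trans hs)]
    _ = _ := integral_complex_ofReal

lemma fourierCoeff₂_potential_Ioi_one {f : ℝ × ℝ → ℝ} (hf : Continuous f)
    (hp : Domain.torus.IsFunction f) {M : ℝ} (hM : ∀ y, |f y| ≤ M) (k : ℤ × ℤ) :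
    fourierCoeff₂ (potential (Ioi 1) f) k
      = ((∫ s in Ioi 1, weight s * gaussianFT s (latticePoint k) : ℝ) : ℂ) *
        fourierCoeff₂ f k := by
  have : IsFiniteMeasure (volume.restrict unitSquare) := ⟨by simp [volume_unitSquare]⟩
  have hint : Integrable (fun p : (ℝ × ℝ) × (ℝ × ℝ) =>
      ((f (p.1 - p.2) * scaleKernel (Ioi 1) p.2 : ℝ) : ℂ) * character (latticePoint k) p.1)
      ((volume.restrict unitSquare).prod volume) := by
    have hkernel : Integrable (fun p : (ℝ × ℝ) × (ℝ × ℝ) => scaleKernel (Ioi 1) p.2)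
        ((volume.restrict unitSquare).prod volume) := by
      simpa only [one_mul] using (integrable_const (1 : ℝ)).mul_prod integrable_scaleKernel_Ioi_one
    exact (hkernel.bdd_mul (c := M)
      (by fun_prop : Continuous fun p : (ℝ × ℝ) × (ℝ × ℝ) => f (p.1 - p.2)).aestronglyMeasurable
      (.of_forall fun p => hM _)).ofReal.mul_bdd (c := 1)
        ((continuous_character _).comp continuous_fst).aestronglyMeasurable
        (.of_forall fun p => (norm_character _ p.1).le)
  calc fourierCoeff₂ (potential (Ioi 1) f) k
      = ∫ x in unitSquare, ∫ z,
          ((f (x - z) * scaleKernel (Ioi 1) z : ℝ) : ℂ) * character (latticePoint k) x := by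
        simp only [fourierCoeff₂_eq, potential_eq_integral_sub, ← integral_complex_ofReal,
          ← integral_mul_const]
    _ = ∫ z, ∫ x in unitSquare,
          ((f (x - z) * scaleKernel (Ioi 1) z : ℝ) : ℂ) * character (latticePoint k) x :=
        integral_integral_swap hint
    _ = ∫ z, (scaleKernel (Ioi 1) z : ℂ) * character (latticePoint k) z * fourierCoeff₂ f k := by
        refine integral_congr_ae (.of_forall fun z => ?_)
        have h := fourierCoeff₂_add_right hf hp (-z) k
        rw [fourierCoeff₂_eq] at h
        simp only [neg_neg, ← sub_eq_add_neg] at h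
        simp only [mul_assoc, ← h, ← integral_const_mul, Complex.ofReal_mul]
        exact integral_congr_ae (.of_forall fun x => mul_left_comm _ _ _)
    _ = _ := by rw [integral_mul_const, integral_scaleKernel_mul_character]

/-! ### The long-range part of the stream function on the torus -/

lemma summable_inv_one_add_sq : Summable fun n : ℤ => (1 + (n : ℝ) ^ 2)⁻¹ := by
  have hinv : Summable fun n : ℤ => 1 / (n : ℝ) ^ 2 := Real.summable_one_div_int_pow.mpr one_lt_two
  refine (hinv.add (hasSum_ite_eq 0 (1 : ℝ)).summable).of_nonneg_of_le (fun n => by positivity)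
    fun n => ?_
  rcases eq_or_ne n 0 with rfl | hn
  · simp
  · have hn2 : (0 : ℝ) < (n : ℝ) ^ 2 := by positivity
    rw [if_neg hn, add_zero, one_div]
    exact inv_anti₀ hn2 (by linarith)

/-- A summable majorant of `|k|⁻⁴` on the nonzero lattice points, in product form. -/
def latticeDecay (k : ℤ × ℤ) : ℝ := (1 + (k.1 : ℝ) ^ 2)⁻¹ * (1 + (k.2 : ℝ) ^ 2)⁻¹

lemma latticeDecay_nonneg (k : ℤ × ℤ) : 0 ≤ latticeDecay k := by
  unfold latticeDecay; positivity

lemma summable_latticeDecay : Summable latticeDecay :=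
  summable_inv_one_add_sq.mul_of_nonneg summable_inv_one_add_sq (fun n => by positivity)
    (fun n => by positivity)

lemma one_le_euclid_latticePoint {k : ℤ × ℤ} (hk : k ≠ 0) : 1 ≤ euclid (latticePoint k) := by
  have hpos : (0 : ℤ) < k.1 ^ 2 + k.2 ^ 2 := by
    have h := pow_pos (euclid_pos (latticePoint_ne_zero hk)) 2
    rw [euclid_sq] at h
    simp only [latticePoint] at h
    exact_mod_cast h
  refine Real.one_le_sqrt.mpr ?_
  simp only [latticePoint]
  exact_mod_cast hpos

lemma inv_euclid_latticePoint_pow_le {k : ℤ × ℤ} (hk : k ≠ 0) :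
    (euclid (latticePoint k) ^ 4)⁻¹ ≤ 3 * latticeDecay k := by
  have hE0 : 0 < euclid (latticePoint k) := euclid_pos (latticePoint_ne_zero hk)
  have hE := one_le_pow₀ (one_le_euclid_latticePoint hk) (n := 2)
  have hsq := euclid_sq (latticePoint k)
  rw [latticeDecay, ← mul_inv, ← div_eq_mul_inv, inv_eq_one_div,
    div_le_div_iff₀ (by positivity) (by positivity),
    show euclid (latticePoint k) ^ 4 = (euclid (latticePoint k) ^ 2) ^ 2 by ring]
  simp only [latticePoint] at hE hsq ⊢
  rw [hsq] at hE ⊢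
  nlinarith [sq_nonneg ((k.1 : ℝ) ^ 2 - (k.2 : ℝ) ^ 2)]

lemma exp_neg_le_cube {x : ℝ} (hx : 0 < x) : Real.exp (-x) ≤ 6 / x ^ 3 := by
  have h := Real.pow_div_factorial_le_exp x hx.le 3
  rw [Real.exp_neg, inv_le_comm₀ (Real.exp_pos _) (by positivity), inv_div]
  simpa [Nat.factorial] using h

lemma weight_mul_gaussianFT_le {s : ℝ} (hs : s ∈ Ioc 0 1) {ξ : ℝ × ℝ} (hξ : ξ ≠ 0) :
    weight s * gaussianFT s ξ ≤ 6 / euclid ξ ^ 6 := by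
  have hs0 := hs.1
  have hE := euclid_pos hξ
  have hgauss : gaussian (π ^ 2 / s) ξ ≤ 6 / (π ^ 2 / s * euclid ξ ^ 2) ^ 3 := by
    rw [gaussian, ← euclid_sq, neg_mul]
    exact exp_neg_le_cube (by positivity)
  have hweight : weight s ≤ s⁻¹ := by
    refine (weight_le hs0.le).trans ?_
    rw [← Real.rpow_neg_one]
    exact Real.rpow_le_rpow_of_exponent_ge hs0 hs.2 (by norm_num)
  have hpi : 1 ≤ π ^ 5 := one_le_pow₀ (by linarith [Real.pi_gt_three])
  calc weight s * gaussianFT s ξ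
      ≤ s⁻¹ * (π / s * (6 / (π ^ 2 / s * euclid ξ ^ 2) ^ 3)) :=
        mul_le_mul hweight (mul_le_mul_of_nonneg_left hgauss (by positivity))
          (gaussianFT_nonneg hs0.le ξ) (by positivity)
    _ = s / π ^ 5 * (6 / euclid ξ ^ 6) := by field_simp
    _ ≤ 1 * (6 / euclid ξ ^ 6) := by
        gcongr
        exact div_le_one_of_le₀ (hs.2.trans hpi) (by positivity)
    _ = 6 / euclid ξ ^ 6 := one_mul _

lemma setIntegral_weight_mul_gaussianFT_le {ξ : ℝ × ℝ} (hξ : ξ ≠ 0) :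
    ∫ s in Ioc (0 : ℝ) 1, weight s * gaussianFT s ξ ≤ 6 / euclid ξ ^ 6 :=
  (setIntegral_mono_on ((integrableOn_weight_mul_gaussianFT hξ).mono_set Ioc_subset_Ioi_self)
    (integrableOn_const (by simp)) measurableSet_Ioc
    fun _ hs => weight_mul_gaussianFT_le hs hξ).trans_eq (by simp)

lemma setIntegral_weight_mul_gaussianFT_nonneg (ξ : ℝ × ℝ) :
    0 ≤ ∫ s in Ioc (0 : ℝ) 1, weight s * gaussianFT s ξ :=
  setIntegral_nonneg measurableSet_Ioc fun _ hs =>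
    mul_nonneg (weight_nonneg hs.1.le) (gaussianFT_nonneg hs.1.le ξ)

lemma euclid_mul_setIntegral_weight_mul_gaussianFT_le {k : ℤ × ℤ} (hk : k ≠ 0) :
    euclid (latticePoint k) * ∫ s in Ioc (0 : ℝ) 1, weight s * gaussianFT s (latticePoint k)
      ≤ 18 * latticeDecay k := by
  have hE := one_le_euclid_latticePoint hk
  have := euclid_pos (latticePoint_ne_zero hk)
  calc euclid (latticePoint k) * ∫ s in Ioc (0 : ℝ) 1, weight s * gaussianFT s (latticePoint k)
      ≤ euclid (latticePoint k) * (6 / euclid (latticePoint k) ^ 6) := by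
        gcongr
        exact setIntegral_weight_mul_gaussianFT_le (latticePoint_ne_zero hk)
    _ = 6 * (euclid (latticePoint k) ^ 5)⁻¹ := by field_simp
    _ ≤ 6 * (euclid (latticePoint k) ^ 4)⁻¹ := by gcongr; norm_num
    _ ≤ 6 * (3 * latticeDecay k) := by gcongr; exact inv_euclid_latticePoint_pow_le hk
    _ = 18 * latticeDecay k := by ring

lemma norm_character_sub_one_le (ξ v : ℝ × ℝ) :
    ‖character ξ v - 1‖ ≤ 2 * π * (euclid ξ * euclid v) := by
  rw [character_eq_exp_mul_I, mul_comm]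
  refine Real.norm_exp_I_mul_ofReal_sub_one_le.trans ?_
  rw [norm_neg, Real.norm_eq_abs, abs_mul, abs_of_pos Real.two_pi_pos]
  exact mul_le_mul_of_nonneg_left (abs_dot_le_euclid_mul ξ v) Real.two_pi_pos.le

section Torus

variable {f ψ : ℝ × ℝ → ℝ} {M : ℝ}

lemma fourierCoeff₂_sub_potential (hf : Continuous f) (hp : Domain.torus.IsFunction f)
    (hM : ∀ y, |f y| ≤ M) (hψc : Continuous ψ) (hψ : IsInvSqrtLaplacian .torus f ψ) {k : ℤ × ℤ}
    (hk : k ≠ 0) :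
    fourierCoeff₂ (fun x => ψ x - potential (Ioi 1) f x) k
      = ((∫ s in Ioc (0 : ℝ) 1, weight s * gaussianFT s (latticePoint k) : ℝ) : ℂ) *
        fourierCoeff₂ f k := by
  have hint := integrableOn_weight_mul_gaussianFT (latticePoint_ne_zero hk)
  have hsum := integral_weight_mul_gaussianFT (latticePoint_ne_zero hk)
  rw [← Ioc_union_Ioi_eq_Ioi (zero_le_one' ℝ), setIntegral_union
    (Ioc_disjoint_Ioi le_rfl) measurableSet_Ioi (hint.mono_set Ioc_subset_Ioi_self)
    (hint.mono_set (Ioi_subset_Ioi zero_le_one))] at hsum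
  have hstream : fourierCoeff₂ ψ k
      = ((1 / (2 * π * euclid (latticePoint k)) : ℝ) : ℂ) * fourierCoeff₂ f k := by
    rw [hψ.2, if_neg hk, latticePoint]; push_cast; ring
  rw [fourierCoeff₂_sub hψc (continuous_potential_Ioi_one hf hM), hstream,
    fourierCoeff₂_potential_Ioi_one hf hp hM, ← hsum]
  push_cast; ring

lemma norm_fourierCoeff₂_increment_le (hf : Continuous f) (hp : Domain.torus.IsFunction f)
    (hM : ∀ y, |f y| ≤ M) (hψc : Continuous ψ) (hψ : IsInvSqrtLaplacian .torus f ψ) {g : ℝ × ℝ → ℝ}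
    (hg : g = fun x => ψ x - potential (Ioi 1) f x) (v : ℝ × ℝ) (k : ℤ × ℤ) :
    ‖fourierCoeff₂ (fun x => g (x + v) - g x) k‖ ≤ 36 * π * M * euclid v * latticeDecay k := by
  have hM0 : 0 ≤ M := (abs_nonneg _).trans (hM 0)
  have hv := euclid_nonneg v
  have hgc : Continuous g := hg ▸ hψc.sub (continuous_potential_Ioi_one hf hM)
  have hgp : Domain.torus.IsFunction g := hg ▸ hψ.1.sub (isFunction_potential hp _)
  rw [fourierCoeff₂_sub (by fun_prop) hgc, fourierCoeff₂_add_right hgc hgp, ← sub_one_mul,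
    norm_mul]
  have hchar := norm_character_sub_one_le (latticePoint k) (-v)
  rw [euclid_neg] at hchar
  rcases eq_or_ne k 0 with rfl | hk
  · have hdecay := latticeDecay_nonneg 0
    have hzero : character (latticePoint 0) (-v) = 1 := by simp [character, latticePoint]
    rw [hzero, sub_self, norm_zero, zero_mul]
    positivity
  · have hnonneg := setIntegral_weight_mul_gaussianFT_nonneg (latticePoint k)
    rw [hg, fourierCoeff₂_sub_potential hf hp hM hψc hψ hk, norm_mul, Complex.norm_real,
      Real.norm_of_nonneg hnonneg]
    set m := ∫ s in Ioc (0 : ℝ) 1, weight s * gaussianFT s (latticePoint k)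
    calc ‖character (latticePoint k) (-v) - 1‖ * (m * ‖fourierCoeff₂ f k‖)
        ≤ 2 * π * (euclid (latticePoint k) * euclid v) * (m * M) :=
          mul_le_mul hchar (mul_le_mul_of_nonneg_left (norm_fourierCoeff₂_le hM k) hnonneg)
            (by positivity) ((norm_nonneg _).trans hchar)
      _ = 2 * π * M * euclid v * (euclid (latticePoint k) * m) := by ring
      _ ≤ 2 * π * M * euclid v * (18 * latticeDecay k) := 
          mul_le_mul_of_nonneg_left (euclid_mul_setIntegral_weight_mul_gaussianFT_le hk)
            (by positivity)
      _ = 36 * π * M * euclid v * latticeDecay k := by ring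

theorem abs_stream_add_sub_le_torus (hf : Continuous f) (hp : Domain.torus.IsFunction f)
    (hM : ∀ y, |f y| ≤ M) (hψc : Continuous ψ) (hψ : IsInvSqrtLaplacian .torus f ψ) (x : ℝ × ℝ)
    {v : ℝ × ℝ} {H : ℝ} (hH : 0 < H) (hH1 : H ≤ 1) (hv : euclid v ≤ H) :
    |ψ (x + v) - ψ x| ≤ 36 * π * M * (1 + ∑' k, latticeDecay k) * logModulus H := by
  have hM0 : 0 ≤ M := (abs_nonneg _).trans (hM 0)
  have hdecay : 0 ≤ ∑' k, latticeDecay k := tsum_nonneg latticeDecay_nonneg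
  obtain ⟨g, hg⟩ : ∃ g : ℝ × ℝ → ℝ, g = fun x => ψ x - potential (Ioi 1) f x := ⟨_, rfl⟩
  have hgc : Continuous g := hg ▸ hψc.sub (continuous_potential_Ioi_one hf hM)
  have hgp : Domain.torus.IsFunction g := hg ▸ hψ.1.sub (isFunction_potential hp _)
  have hsmooth : |g (x + v) - g x| ≤ 36 * π * M * euclid v * ∑' k, latticeDecay k := by
    rw [← tsum_mul_left]
    exact abs_le_tsum_of_norm_fourierCoeff₂_le (w := fun x => g (x + v) - g x) (by fun_prop)
      ((hgp.comp_add_right v).sub hgp) (summable_latticeDecay.mul_left _)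
      (norm_fourierCoeff₂_increment_le hf hp hM hψc hψ hg v) x
  have hlocal := abs_potential_Ioi_one_add_sub_le hf hM x hH hH1 hv
  calc |ψ (x + v) - ψ x|
      = |(g (x + v) - g x) + (potential (Ioi 1) f (x + v) - potential (Ioi 1) f x)| := by
        rw [hg]; ring_nf
    _ ≤ 36 * π * M * euclid v * (∑' k, latticeDecay k) + 36 * π * M * logModulus H :=
        (abs_add_le _ _).trans (add_le_add hsmooth hlocal)
    _ ≤ 36 * π * M * logModulus H * (∑' k, latticeDecay k) + 36 * π * M * logModulus H := by
        gcongr; exact hv.trans (le_logModulus hH.le)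
    _ = 36 * π * M * (1 + ∑' k, latticeDecay k) * logModulus H := by ring

end Torus

/-! ### The modulus of continuity of the stream function -/

/-- The log-Lipschitz constant of the stream function of a solution whose initial datum has norm
at most `N` in `L¹ ∩ L^∞`. -/
def streamConst (N : ℝ) : ℝ :=
  36 * π * N * (1 + ∑' k, latticeDecay k) + 4 * (N ^ 2 + 2 * π)

lemma streamConst_nonneg {N : ℝ} (hN : 0 ≤ N) : 0 ≤ streamConst N := by
  have hdecay : 0 ≤ ∑' k, latticeDecay k := tsum_nonneg latticeDecay_nonneg
  unfold streamConst; positivity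

lemma abs_add_nsmul_sub_le {p : ℝ × ℝ → ℝ} {C : ℝ} {v : ℝ × ℝ}
    (hp : ∀ x : ℝ × ℝ, |p (x + v) - p x| ≤ C) (n : ℕ) (x : ℝ × ℝ) :
    |p (x + n • v) - p x| ≤ n * C := by
  induction n with
  | zero => simp
  | succ n ih =>
    have h := abs_sub_le (p (x + n • v + v)) (p (x + n • v)) (p x)
    rw [succ_nsmul, ← add_assoc]
    push_cast
    linarith [hp (x + n • v)]

namespace IsSolution

variable {Ω : Domain} {T : EReal} {θ ψ : ℝ × ℝ → ℝ → ℝ} {t N H : ℝ} {v : ℝ × ℝ}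

lemma abs_stream_add_sub_le_of_le_one (hS : IsSolution Ω T θ ψ) (hN : 0 ≤ N)
    (h0 : normL1Linf Ω (fun x => θ x 0) ≤ ENNReal.ofReal N) (ht : t ∈ timeInterval T) (x : ℝ × ℝ)
    (hH : 0 < H) (hH1 : H ≤ 1) (hv : euclid v ≤ H) :
    |ψ (x + v) t - ψ x t| ≤ streamConst N * logModulus H := by
  have hmod := logModulus_nonneg hH.le
  have hθ := (hS.contDiff ht).continuous
  have hM := hS.abs_le hN h0 ht
  cases Ω with
  | plane =>
    obtain ⟨M, -, hMt⟩ := hS.exists_normL1Linf_le ht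
    have hint := integrable_of_normL1Linf_le hθ (hMt t ⟨ht.1, le_rfl⟩)
    have h := abs_potential_Ioi_zero_add_sub_le hθ hint hM (sq_nonneg N)
      (hS.lintegral_sq_le hN h0 ht) x hH hH1 hv
    rw [← (hS.stream t ht).eq_potential] at h
    refine h.trans (mul_le_mul_of_nonneg_right (add_le_add_left ?_ _) hmod)
    exact le_mul_of_one_le_right (by positivity)
      (le_add_of_nonneg_right (tsum_nonneg latticeDecay_nonneg))
  | torus =>
    exact (abs_stream_add_sub_le_torus hθ (hS.isFunction t ht) hM
      (hS.stream_contDiff t ht).continuous (hS.stream t ht) x hH hH1 hv).trans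
      (mul_le_mul_of_nonneg_right (le_add_of_nonneg_right (by positivity)) hmod)

theorem abs_stream_add_sub_le (hS : IsSolution Ω T θ ψ) (hN : 0 ≤ N)
    (h0 : normL1Linf Ω (fun x => θ x 0) ≤ ENNReal.ofReal N) (ht : t ∈ timeInterval T) (x : ℝ × ℝ)
    (hH : 0 < H) (hv : euclid v ≤ H) :
    |ψ (x + v) t - ψ x t| ≤ 2 * streamConst N * logModulus H := by
  have hK := streamConst_nonneg hN
  have hmod := mul_nonneg hK (logModulus_nonneg hH.le)
  rcases le_total H 1 with hH1 | hH1
  · linarith [hS.abs_stream_add_sub_le_of_le_one hN h0 ht x hH hH1 hv]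
  · have hn : 0 < (⌈H⌉₊ : ℝ) := by exact_mod_cast Nat.ceil_pos.mpr hH
    have hsmall : euclid ((⌈H⌉₊ : ℝ)⁻¹ • v) ≤ 1 := by
      rw [euclid_smul, abs_of_pos (inv_pos.mpr hn), inv_mul_le_one₀ hn]
      exact hv.trans (Nat.le_ceil H)
    have hstep (y : ℝ × ℝ) : |ψ (y + (⌈H⌉₊ : ℝ)⁻¹ • v) t - ψ y t| ≤ streamConst N := by
      simpa [logModulus] using hS.abs_stream_add_sub_le_of_le_one hN h0 ht y one_pos le_rfl hsmall
    have hsum := abs_add_nsmul_sub_le (p := fun y => ψ y t) hstep ⌈H⌉₊ x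
    rw [← Nat.cast_smul_eq_nsmul ℝ, smul_inv_smul₀ hn.ne'] at hsum
    calc |ψ (x + v) t - ψ x t| ≤ ⌈H⌉₊ * streamConst N := hsum
      _ ≤ 2 * H * streamConst N := by gcongr; linarith [Nat.ceil_lt_add_one hH.le]
      _ ≤ 2 * logModulus H * streamConst N := by gcongr; exact le_logModulus hH.le
      _ = 2 * streamConst N * logModulus H := by ring

end IsSolution

/-! ### Motion of the level curves -/

lemma hasDerivAt_comp_graph {f : ℝ × ℝ → ℝ} {u : ℝ → ℝ} {u' x : ℝ}
    (hf : DifferentiableAt ℝ f (x, u x)) (hu : HasDerivAt u u' x) :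
    HasDerivAt (fun y => f (y, u y)) (d₁ f (x, u x) + u' * d₂ f (x, u x)) x := by
  have hcomp := hf.hasFDerivAt.comp_hasDerivAt (x := x) (f := fun y : ℝ => (y, u y))
    ((hasDerivAt_id x).prodMk hu)
  refine hcomp.congr_deriv ?_
  rw [d₁_eq_fderiv hf, d₂_eq_fderiv hf, ← smul_eq_mul, ← map_smul, ← map_add]
  simp

lemma hasDerivAt_comp_vertical {T : EReal} {θ : ℝ × ℝ → ℝ → ℝ} {u : ℝ → ℝ} {u' t : ℝ}
    (hθ : ContDiffOn ℝ 1 (fun p : (ℝ × ℝ) × ℝ => θ p.1 p.2) (univ ×ˢ timeInterval T))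
    (ht : t ∈ openTimeInterval T) (hu : HasDerivAt u u' t) (x : ℝ) :
    HasDerivAt (fun s => θ (x, u s) s)
      (deriv (fun s => θ (x, u t) s) t + u' * d₂ (fun y => θ y t) (x, u t)) t := by
  have hdiff := differentiableAt_uncurry hθ ht (x, u t)
  have hspace : d₂ (fun y => θ y t) (x, u t)
      = fderiv ℝ (fun p : (ℝ × ℝ) × ℝ => θ p.1 p.2) ((x, u t), t) ((0, 1), 0) :=
    (hdiff.hasFDerivAt.comp_hasDerivAt (x := u t) (f := fun y : ℝ => ((x, y), t))
      (((hasDerivAt_const _ x).prodMk (hasDerivAt_id _)).prodMk (hasDerivAt_const _ t))).deriv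
  have hcomp := hdiff.hasFDerivAt.comp_hasDerivAt (x := t) (f := fun s : ℝ => ((x, u s), s))
    (((hasDerivAt_const t x).prodMk hu).prodMk (hasDerivAt_id t))
  refine hcomp.congr_deriv ?_
  rw [(hasDerivAt_time hθ ht _).deriv, hspace, ← smul_eq_mul, ← map_smul, ← map_add]
  simp

section MovingGraph

variable {a b t : ℝ} {u : ℝ → ℝ → ℝ} {V : Set ℝ}

lemma hasDerivAt_deriv_of_contDiffOn_prod
    (hu : ContDiffOn ℝ 1 (fun p : ℝ × ℝ => u p.1 p.2) (Icc a b ×ˢ V)) (hV : IsOpen V)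
    {x : ℝ} (hx : x ∈ Icc a b) (ht : t ∈ V) : HasDerivAt (u x) (deriv (u x) t) t :=
  ((hu.comp (f := fun s : ℝ => (x, s)) (by fun_prop) fun _ hs => ⟨hx, hs⟩).contDiffAt
    (hV.mem_nhds ht)).differentiableAt one_ne_zero |>.hasDerivAt

lemma continuousOn_deriv_of_contDiffOn_prod
    (hu : ContDiffOn ℝ 1 (fun p : ℝ × ℝ => u p.1 p.2) (Icc a b ×ˢ V)) (hab : a < b)
    (hV : IsOpen V) : ContinuousOn (fun p : ℝ × ℝ => deriv (u p.1) p.2) (Icc a b ×ˢ V) := by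
  refine ((hu.continuousOn_fderivWithin ((uniqueDiffOn_Icc hab).prod hV.uniqueDiffOn)
    le_rfl).clm_apply (continuousOn_const (c := ((0 : ℝ), (1 : ℝ))))).congr fun p hp => ?_
  have hline : HasDerivWithinAt (fun s : ℝ => (p.1, s)) ((0 : ℝ), (1 : ℝ)) V p.2 :=
    ((hasDerivAt_const p.2 p.1).prodMk (hasDerivAt_id p.2)).hasDerivWithinAt
  exact (((hu.differentiableOn one_ne_zero p hp).hasFDerivWithinAt.comp_hasDerivWithinAt
    (x := p.2) (f := fun s : ℝ => (p.1, s)) hline fun s hs => ⟨hp.1, hs⟩).hasDerivAt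
    (hV.mem_nhds hp.2)).deriv

lemma continuousOn_slice_of_continuousOn_prod {g : ℝ × ℝ → ℝ} (hg : ContinuousOn g (Icc a b ×ˢ V))
    (ht : t ∈ V) : ContinuousOn (fun x => g (x, t)) (Icc a b) :=
  hg.comp (f := fun x : ℝ => (x, t)) (by fun_prop) fun _ hx => ⟨hx, ht⟩

lemma aestronglyMeasurable_uIoc (hab : a ≤ b) {f : ℝ → ℝ} (hf : ContinuousOn f (Icc a b)) :
    AEStronglyMeasurable f (volume.restrict (uIoc a b)) :=
  (hf.aestronglyMeasurable measurableSet_Icc).mono_measure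
    (Measure.restrict_mono (uIoc_of_le hab ▸ Ioc_subset_Icc_self) le_rfl)

lemma hasDerivAt_intervalIntegral_of_contDiffOn
    (hu : ContDiffOn ℝ 1 (fun p : ℝ × ℝ => u p.1 p.2) (Icc a b ×ˢ V)) (hab : a < b)
    (hV : IsOpen V) (ht : t ∈ V) :
    HasDerivAt (fun s => ∫ x in a..b, u x s) (∫ x in a..b, deriv (u x) t) t := by
  obtain ⟨J, hJ, htJ, hJV⟩ := exists_compact_subset hV ht
  have hderiv := continuousOn_deriv_of_contDiffOn_prod hu hab hV
  obtain ⟨C, hC⟩ := (isCompact_Icc.prod hJ).exists_bound_of_continuousOn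
    (hderiv.mono (prod_mono_right hJV))
  have hslice {s : ℝ} (hs : s ∈ V) : ContinuousOn (fun x => u x s) (Icc a b) :=
    continuousOn_slice_of_continuousOn_prod hu.continuousOn hs
  have hsub : uIoc a b ⊆ Icc a b := uIoc_of_le hab.le ▸ Ioc_subset_Icc_self
  refine (intervalIntegral.hasDerivAt_integral_of_dominated_loc_of_deriv_le
    (F' := fun s x => deriv (u x) s) (bound := fun _ => C) (mem_interior_iff_mem_nhds.mp htJ) ?_
    ((hslice ht).intervalIntegrable_of_Icc hab.le)
    (aestronglyMeasurable_uIoc hab.le (continuousOn_slice_of_continuousOn_prod hderiv ht))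
    (.of_forall fun x hx s hs => hC (x, s) ⟨hsub hx, hs⟩) intervalIntegrable_const
    (.of_forall fun x hx s hs =>
      hasDerivAt_deriv_of_contDiffOn_prod hu hV (hsub hx) (hJV hs))).2
  filter_upwards [hV.mem_nhds ht] with s hs
  exact aestronglyMeasurable_uIoc hab.le (hslice hs)

lemma continuousOn_intervalIntegral_of_continuousOn
    (hu : ContinuousOn (fun p : ℝ × ℝ => u p.1 p.2) (Icc a b ×ˢ V)) (hab : a ≤ b)
    (hV : IsCompact V) : ContinuousOn (fun s => ∫ x in a..b, u x s) V := by
  obtain ⟨C, hC⟩ := (isCompact_Icc.prod hV).exists_bound_of_continuousOn hu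
  have hsub : uIoc a b ⊆ Icc a b := uIoc_of_le hab ▸ Ioc_subset_Icc_self
  intro s hs
  refine intervalIntegral.continuousWithinAt_of_dominated_interval (bound := fun _ => C) ?_ ?_
    intervalIntegrable_const (.of_forall fun x hx => ?_)
  · filter_upwards [self_mem_nhdsWithin] with r hr
    exact aestronglyMeasurable_uIoc hab (continuousOn_slice_of_continuousOn_prod hu hr)
  · filter_upwards [self_mem_nhdsWithin] with r hr
    exact .of_forall fun x hx => hC (x, r) ⟨hsub hx, hr⟩
  · exact hu.comp (f := fun r : ℝ => (x, r)) (by fun_prop) (fun r hr => ⟨hsub hx, hr⟩) s hs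

end MovingGraph

namespace IsLevelCurve

variable {Ω : Domain} {T : EReal} {θ ψ : ℝ × ℝ → ℝ → ℝ} {a b g x t : ℝ} {φ : ℝ → ℝ → ℝ}

lemma contDiffOn_openTimeInterval (hφ : IsLevelCurve T θ a b φ g) :
    ContDiffOn ℝ 1 (fun p : ℝ × ℝ => φ p.1 p.2) (Icc a b ×ˢ openTimeInterval T) :=
  hφ.contDiffOn.mono (prod_mono_right (openTimeInterval_subset T))

lemma continuousOn_slice (hφ : IsLevelCurve T θ a b φ g) (ht : t ∈ timeInterval T) :
    ContinuousOn (fun x => φ x t) (Icc a b) :=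
  continuousOn_slice_of_continuousOn_prod hφ.contDiffOn.continuousOn ht

lemma hasDerivAt_deriv (hφ : IsLevelCurve T θ a b φ g) (hx : x ∈ Icc a b)
    (ht : t ∈ openTimeInterval T) : HasDerivAt (φ x) (deriv (φ x) t) t :=
  hasDerivAt_deriv_of_contDiffOn_prod hφ.contDiffOn_openTimeInterval (isOpen_openTimeInterval T)
    hx ht

theorem hasDerivAt_stream (hS : IsSolution Ω T θ ψ) (hφ : IsLevelCurve T θ a b φ g)
    (hx : x ∈ Ioo a b) (ht : t ∈ openTimeInterval T) :
    HasDerivAt (fun y => ψ (y, φ y t) t) (deriv (φ x) t) x := by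
  have htT := openTimeInterval_subset T ht
  have hxI := Ioo_subset_Icc_self hx
  obtain ⟨φx, hφx⟩ : ∃ φx, HasDerivAt (fun y => φ y t) φx x :=
    ⟨_, ((hφ.contDiffOn.comp (f := fun y : ℝ => (y, t)) (by fun_prop)
      fun _ hy => ⟨hy, htT⟩).contDiffAt (Icc_mem_nhds hx.1 hx.2)).differentiableAt
      one_ne_zero |>.hasDerivAt⟩
  have hlevel_space := (hasDerivAt_comp_graph ((contDiff_slice hS.contDiffOn htT).differentiable
    one_ne_zero (x, φ x t)) hφx).unique <| (hasDerivAt_const x g).congr_of_eventuallyEq <| by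
      filter_upwards [Icc_mem_nhds hx.1 hx.2] with y hy using hφ.level y hy t htT
  have hlevel_time := (hasDerivAt_comp_vertical hS.contDiffOn ht (hφ.hasDerivAt_deriv hxI ht)
    x).unique <| (hasDerivAt_const t g).congr_of_eventuallyEq <| by
      filter_upwards [(isOpen_openTimeInterval T).mem_nhds ht] with s hs
        using hφ.level x hxI s (openTimeInterval_subset T hs)
  have htransport := hS.transport t htT ht.1 (x, φ x t)
  refine (hasDerivAt_comp_graph ((hS.stream_contDiff t htT).differentiable one_ne_zero
    (x, φ x t)) hφx).congr_deriv (mul_right_cancel₀ (hφ.nondegenerate x hxI t htT) ?_)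
  linear_combination htransport - hlevel_time
    + d₂ (fun y => ψ y t) (x, φ x t) * hlevel_space

end IsLevelCurve

/-! ### The area of the front -/

lemma mul_le_abs_integral {a b m : ℝ} {u : ℝ → ℝ} (hab : a ≤ b) (hu : ContinuousOn u (Icc a b))
    (hm : 0 < m) (hmu : ∀ x ∈ Icc a b, m ≤ |u x|) : (b - a) * m ≤ |∫ x in a..b, u x| := by
  have hconst : ∫ _ in a..b, m = (b - a) * m := by simp
  have hint : IntervalIntegrable u volume a b := hu.intervalIntegrable_of_Icc hab
  have hsign : (∀ x ∈ Icc a b, m ≤ u x) ∨ ∀ x ∈ Icc a b, m ≤ -u x := by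
    by_contra! hcon
    obtain ⟨⟨x, hx, hxm⟩, y, hy, hym⟩ := hcon
    have hux : u x ≤ 0 := by rcases le_abs.mp (hmu x hx) with h | h <;> linarith
    have huy : 0 ≤ u y := by rcases le_abs.mp (hmu y hy) with h | h <;> linarith
    obtain ⟨z, hz, hz0⟩ := isPreconnected_Icc.intermediate_value hx hy hu ⟨hux, huy⟩
    have hmz := hmu z hz
    rw [hz0, abs_zero] at hmz
    exact hm.not_ge hmz
  rcases hsign with h | h
  · refine le_trans ?_ (le_abs_self _)
    rw [← hconst]
    exact intervalIntegral.integral_mono_on hab intervalIntegrable_const hint h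
  · refine le_trans ?_ (neg_le_abs _)
    rw [← hconst, ← intervalIntegral.integral_neg]
    exact intervalIntegral.integral_mono_on hab intervalIntegrable_const hint.neg h

lemma minThickness_nonneg (a b : ℝ) (φ₁ φ₂ : ℝ → ℝ → ℝ) (t : ℝ) :
    0 ≤ minThickness a b φ₁ φ₂ t :=
  Real.sInf_nonneg (by rintro _ ⟨x, -, rfl⟩; exact abs_nonneg _)

lemma minThickness_le {a b x : ℝ} (hx : x ∈ Icc a b) (φ₁ φ₂ : ℝ → ℝ → ℝ) (t : ℝ) :
    minThickness a b φ₁ φ₂ t ≤ thickness φ₁ φ₂ x t :=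
  csInf_le ⟨0, by rintro _ ⟨y, -, rfl⟩; exact abs_nonneg _⟩ ⟨x, hx, rfl⟩

/-- The signed area between the curves, divided by `c (b - a)` so that it bounds the thickness of a
semi-uniform front with constant `c` from above. -/
def scaledArea (a b c : ℝ) (φ₁ φ₂ : ℝ → ℝ → ℝ) (t : ℝ) : ℝ :=
  (∫ x in a..b, (φ₂ x t - φ₁ x t)) / (c * (b - a))

/-- The rate `κ` in the differential inequality `|Y'| ≤ κ Y (1 + log⁺ (1 / Y))` for the scaled area
`Y` of a front of length `ℓ`. -/
def areaRate (ℓ c N : ℝ) : ℝ := 4 * streamConst N / (c * ℓ)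

lemma areaRate_nonneg {ℓ c N : ℝ} (hℓ : 0 ≤ ℓ) (hc : 0 ≤ c) (hN : 0 ≤ N) : 0 ≤ areaRate ℓ c N :=
  div_nonneg (mul_nonneg zero_le_four (streamConst_nonneg hN)) (mul_nonneg hc hℓ)

/-- The flux of the velocity `∇^⊥ ψ`, in the direction of decreasing `x₁`, through the vertical
segment joining the two curves above `x`. -/
def flux (ψ : ℝ × ℝ → ℝ → ℝ) (φ₁ φ₂ : ℝ → ℝ → ℝ) (x t : ℝ) : ℝ :=
  ψ (x, φ₂ x t) t - ψ (x, φ₁ x t) t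

lemma IsSolution.abs_flux_le {Ω : Domain} {T : EReal} {θ ψ : ℝ × ℝ → ℝ → ℝ} {t N H x : ℝ}
    {φ₁ φ₂ : ℝ → ℝ → ℝ} (hS : IsSolution Ω T θ ψ) (hN : 0 ≤ N)
    (h0 : normL1Linf Ω (fun x => θ x 0) ≤ ENNReal.ofReal N) (ht : t ∈ timeInterval T)
    (hH : 0 < H) (hx : thickness φ₁ φ₂ x t ≤ H) :
    |flux ψ φ₁ φ₂ x t| ≤ 2 * streamConst N * logModulus H := by
  have hv : euclid (0, φ₂ x t - φ₁ x t) ≤ H := by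
    simpa [euclid, Real.sqrt_sq_eq_abs, thickness] using hx
  simpa [flux] using hS.abs_stream_add_sub_le hN h0 ht (x, φ₁ x t) hH hv

namespace IsSemiUniformFront

variable {Ω : Domain} {T : EReal} {θ ψ : ℝ × ℝ → ℝ → ℝ} {a b c t N : ℝ} {φ₁ φ₂ : ℝ → ℝ → ℝ}

lemma contDiffOn_sub (hF : IsSemiUniformFront T θ a b c φ₁ φ₂) :
    ContDiffOn ℝ 1 (fun p : ℝ × ℝ => φ₂ p.1 p.2 - φ₁ p.1 p.2) (Icc a b ×ˢ timeInterval T) := by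
  obtain ⟨g₁, h₁⟩ := hF.levelCurve₁
  obtain ⟨g₂, h₂⟩ := hF.levelCurve₂
  exact h₂.contDiffOn.sub h₁.contDiffOn

lemma continuousOn_sub (hF : IsSemiUniformFront T θ a b c φ₁ φ₂) (ht : t ∈ timeInterval T) :
    ContinuousOn (fun x => φ₂ x t - φ₁ x t) (Icc a b) :=
  continuousOn_slice_of_continuousOn_prod hF.contDiffOn_sub.continuousOn ht

lemma thickness_le_maxThickness (hF : IsSemiUniformFront T θ a b c φ₁ φ₂)
    (ht : t ∈ timeInterval T) {x : ℝ} (hx : x ∈ Icc a b) :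
    thickness φ₁ φ₂ x t ≤ maxThickness a b φ₁ φ₂ t :=
  le_csSup (isCompact_Icc.bddAbove_image (hF.continuousOn_sub ht).abs) ⟨x, hx, rfl⟩

lemma minThickness_div_le_abs_scaledArea (hF : IsSemiUniformFront T θ a b c φ₁ φ₂) (hc : 0 < c)
    (hab : a < b) (ht : t ∈ timeInterval T) :
    minThickness a b φ₁ φ₂ t / c ≤ |scaledArea a b c φ₁ φ₂ t| := by
  have hba := sub_pos.mpr hab
  rcases (minThickness_nonneg a b φ₁ φ₂ t).eq_or_lt with h0 | hpos
  · simp [← h0]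
  · have harea := mul_le_abs_integral hab.le (hF.continuousOn_sub ht) hpos
      fun x hx => minThickness_le hx φ₁ φ₂ t
    rw [scaledArea, abs_div, abs_of_pos (mul_pos hc hba), le_div_iff₀ (mul_pos hc hba)]
    calc minThickness a b φ₁ φ₂ t / c * (c * (b - a))
        = (b - a) * minThickness a b φ₁ φ₂ t := by field_simp
      _ ≤ _ := harea

lemma mul_abs_scaledArea_le_minThickness (hF : IsSemiUniformFront T θ a b c φ₁ φ₂) (hc : 0 < c)
    (hab : a < b) (ht : t ∈ timeInterval T) :
    c ^ 2 * |scaledArea a b c φ₁ φ₂ t| ≤ minThickness a b φ₁ φ₂ t := by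
  have hba := sub_pos.mpr hab
  have harea := intervalIntegral.norm_integral_le_of_norm_le_const
    (f := fun x => φ₂ x t - φ₁ x t) (C := maxThickness a b φ₁ φ₂ t)
    fun x hx => hF.thickness_le_maxThickness ht (Ioc_subset_Icc_self (uIoc_of_le hab.le ▸ hx))
  rw [Real.norm_eq_abs, abs_of_pos hba, ← div_le_iff₀ hba] at harea
  calc c ^ 2 * |scaledArea a b c φ₁ φ₂ t|
      = c * (|∫ x in a..b, (φ₂ x t - φ₁ x t)| / (b - a)) := by
        rw [scaledArea, abs_div, abs_of_pos (mul_pos hc hba)]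
        field_simp
    _ ≤ c * maxThickness a b φ₁ φ₂ t := by gcongr
    _ ≤ minThickness a b φ₁ φ₂ t := hF.semiUniform t ht

lemma thickness_le_abs_scaledArea (hF : IsSemiUniformFront T θ a b c φ₁ φ₂) (hc : 0 < c)
    (hab : a < b) (ht : t ∈ timeInterval T) {x : ℝ} (hx : x ∈ Icc a b) :
    thickness φ₁ φ₂ x t ≤ |scaledArea a b c φ₁ φ₂ t| := by
  refine le_trans ?_ (hF.minThickness_div_le_abs_scaledArea hc hab ht)
  rw [le_div_iff₀ hc, mul_comm]
  exact (mul_le_mul_of_nonneg_left (hF.thickness_le_maxThickness ht hx) hc.le).trans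
    (hF.semiUniform t ht)

lemma continuousOn_scaledArea (hF : IsSemiUniformFront T θ a b c φ₁ φ₂) (hab : a ≤ b)
    (ht : t ∈ timeInterval T) : ContinuousOn (scaledArea a b c φ₁ φ₂) (Icc 0 t) :=
  (continuousOn_intervalIntegral_of_continuousOn (u := fun x s => φ₂ x s - φ₁ x s)
    (hF.contDiffOn_sub.continuousOn.mono (prod_mono_right (Icc_subset_timeInterval ht))) hab
    isCompact_Icc).div_const _

lemma integral_deriv_eq_flux_sub (hF : IsSemiUniformFront T θ a b c φ₁ φ₂)
    (hS : IsSolution Ω T θ ψ) (hab : a < b) (ht : t ∈ openTimeInterval T) :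
    ∫ x in a..b, deriv (fun s => φ₂ x s - φ₁ x s) t
      = flux ψ φ₁ φ₂ b t - flux ψ φ₁ φ₂ a t := by
  obtain ⟨g₁, h₁⟩ := hF.levelCurve₁
  obtain ⟨g₂, h₂⟩ := hF.levelCurve₂
  have htT := openTimeInterval_subset T ht
  have hψ := (hS.stream_contDiff t htT).continuous
  have hderiv := continuousOn_deriv_of_contDiffOn_prod (u := fun x s => φ₂ x s - φ₁ x s)
    (hF.contDiffOn_sub.mono (prod_mono_right (openTimeInterval_subset T))) hab
    (isOpen_openTimeInterval T)
  refine intervalIntegral.integral_eq_sub_of_hasDerivAt_of_le hab.le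
    (f := fun x => flux ψ φ₁ φ₂ x t) ?_ (fun x hx => ?_)
    ((continuousOn_slice_of_continuousOn_prod hderiv ht).intervalIntegrable_of_Icc hab.le)
  · exact (hψ.comp_continuousOn (continuousOn_id.prodMk (h₂.continuousOn_slice htT))).sub
      (hψ.comp_continuousOn (continuousOn_id.prodMk (h₁.continuousOn_slice htT)))
  · have hxI := Ioo_subset_Icc_self hx
    exact ((h₂.hasDerivAt_stream hS hx ht).sub (h₁.hasDerivAt_stream hS hx ht)).congr_deriv
      ((h₂.hasDerivAt_deriv hxI ht).sub (h₁.hasDerivAt_deriv hxI ht)).deriv.symm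

theorem hasDerivAt_scaledArea (hF : IsSemiUniformFront T θ a b c φ₁ φ₂)
    (hS : IsSolution Ω T θ ψ) (hab : a < b) (ht : t ∈ openTimeInterval T) :
    HasDerivAt (scaledArea a b c φ₁ φ₂)
      ((flux ψ φ₁ φ₂ b t - flux ψ φ₁ φ₂ a t) / (c * (b - a))) t := by
  rw [← hF.integral_deriv_eq_flux_sub hS hab ht]
  exact (hasDerivAt_intervalIntegral_of_contDiffOn (u := fun x s => φ₂ x s - φ₁ x s)
    (hF.contDiffOn_sub.mono (prod_mono_right (openTimeInterval_subset T))) hab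
    (isOpen_openTimeInterval T) ht).div_const _

theorem abs_flux_sub_div_le (hF : IsSemiUniformFront T θ a b c φ₁ φ₂) (hS : IsSolution Ω T θ ψ)
    (hc : 0 < c) (hab : a < b) (hN : 0 ≤ N)
    (h0 : normL1Linf Ω (fun x => θ x 0) ≤ ENNReal.ofReal N) (ht : t ∈ timeInterval T)
    (hne : scaledArea a b c φ₁ φ₂ t ≠ 0) :
    |(flux ψ φ₁ φ₂ b t - flux ψ φ₁ φ₂ a t) / (c * (b - a))|
      ≤ areaRate (b - a) c N * logModulus |scaledArea a b c φ₁ φ₂ t| := by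
  have hba := sub_pos.mpr hab
  have hflux {x : ℝ} (hx : x ∈ Icc a b) :
      |flux ψ φ₁ φ₂ x t| ≤ 2 * streamConst N * logModulus |scaledArea a b c φ₁ φ₂ t| :=
    hS.abs_flux_le hN h0 ht (abs_pos.mpr hne) (hF.thickness_le_abs_scaledArea hc hab ht hx)
  rw [areaRate, abs_div, abs_of_pos (mul_pos hc hba), div_mul_eq_mul_div]
  gcongr
  linarith [abs_sub (flux ψ φ₁ φ₂ b t) (flux ψ φ₁ φ₂ a t), hflux ⟨hab.le, le_rfl⟩,
    hflux ⟨le_rfl, hab.le⟩]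

end IsSemiUniformFront

/-! ### The double exponential barrier -/

/-- The barrier, a subsolution of `Y' = -κ Y (1 + log⁺ (1 / Y))` for `A > 2κ` and `B ≥ 0`. -/
def doubleExp (A B t : ℝ) : ℝ := Real.exp (-Real.exp (A * t + B))

lemma doubleExp_pos (A B t : ℝ) : 0 < doubleExp A B t := Real.exp_pos _

lemma hasDerivAt_doubleExp (A B t : ℝ) :
    HasDerivAt (doubleExp A B) (-(A * (Real.exp (A * t + B) * doubleExp A B t))) t := by
  have hlin : HasDerivAt (fun t => A * t + B) A t := by
    simpa using ((hasDerivAt_id t).const_mul A).add_const B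
  refine hlin.exp.neg.exp.congr_deriv ?_
  simp only [doubleExp, Pi.neg_apply]
  ring

lemma logModulus_doubleExp_le {A B t : ℝ} (h : 0 ≤ A * t + B) :
    logModulus (doubleExp A B t) ≤ 2 * (Real.exp (A * t + B) * doubleExp A B t) := by
  have hlog : Real.posLog (doubleExp A B t)⁻¹ = Real.exp (A * t + B) := by
    rw [doubleExp, ← Real.exp_neg, neg_neg, Real.posLog_eq_log, Real.log_exp]
    exact (Real.one_le_exp (Real.exp_pos _).le).trans (le_abs_self _)
  rw [logModulus, hlog]
  nlinarith [Real.one_le_exp h, doubleExp_pos A B t]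

lemma exists_mem_Ioo_lt_of_lt {f g : ℝ → ℝ} {t : ℝ} (ht : 0 < t) (hf : ContinuousOn f (Icc 0 t))
    (hg : ContinuousOn g (Icc 0 t)) (h : f 0 < g 0) : ∃ s ∈ Ioo 0 t, f s < g s := by
  have h0 : (0 : ℝ) ∈ Icc 0 t := ⟨le_rfl, ht.le⟩
  have hev : ∀ᶠ s in 𝓝[Ioo 0 t] 0, f s < g s :=
    ((hf 0 h0).mono Ioo_subset_Icc_self).eventually_lt ((hg 0 h0).mono Ioo_subset_Icc_self) h
  have := left_nhdsWithin_Ioo_neBot ht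
  obtain ⟨s, hlt, hs⟩ := (hev.and self_mem_nhdsWithin).exists
  exact ⟨s, hs, hlt⟩

section Barrier

variable {Y Y' : ℝ → ℝ} {κ B t : ℝ}

lemma doubleExp_le_of_abs_deriv_le (hκ : 0 ≤ κ) (hB : 0 ≤ B) (ht : 0 ≤ t)
    (hY : ContinuousOn Y (Icc 0 t)) (h0 : doubleExp (2 * κ + 1) B 0 < Y 0)
    (hY' : ∀ s ∈ Ioo 0 t, HasDerivAt Y (Y' s) s)
    (hbound : ∀ s ∈ Ioo 0 t, 0 < Y s → |Y' s| ≤ κ * logModulus (Y s)) :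
    doubleExp (2 * κ + 1) B t ≤ Y t := by
  rcases ht.eq_or_lt with rfl | ht0
  · exact h0.le
  have hE : Continuous (doubleExp (2 * κ + 1) B) := by unfold doubleExp; fun_prop
  obtain ⟨t₀, ht₀, hlt⟩ := exists_mem_Ioo_lt_of_lt ht0 hE.continuousOn hY h0
  have hsub {s : ℝ} (hs : s ∈ Ico t₀ t) : s ∈ Ioo 0 t := ⟨ht₀.1.trans_le hs.1, hs.2⟩
  refine image_le_of_deriv_right_lt_deriv_boundary' (a := t₀) (b := t) hE.continuousOn
    (fun s _ => (hasDerivAt_doubleExp _ B s).hasDerivWithinAt) hlt.le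
    (hY.mono (Icc_subset_Icc_left ht₀.1.le))
    (fun s hs => (hY' s (hsub hs)).hasDerivWithinAt) (fun s hs heq => ?_) ⟨ht₀.2.le, le_rfl⟩
  have hs0 := (hsub hs).1
  have hYs := hbound s (hsub hs) (heq ▸ doubleExp_pos _ B s)
  rw [← heq] at hYs
  have hmod := mul_le_mul_of_nonneg_left
    (logModulus_doubleExp_le (show 0 ≤ (2 * κ + 1) * s + B by positivity)) hκ
  have hpos := mul_pos (Real.exp_pos ((2 * κ + 1) * s + B)) (doubleExp_pos (2 * κ + 1) B s)
  linarith [neg_le_of_abs_le hYs]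

theorem doubleExp_le_abs_of_abs_deriv_le (hκ : 0 ≤ κ) (hB : 0 ≤ B) (ht : 0 ≤ t)
    (hY : ContinuousOn Y (Icc 0 t)) (h0 : doubleExp (2 * κ + 1) B 0 < |Y 0|)
    (hY' : ∀ s ∈ Ioo 0 t, HasDerivAt Y (Y' s) s)
    (hbound : ∀ s ∈ Ioo 0 t, Y s ≠ 0 → |Y' s| ≤ κ * logModulus |Y s|) :
    doubleExp (2 * κ + 1) B t ≤ |Y t| := by
  rcases lt_abs.mp h0 with hpos | hneg
  · refine (doubleExp_le_of_abs_deriv_le hκ hB ht hY hpos hY' fun s hs hs0 => ?_).trans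
      (le_abs_self _)
    simpa only [abs_of_pos hs0] using hbound s hs hs0.ne'
  · refine (doubleExp_le_of_abs_deriv_le hκ hB ht hY.neg hneg (fun s hs => (hY' s hs).neg)
      fun s hs hs0 => ?_).trans (neg_le_abs _)
    rw [abs_neg, Pi.neg_apply, ← abs_of_neg (neg_pos.mp hs0)]
    exact hbound s hs (neg_pos.mp hs0).ne

end Barrier

lemma exists_doubleExp_zero_lt {y : ℝ} (hy : 0 < y) : ∃ B ≥ 0, ∀ A : ℝ, doubleExp A B 0 < y := by
  have habs := abs_nonneg (Real.log y)
  refine ⟨Real.log (1 + |Real.log y|), Real.log_nonneg (by linarith), fun A => ?_⟩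
  rw [doubleExp, mul_zero, zero_add, Real.exp_log (by positivity), ← Real.lt_log_iff_exp_lt hy]
  linarith [neg_abs_le (Real.log y)]

lemma exists_doubleExp_lt_mul_doubleExp {m A : ℝ} (hm : 0 < m) (hA : 0 ≤ A) (B : ℝ) :
    ∃ B' : ℝ, ∀ t ≥ 0, doubleExp A B' t < m * doubleExp A B t := by
  refine ⟨Real.log (Real.exp B + |Real.log m| + 1), fun t ht => ?_⟩
  have hgrow : 1 ≤ Real.exp (A * t) := Real.one_le_exp (by positivity)
  have habs := abs_nonneg (Real.log m)
  nth_rw 2 [← Real.exp_log hm]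
  rw [doubleExp, doubleExp, ← Real.exp_add, Real.exp_lt_exp, Real.exp_add, Real.exp_add,
    Real.exp_log (by positivity)]
  nlinarith [neg_abs_le (Real.log m)]

theorem IsSemiUniformFront.doubleExp_le_abs_scaledArea {Ω : Domain} {T : EReal}
    {θ ψ : ℝ × ℝ → ℝ → ℝ} {a b c t N B : ℝ} {φ₁ φ₂ : ℝ → ℝ → ℝ}
    (hF : IsSemiUniformFront T θ a b c φ₁ φ₂) (hS : IsSolution Ω T θ ψ) (hc : 0 < c) (hab : a < b)
    (hN : 0 ≤ N) (h0 : normL1Linf Ω (fun x => θ x 0) ≤ ENNReal.ofReal N) (hB : 0 ≤ B)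
    (hinitial : doubleExp (2 * areaRate (b - a) c N + 1) B 0 < minThickness a b φ₁ φ₂ 0 / c)
    (ht : t ∈ timeInterval T) :
    doubleExp (2 * areaRate (b - a) c N + 1) B t ≤ |scaledArea a b c φ₁ φ₂ t| := by
  refine doubleExp_le_abs_of_abs_deriv_le (areaRate_nonneg (sub_nonneg.mpr hab.le) hc.le hN) hB ht.1
    (hF.continuousOn_scaledArea hab.le ht)
    (hinitial.trans_le (hF.minThickness_div_le_abs_scaledArea hc hab (zero_mem_timeInterval ht)))
    (fun s hs => hF.hasDerivAt_scaledArea hS hab (Ioo_subset_openTimeInterval ht hs))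
    fun s hs hne => ?_
  exact hF.abs_flux_sub_div_le hS hc hab hN h0
    (Icc_subset_timeInterval ht (Ioo_subset_Icc_self hs)) hne

end QG

end

theorem theorem1 (ℓ c d N : ℝ) (hℓ : 0 < ℓ) (hc : 0 < c) (hd : 0 < d) (hN : 0 ≤ N) :
    ∃ A B : ℝ, ∀ (Ω : QG.Domain) (T : EReal) (θ ψ : ℝ × ℝ → ℝ → ℝ) (a b : ℝ)
      (φ₁ φ₂ : ℝ → ℝ → ℝ),
      QG.IsSolution Ω T θ ψ →
      QG.IsSemiUniformFront T θ a b c φ₁ φ₂ →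
      b - a = ℓ →
      QG.minThickness a b φ₁ φ₂ 0 = d →
      QG.normL1Linf Ω (fun x => θ x 0) = ENNReal.ofReal N →
      ∀ t ∈ QG.timeInterval T,
        Real.exp (-Real.exp (A * t + B)) < QG.minThickness a b φ₁ φ₂ t := by
  have hκ := QG.areaRate_nonneg hℓ.le hc.le hN
  obtain ⟨B₀, hB₀, hinitial⟩ := QG.exists_doubleExp_zero_lt (div_pos hd hc)
  obtain ⟨B, hB⟩ := QG.exists_doubleExp_lt_mul_doubleExp (A := 2 * QG.areaRate ℓ c N + 1)
    (pow_pos hc 2) (by positivity) B₀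
  refine ⟨2 * QG.areaRate ℓ c N + 1, B, fun Ω T θ ψ a b φ₁ φ₂ hS hF hba hδ h0 t ht => ?_⟩
  have hab : a < b := by linarith
  have harea := hF.doubleExp_le_abs_scaledArea hS hc hab hN h0.le hB₀ (hδ ▸ hinitial _) ht
  rw [hba] at harea
  calc _ < c ^ 2 * QG.doubleExp _ B₀ t := hB t ht.1
    _ ≤ c ^ 2 * |QG.scaledArea a b c φ₁ φ₂ t| := mul_le_mul_of_nonneg_left harea (sq_nonneg c)
    _ ≤ QG.minThickness a b φ₁ φ₂ t := hF.mul_abs_scaledArea_le_minThickness hc hab ht
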